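/- Let $\omega_1,\omega_3\in\mathbb C$ be linearly independent over $\mathbb R$, put $\omega_0=0$, $\omega_2=-\omega_1-\omega_3$, and let $\wp$ be the Weierstrass function with periods $2\omega_1,2\omega_3$; put $\Lambda=2\omega_1\mathbb Z+2\omega_3\mathbb Z$, $e_i=\wp(\omega_i)$ $(i=1,2,3)$, $g_2=-4(e_1e_2+e_2e_3+e_3e_1)$, $g_3=4e_1e_2e_3$. Let $M\ge 0$, let $l_0,\dots,l_3\in\mathbb Z_{\ge 0}$, $r_1,\dots,r_M\in\mathbb Z_{>0}$, $s_1,\dots,s_M,E\in\mathbb C$, and let $\delta_1,\dots,\delta_M\in\mathbb C$ satisfy $2\delta_k\notin\Lambda$, with pairwise distinct values $b_k=\wp(\delta_k)$. Put $$v(x)=\sum_{i=0}^3 l_i(l_i+1)\wp(x+\omega_i)+\sum_{k=1}^M\left(\frac{r_k}{2}\Big(\frac{r_k}{2}+1\Big)\big(\wp(x-\delta_k)+\wp(x+\delta_k)\big)+\frac{s_k}{\wp(x)-\wp(\delta_k)}\right).$$ The equation $-f''+v f=Ef$ is equivalent, through $z=\wp(x)$ and $f(x)=\tilde f(z)\prod_{i=1}^3(z-e_i)^{-l_i/2}\prod_{k}(z-b_k)^{-r_k/2}$,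 to the Fuchsian equation $$\tilde f''+\left(\sum_{i=1}^3\frac{\frac12-l_i}{z-e_i}+\sum_{k=1}^M\frac{-r_k}{z-b_k}\right)\tilde f'+\frac{N(N-2l_0-1)z+p+\sum_{k=1}^M\frac{o_k}{z-b_k}}{4(z-e_1)(z-e_2)(z-e_3)}\,\tilde f=0,\qquad(\ast)$$ where $N=\sum_{i=0}^3 l_i+\sum_k r_k$, $$o_k=-s_k+r_k\Big\{\tfrac18 r_k(12b_k^2-g_2)+\tfrac12(4b_k^3-g_2b_k-g_3)\sum_{j\ne k}\tfrac{r_j}{b_k-b_j}+2\big(l_1(b_k-e_2)(b_k-e_3)+l_2(b_k-e_1)(b_k-e_3)+l_3(b_k-e_1)(b_k-e_2)\big)\Big\},$$ $$p=E+\sum_{i=1}^3e_il_i^2-2(l_1l_2e_3+l_2l_3e_1+l_3l_1e_2)-\tfrac12\sum_k b_kr_k^2+2\sum_k\sum_{i=1}^3l_ir_k(e_i+b_k)+2\Big(\sum_kb_kr_k\Big)\Big(\sum_kr_k\Big).$$ Assume that each singular point $z=b_k$ of $(\ast)$ is apparent, i.e. it is a regular singular point, the exponents there are integers and $(\ast)$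 has no logarithmic solution there. If $M=0$, or if $M=1$ and $r_1=1$, then the complex vector space of even doubly-periodic solutions (meromorphic functions $\Xi$ on $\mathbb C$ with $\Xi(-x)=\Xi(x+2\omega_1)=\Xi(x+2\omega_3)=\Xi(x)$) of $$\Xi'''(x)-4\big(v(x)-E\big)\Xi'(x)-2v'(x)\,\Xi(x)=0$$ has dimension exactly one. -/

import Mathlib

open Filter Topology

noncomputable section

namespace FuchsElliptic

/-- The half-periods `ω₀ = 0`, `ω₁`, `ω₂ = -ω₁ - ω₃`, `ω₃`, where the basic periods are
`(2ω₁, 2ω₃)`. Mathlib's `PeriodPair` records full periods: `L.ω₁ = 2ω₁` and `L.ω₂ = 2ω₃`. -/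
def halfPeriod (L : PeriodPair) : Fin 4 → ℂ :=
  ![0, L.ω₁ / 2, -(L.ω₁ / 2) - L.ω₂ / 2, L.ω₂ / 2]

/-- `e_i = ℘(ω_i)`; only the indices `i = 1, 2, 3` are meaningful. -/
def eVal (L : PeriodPair) (i : Fin 4) : ℂ := L.weierstrassP (halfPeriod L i)

/-- `b_k = ℘(δ_k)`. -/
def bVal (L : PeriodPair) {M : ℕ} (δ : Fin M → ℂ) (k : Fin M) : ℂ := L.weierstrassP (δ k)

/-! ### Second order equations, exponents and apparent singularities -/

/-- `f'' + P f' + Q f = 0` at the point `z`. -/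
def SolvesAt (P Q f : ℂ → ℂ) (z : ℂ) : Prop :=
  deriv (deriv f) z + P z * deriv f z + Q z * f z = 0

/-- `a` is a regular singular point (possibly an ordinary one) of `f'' + P f' + Q f = 0`: `P` has
at most a simple pole and `Q` at most a double pole at `a`. -/
def IsRegularSingularPoint (P Q : ℂ → ℂ) (a : ℂ) : Prop :=
  MeromorphicAt P a ∧ MeromorphicAt Q a ∧
    (-1 : WithTop ℤ) ≤ meromorphicOrderAt P a ∧ (-2 : WithTop ℤ) ≤ meromorphicOrderAt Q a

/-- `α` is an exponent of `f'' + P f' + Q f = 0` at `a`, i.e. a root of the characteristic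
polynomial `t² + (p₀ - 1) t + q₀`, where `p₀`, `q₀` are the leading coefficients of
`P = p₀ (z - a)⁻¹ + ⋯` and `Q = q₀ (z - a)⁻² + ⋯`. -/
def IsExponent (P Q : ℂ → ℂ) (a α : ℂ) : Prop :=
  ∃ p₀ q₀ : ℂ, Tendsto (fun z => (z - a) * P z) (𝓝[≠] a) (𝓝 p₀) ∧
    Tendsto (fun z => (z - a) ^ 2 * Q z) (𝓝[≠] a) (𝓝 q₀) ∧
    α ^ 2 + (p₀ - 1) * α + q₀ = 0

/-- The equation `f'' + P f' + Q f = 0` (with integer exponents at `a`) has a logarithmic solution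
at `a`: a solution `u(z) + w(z) log (z - a)` near `a`, off the cut of the logarithm, where `u`, `w`
are meromorphic at `a` and `w` is not identically zero near `a`. -/
def HasLogarithmicSolution (P Q : ℂ → ℂ) (a : ℂ) : Prop :=
  ∃ u w : ℂ → ℂ, MeromorphicAt u a ∧ MeromorphicAt w a ∧
    (¬ ∀ᶠ z in 𝓝[≠] a, w z = 0) ∧
    ∀ᶠ z in 𝓝[≠] a, z - a ∈ Complex.slitPlane →
      SolvesAt P Q (fun y => u y + w y * Complex.log (y - a)) z

/-- `a` is an apparent singularity of `f'' + P f' + Q f = 0`: a regular singular point at which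
the exponents are integers and there is no logarithmic solution. -/
def IsApparent (P Q : ℂ → ℂ) (a : ℂ) : Prop :=
  IsRegularSingularPoint P Q a ∧ (∀ α : ℂ, IsExponent P Q a α → ∃ n : ℤ, α = n) ∧
    ¬ HasLogarithmicSolution P Q a

/-! ### The Fuchsian equation and its elliptic form -/

section Equation

variable (L : PeriodPair) (l : Fin 4 → ℕ) {M : ℕ} (r : Fin M → ℕ) (δ s : Fin M → ℂ) (E : ℂ)

/-- `g₂ = -4 (e₁ e₂ + e₂ e₃ + e₃ e₁)`. -/
def g2 : ℂ :=
  -4 * (eVal L 1 * eVal L 2 + eVal L 2 * eVal L 3 + eVal L 3 * eVal L 1)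

/-- `g₃ = 4 e₁ e₂ e₃`. -/
def g3 : ℂ := 4 * (eVal L 1 * eVal L 2 * eVal L 3)

/-- `N = l₀ + l₁ + l₂ + l₃ + ∑ r_k`. -/
def bigN : ℂ := (∑ i, (l i : ℂ)) + ∑ k, (r k : ℂ)

/-- The residue parameters `o_k` of the Fuchsian equation. -/
def oPar (k : Fin M) : ℂ :=
  -s k + r k *
    ((1 / 8) * r k * (12 * bVal L δ k ^ 2 - g2 L)
      + (1 / 2) * (4 * bVal L δ k ^ 3 - g2 L * bVal L δ k - g3 L)
          * (∑ j ∈ Finset.univ.erase k, (r j : ℂ) / (bVal L δ k - bVal L δ j))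
      + 2 * (l 1 * (bVal L δ k - eVal L 2) * (bVal L δ k - eVal L 3)
            + l 2 * (bVal L δ k - eVal L 1) * (bVal L δ k - eVal L 3)
            + l 3 * (bVal L δ k - eVal L 1) * (bVal L δ k - eVal L 2)))

/-- The accessory parameter `p` of the Fuchsian equation. -/
def pPar : ℂ :=
  E + (eVal L 1 * l 1 ^ 2 + eVal L 2 * l 2 ^ 2 + eVal L 3 * l 3 ^ 2)
    - 2 * (l 1 * l 2 * eVal L 3 + l 2 * l 3 * eVal L 1 + l 3 * l 1 * eVal L 2)
    - (1 / 2) * (∑ k, bVal L δ k * r k ^ 2)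
    + 2 * (∑ k, ∑ i : Fin 3, (l i.succ : ℂ) * r k * (eVal L i.succ + bVal L δ k))
    + 2 * (∑ k, bVal L δ k * r k) * (∑ k, (r k : ℂ))

/-- The coefficient of `d/dz` in the Fuchsian equation. -/
def fuchsP (z : ℂ) : ℂ :=
  (∑ i : Fin 3, (1 / 2 - (l i.succ : ℂ)) / (z - eVal L i.succ))
    + ∑ k, (-(r k : ℂ)) / (z - bVal L δ k)

/-- The zeroth order coefficient of the Fuchsian equation. -/
def fuchsQ (z : ℂ) : ℂ :=
  (bigN l r * (bigN l r - 2 * l 0 - 1) * z + pPar L l r δ E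
      + ∑ k, oPar L l r δ s k / (z - bVal L δ k))
    / (4 * (z - eVal L 1) * (z - eVal L 2) * (z - eVal L 3))

/-- The potential
`v(x) = ∑ l_i (l_i + 1) ℘(x + ω_i)
  + ∑ (r_k/2 (r_k/2 + 1) (℘(x - δ_k) + ℘(x + δ_k)) + s_k / (℘(x) - ℘(δ_k)))`. -/
def potential (x : ℂ) : ℂ :=
  (∑ i, (l i : ℂ) * (l i + 1) * L.weierstrassP (x + halfPeriod L i))
    + ∑ k, ((r k : ℂ) / 2 * ((r k : ℂ) / 2 + 1)
          * (L.weierstrassP (x - δ k) + L.weierstrassP (x + δ k))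
        + s k / (L.weierstrassP x - L.weierstrassP (δ k)))

/-- The points `ω_i` `(i = 0, …, 3)` and `±δ_k`, modulo the period lattice. -/
def singularSet : Set ℂ :=
  {x | (∃ i, x - halfPeriod L i ∈ L.lattice) ∨
    ∃ k, x - δ k ∈ L.lattice ∨ x + δ k ∈ L.lattice}

/-- The complex vector space of even doubly-periodic (meromorphic, periods `2ω₁`, `2ω₃`) solutions
of `Ξ''' - 4 (v - E) Ξ' - 2 v' Ξ = 0`. A solution is holomorphic away from the singular set; it is
given the value `0` on the singular set, so that each meromorphic function is represented once. -/
def evenPeriodicSolutions : Submodule ℂ (ℂ → ℂ) where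
  carrier := {f |
    Meromorphic f ∧
    AnalyticOnNhd ℂ f (singularSet L δ)ᶜ ∧
    (∀ x ∈ singularSet L δ, f x = 0) ∧
    (∀ x, f (-x) = f x) ∧
    (∀ x, f (x + L.ω₁) = f x) ∧
    (∀ x, f (x + L.ω₂) = f x) ∧
    ∀ x ∉ singularSet L δ,
      iteratedDeriv 3 f x - 4 * (potential L l r δ s x - E) * deriv f x
        - 2 * deriv (potential L l r δ s) x * f x = 0}
  zero_mem' := by
    refine ⟨fun x => MeromorphicAt.const 0 x, fun x _ => analyticAt_const, fun _ _ => rfl,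
      fun _ => rfl, fun _ => rfl, fun _ => rfl, fun x _ => ?_⟩
    simp [Pi.zero_def]
  add_mem' := by
    rintro f g ⟨f0, f1, f2, f3, f4, f5, f6⟩ ⟨g0, g1, g2, g3, g4, g5, g6⟩
    refine ⟨fun x => (f0 x).add (g0 x), f1.add g1, fun x hx => ?_, fun x => ?_, fun x => ?_,
      fun x => ?_, fun x hx => ?_⟩
    · simp [f2 x hx, g2 x hx]
    · simp [f3 x, g3 x]
    · simp [f4 x, g4 x]
    · simp [f5 x, g5 x]
    · rw [iteratedDeriv_add (f1 x hx).contDiffAt (g1 x hx).contDiffAt,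
        deriv_add (f1 x hx).differentiableAt (g1 x hx).differentiableAt, Pi.add_apply]
      linear_combination f6 x hx + g6 x hx
  smul_mem' := by
    rintro c f ⟨f0, f1, f2, f3, f4, f5, f6⟩
    refine ⟨fun x => (MeromorphicAt.const c x).smul (f0 x), fun x hx => (f1 x hx).const_smul,
      fun x hx => ?_, fun x => ?_, fun x => ?_, fun x => ?_, fun x hx => ?_⟩
    · simp [f2 x hx]
    · simp [f3 x]
    · simp [f4 x]
    · simp [f5 x]
    · rw [iteratedDeriv_const_smul (f1 x hx).contDiffAt c,
        deriv_const_smul c (f1 x hx).differentiableAt, Pi.smul_apply]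
      simp only [smul_eq_mul]
      linear_combination c * f6 x hx

end Equation

end FuchsElliptic

end

/-!
The dimension is at most one because Wronskians of solutions vanish, and at least one because a
rational function of `℘` solves the equation. Write `u = v - E` for the potential, so that the
equation is `Ξ''' = 4 u Ξ' + 2 u' Ξ`, the symmetric square of `y'' = u y`.

*Uniqueness.* The Wronskian `W` of two solutions solves the same equation
(`deriv_deriv_deriv_wronskian`); it is elliptic and odd. At the half periods the exponents of the
equation are `-2 l`, `1`, `2 l + 2`, so that the odd function `W` vanishes there, and at `±δ` (for
`r = 1`) they are `-1`, `1`, `3`, so that `W` has at most a simple pole. An elliptic function with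
these properties is zero: `W² (℘ - b)² / ∏ (℘ - e_j)` has no poles and vanishes at the origin
(`eventually_eq_zero_of_order`). Hence any two solutions are proportional (`exists_smul_eq`).

*Existence.* In the coordinate `ζ = 1 / (℘ - θ)`, with `θ` generic, the equation has rational
coefficients and its derivation is `√p d/dζ` for a polynomial `p = ∏ (ζ - a_i)` of degree four. Look
for a solution `F / (∏ (ζ - a_i) ^ l_i (ζ - c) ^ r)` with `deg F ≤ d = ∑ l_i + r`, where `c` is the
image of `b`. The third order operator `T` is skew-adjoint (`cubicOp_skew`), so the sum of the
residues of `G · T F` is an alternating form, and it may be taken on polynomials modulo a denominator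
of degree `2 d + 6`. Polynomials of degree at most `d` form an isotropic subspace of dimension
`d + 1`, since infinity is an ordinary point. At each `a_i` the local form lives on a space of odd
dimension `2 l_i + 1`, so it is degenerate; at `c` the local dimension `2 r + 2` is even, and the
nullity is at least two as soon as it is positive, which is the case when no logarithm occurs at `c`.
The rank is therefore at most `2 d`, so some nonzero `F` of degree at most `d` lies in the radical,
and then `T F = 0` for reasons of degree (`exists_ne_zero_of_residueForm_isAlt`,
`exists_cubicOp_eq_zero`).

*Apparent singularities.* For `r = 1` the Fuchsian equation has the exponents `0` and `2` at `b`. The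
solution with exponent `2` is constructed by Frobenius' method (`exists_frobenius_solution`), the
second one by reduction of order; the coefficient of its logarithm vanishes exactly when
`q (A(b) + q) + B(b) = 0`, where `-1 / (z - b) + A` and `q / (z - b) + B` are the coefficients of the
equation (`coeff_condition_of_not_hasLogarithmicSolution`). A computation turns this into the
condition needed at `c` (`halfPeriodPotential_eq_of_isApparent`, `pow_dvd_cubicOp_linear`). For
`M = 0` the point `c` is an arbitrary ordinary point, and `r = 0`.
-/

namespace FuchsElliptic

/-! ### The sum of the finite residues of a rational function -/

section Residue

open Polynomial Module

variable {K : Type*} [Field K]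

/-- For monic `D`, the sum of the residues of `F / D` at the zeros of `D`, read off as the
coefficient of `X ^ (deg D - 1)` in the remainder of `F` modulo `D`. -/
noncomputable def residueSum (D : K[X]) : K[X] →ₗ[K] K :=
  (lcoeff K (D.natDegree - 1)).comp (modByMonicHom D)

lemma residueSum_apply (D F : K[X]) : residueSum D F = (F %ₘ D).coeff (D.natDegree - 1) := rfl

lemma residueSum_eq_zero_of_dvd {D F : K[X]} (hD : D.Monic) (h : D ∣ F) : residueSum D F = 0 := by
  rw [residueSum_apply, (modByMonic_eq_zero_iff_dvd hD).2 h, coeff_zero]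

lemma residueSum_eq_zero_of_natDegree {D F : K[X]} (hD : D.Monic)
    (h : F.natDegree + 1 < D.natDegree) : residueSum D F = 0 := by
  rw [residueSum_apply, (modByMonic_eq_self_iff hD).2 (degree_lt_degree (by omega))]
  exact coeff_eq_zero_of_natDegree_lt (by omega)

/-- Cancelling a common factor does not change the sum of the residues. -/
lemma residueSum_mul_right {D H : K[X]} (hD : D.Monic) (hH : H.Monic) (F : K[X]) :
    residueSum (D * H) (F * H) = residueSum D F := by
  have hmod : F * H %ₘ (D * H) = (F %ₘ D) * H := by
    refine (div_modByMonic_unique (F /ₘ D) _ (hD.mul hH) ⟨?_, ?_⟩).2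
    · linear_combination H * modByMonic_add_div F D
    · rw [degree_mul, degree_mul]
      have := degree_modByMonic_lt F hD
      exact WithBot.add_lt_add_right (by simpa using hH.ne_zero) this
  rw [residueSum_apply, residueSum_apply, hmod, hD.natDegree_mul hH]
  by_cases h1 : D = 1
  · subst h1; simp
  have hpos : 0 < D.natDegree := hD.natDegree_pos.2 h1
  have hlt := natDegree_modByMonic_lt F hD h1
  rw [show D.natDegree + H.natDegree - 1 = (D.natDegree - 1) + H.natDegree by omega,
    coeff_mul_add_eq_of_natDegree_le (by omega) le_rfl, hH.coeff_natDegree, mul_one]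

/-- The residue pairing modulo `D` is perfect. -/
lemma dvd_of_residueSum_eq_zero {D F : K[X]} (hD : D.Monic)
    (h : ∀ G : K[X], G.degree < D.natDegree → residueSum D (G * F) = 0) : D ∣ F := by
  rw [← modByMonic_eq_zero_iff_dvd hD]
  by_contra hne
  set R := F %ₘ D with hR
  have hlt : R.natDegree < D.natDegree :=
    natDegree_lt_natDegree hne (degree_modByMonic_lt F hD)
  -- multiplication by this power of `X` moves the leading coefficient of `R` to degree `deg D - 1`
  have hG := h (X ^ (D.natDegree - 1 - R.natDegree)) (by
    rw [degree_X_pow]; exact_mod_cast (by omega))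
  have hdecomp : X ^ (D.natDegree - 1 - R.natDegree) * F
      = D * (X ^ (D.natDegree - 1 - R.natDegree) * (F /ₘ D))
        + X ^ (D.natDegree - 1 - R.natDegree) * R := by
    linear_combination (-X ^ (D.natDegree - 1 - R.natDegree)) * modByMonic_add_div F D
  rw [hdecomp, map_add, residueSum_eq_zero_of_dvd hD (dvd_mul_right _ _), zero_add,
    residueSum_apply, (modByMonic_eq_self_iff hD).2] at hG
  · have := coeff_X_pow_mul R (D.natDegree - 1 - R.natDegree) R.natDegree
    rw [show R.natDegree + (D.natDegree - 1 - R.natDegree) = D.natDegree - 1 by omega] at this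
    rw [this] at hG
    exact hne (leadingCoeff_eq_zero.1 hG)
  · refine degree_lt_degree ?_
    rw [natDegree_mul (by simp) hne, natDegree_X_pow]
    omega

/-- An exact differential `(J / D)'` has no residues. -/
lemma residueSum_eq_zero_of_exact {D A J : K[X]} (hD : D.Monic)
    (h : D * A = derivative J * D - J * derivative D) : residueSum D A = 0 := by
  by_cases h1 : D = 1
  · subst h1; simp [residueSum_apply]
  have hpos : 0 < D.natDegree := hD.natDegree_pos.2 h1
  -- replacing `J` by its remainder modulo `D` changes `(J / D)'` by the derivative of a polynomial
  rw [← residueSum_mul_right hD hD A, mul_comm A, h]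
  have hJ := modByMonic_add_div J D
  set R := J %ₘ D
  set q := J /ₘ D
  have hlt : R.natDegree < D.natDegree := natDegree_modByMonic_lt J hD h1
  have : derivative J * D - J * derivative D
      = (D * D) * derivative q + (derivative R * D - R * derivative D) := by
    rw [← hJ]; simp only [derivative_add, derivative_mul]; ring
  rw [this, map_add, residueSum_eq_zero_of_dvd (hD.mul hD) (dvd_mul_right _ _), zero_add]
  refine residueSum_eq_zero_of_natDegree (hD.mul hD) ?_
  rw [hD.natDegree_mul hD]
  have h2 : (derivative R * D - R * derivative D).natDegree ≤ R.natDegree + D.natDegree - 1 := by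
    by_cases hR0 : R.natDegree = 0
    · have : derivative R = 0 := by rw [eq_C_of_natDegree_eq_zero hR0, derivative_C]
      rw [this, zero_mul, zero_sub, natDegree_neg]
      refine natDegree_mul_le.trans ?_
      have := natDegree_derivative_le D
      omega
    · refine (natDegree_sub_le _ _).trans (max_le (natDegree_mul_le.trans ?_)
        (natDegree_mul_le.trans ?_))
      · have := natDegree_derivative_le R
        omega
      · have := natDegree_derivative_le D
        omega
  omega

end Residue

/-! ### Alternating forms and isotropic subspaces -/

section Alternating

open Polynomial Module

variable {K V : Type*} [Field K] [AddCommGroup V] [Module K V] [FiniteDimensional K V]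

lemma finrank_even_of_isAlt_of_nondegenerate [CharZero K]
    {B : LinearMap.BilinForm K V} (hB : B.IsAlt) (hnd : B.Nondegenerate) : Even (finrank K V) := by
  by_contra hodd
  rw [Nat.not_even_iff_odd] at hodd
  let b := finBasis K V
  apply (LinearMap.BilinForm.nondegenerate_iff_det_ne_zero b).1 hnd
  set A := (LinearMap.BilinForm.toMatrix b) B
  have hA : A.transpose = -A := by
    ext i j
    simp only [A, Matrix.transpose_apply, Matrix.neg_apply, LinearMap.BilinForm.toMatrix_apply]
    exact (hB.neg_eq _ _).symm
  have h1 : A.det = -A.det := by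
    conv_lhs => rw [← Matrix.det_transpose, hA, Matrix.det_neg]
    simp [hodd.neg_one_pow]
  have h2 : (2 : K) * A.det = 0 := by linear_combination h1
  simpa using h2

/-- The rank of an alternating form is even. -/
lemma even_finrank_add_finrank_ker [CharZero K] {B : LinearMap.BilinForm K V} (hB : B.IsAlt) :
    Even (finrank K V + finrank K (LinearMap.ker B)) := by
  obtain ⟨C, hC⟩ := (LinearMap.ker B).exists_isCompl
  have horth : Disjoint C (B.orthogonal C) := by
    rw [Submodule.disjoint_def]
    intro x hx hx'
    refine (Submodule.disjoint_def.1 hC.disjoint) x ?_ hx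
    rw [LinearMap.mem_ker]
    ext y
    obtain ⟨u, hu, v, hv, rfl⟩ := Submodule.mem_sup.1
      (show y ∈ LinearMap.ker B ⊔ C by rw [hC.sup_eq_top]; trivial)
    have h1 : B x u = 0 := by
      rw [← hB.neg_eq, LinearMap.mem_ker.1 hu]; simp
    have h2 : B x v = 0 := by
      have : B v x = 0 := hx' v hv
      rw [← hB.neg_eq, this]; simp
    simp [h1, h2]
  have hnd := LinearMap.BilinForm.nondegenerate_restrict_of_disjoint_orthogonal B hB.isRefl horth
  have hev := finrank_even_of_isAlt_of_nondegenerate (B := B.restrict C) (fun x => hB x) hnd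
  have := Submodule.finrank_add_eq_of_isCompl hC
  rw [← this]
  obtain ⟨k, hk⟩ := hev
  exact ⟨finrank K (LinearMap.ker B) + k, by omega⟩

/-- An isotropic subspace whose dimension exceeds half the rank of an alternating form meets the
radical of the form. -/
lemma exists_mem_inf_ker_of_isotropic {B : LinearMap.BilinForm K V} (hB : B.IsAlt)
    (W : Submodule K V) (hW : ∀ x ∈ W, ∀ y ∈ W, B x y = 0)
    (hdim : finrank K V < 2 * finrank K W + finrank K (LinearMap.ker B)) :
    ∃ x ∈ W, x ≠ 0 ∧ B x = 0 := by
  have h1 := LinearMap.BilinForm.finrank_add_finrank_orthogonal' (B := B) W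
  have hle : W ⊔ LinearMap.ker B ≤ B.orthogonal W := by
    refine sup_le (fun x hx y hy => hW y hy x hx) (fun x hx y _ => ?_)
    change B y x = 0
    rw [← hB.neg_eq, LinearMap.mem_ker.1 hx]; simp
  have h2 := Submodule.finrank_mono hle
  have h3 := Submodule.finrank_sup_add_finrank_inf_eq W (LinearMap.ker B)
  have hpos : 0 < finrank K (W ⊓ LinearMap.ker B : Submodule K V) := by omega
  obtain ⟨⟨x, hx⟩, hne⟩ := (Module.finrank_pos_iff_exists_ne_zero).1 hpos
  exact ⟨x, hx.1, fun h => hne (Subtype.ext h), LinearMap.mem_ker.1 hx.2⟩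

end Alternating

/-! ### Polynomial kernels of operators with a skew residue form -/

section Kernel

open Polynomial Module

variable {K : Type*} [Field K]

/-- The form `(F, G) ↦ ∑ Res (G · N F / D)` restricted to the multiples of `E`, with `F = E * f` and
`G = E * g`. -/
noncomputable def residueForm (D E : K[X]) (N : K[X] →ₗ[K] K[X]) :
    LinearMap.BilinForm K K[X] :=
  LinearMap.mk₂ K (fun f g => residueSum D (E * g * N (E * f)))
    (fun f f' g => by rw [mul_add, map_add, mul_add, map_add])
    (fun c f g => by rw [mul_smul_comm, map_smul, mul_smul_comm, map_smul])
    (fun f g g' => by rw [mul_add, add_mul, map_add])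
    (fun c f g => by rw [mul_smul_comm, smul_mul_assoc, map_smul])

/-- Subspaces `S v` mapped into `T` by linear maps `j v` whose sum is injective on them. -/
lemma sum_finrank_le_of_sum_injective {ι : Type*} [Fintype ι] [DecidableEq ι] {U : ι → Type*}
    {V : Type*} [∀ v, AddCommGroup (U v)] [∀ v, Module K (U v)] [∀ v, FiniteDimensional K (U v)]
    [AddCommGroup V] [Module K V] [FiniteDimensional K V]
    (S : ∀ v, Submodule K (U v)) (T : Submodule K V) (j : ∀ v, U v →ₗ[K] V)
    (hj : ∀ v, ∀ x ∈ S v, j v x ∈ T)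
    (hinj : ∀ f : ∀ v, U v, (∀ v, f v ∈ S v) → ∑ v, j v (f v) = 0 → ∀ v, f v = 0) :
    ∑ v, finrank K (S v) ≤ finrank K T := by
  let Φ : ((v : ι) → S v) →ₗ[K] V := ∑ v, ((j v).comp (S v).subtype).comp (LinearMap.proj v)
  have hΦ : ∀ f, Φ f = ∑ v, j v (f v) := fun f => by simp [Φ, LinearMap.sum_apply]
  have hT : ∀ f, Φ f ∈ T := fun f => by
    rw [hΦ]; exact Submodule.sum_mem _ fun v _ => hj v _ (f v).2
  have hΦinj : Function.Injective (LinearMap.codRestrict T Φ hT) := by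
    refine (injective_iff_map_eq_zero (LinearMap.codRestrict T Φ hT)).2 fun f hf => ?_
    funext v
    exact Subtype.ext (hinj (fun v => f v) (fun v => (f v).2)
      (by rw [← hΦ]; exact congrArg Subtype.val hf) v)
  rw [← finrank_pi_fintype]
  exact LinearMap.finrank_le_finrank_of_injective hΦinj

/-- If `(F, G) ↦ ∑ Res (G · N F / D)` is alternating, `N` preserves the ideals of the primary
factors of `D`, and the local radicals are large enough, then `N` kills a nonzero polynomial of
degree at most `d`: these polynomials form an isotropic subspace modulo `D`, of dimension more than
half the rank of the form. -/
theorem exists_ne_zero_of_residueForm_isAlt [CharZero K]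
    {ι : Type*} [Fintype ι] [DecidableEq ι] (a : ι → K) (ha : Function.Injective a) (n m : ι → ℕ)
    (N : K[X] →ₗ[K] K[X]) (d e : ℕ)
    (hskew : ∀ F, residueSum (∏ v, (X - C (a v)) ^ n v) (F * N F) = 0)
    (hloc : ∀ v F, (X - C (a v)) ^ n v ∣ F → (X - C (a v)) ^ n v ∣ N F)
    (hdeg : ∀ F : K[X], F.natDegree ≤ d → (N F).natDegree ≤ e)
    (hde : d + e + 2 ≤ ∑ v, n v)
    (hrad : ∀ v, (m v = 1 ∧ Odd (n v)) ∨ (m v = 2 ∧ Even (n v) ∧ ∃ F : K[X],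
      (∏ u ∈ Finset.univ.erase v, (X - C (a u)) ^ n u) ∣ F ∧
      ¬ (X - C (a v)) ^ n v ∣ F ∧ (X - C (a v)) ^ n v ∣ N F))
    (hdim : ∑ v, n v < 2 * (d + 1) + ∑ v, m v) :
    ∃ F : K[X], F ≠ 0 ∧ F.natDegree ≤ d ∧ N F = 0 := by
  set τ : ι → K[X] := fun v => (X - C (a v)) ^ n v with hτ
  set D : K[X] := ∏ v, τ v with hD
  set E : ι → K[X] := fun v => ∏ u ∈ Finset.univ.erase v, τ u with hE
  have hτm : ∀ v, (τ v).Monic := fun v => (monic_X_sub_C _).pow _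
  have hτd : ∀ v, (τ v).natDegree = n v := fun v => by simp [hτ, natDegree_pow]
  have hDm : D.Monic := monic_prod_of_monic _ _ fun v _ => hτm v
  have hEm : ∀ v, (E v).Monic := fun v => monic_prod_of_monic _ _ fun u _ => hτm u
  have hDE : ∀ v, D = τ v * E v := fun v => (Finset.mul_prod_erase _ _ (Finset.mem_univ v)).symm
  have hDd : D.natDegree = ∑ v, n v := by
    rw [hD, natDegree_prod_of_monic _ _ fun v _ => hτm v]; simp [hτd]
  have hcop : ∀ u v, u ≠ v → IsCoprime (τ u) (τ v) := fun u v huv =>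
    (pairwise_coprime_X_sub_C ha huv).pow
  have hDdvd : ∀ F, (∀ v, τ v ∣ F) → D ∣ F := fun F h =>
    Finset.prod_dvd_of_coprime (fun u _ v _ huv => hcop u v huv) fun v _ => h v
  have hτE : ∀ u v, u ≠ v → τ u ∣ E v := fun u v huv =>
    Finset.dvd_prod_of_mem _ (Finset.mem_erase.2 ⟨huv, Finset.mem_univ u⟩)
  have hEcop : ∀ v, IsCoprime (τ v) (E v) := fun v =>
    IsCoprime.prod_right fun u hu => hcop v u (Finset.ne_of_mem_erase hu).symm
  -- the alternating form on all polynomials of degree less than `deg D`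
  let V := degreeLT K (∑ v, n v)
  let B : LinearMap.BilinForm K V := (residueForm D 1 N).restrict V
  have hB : B.IsAlt := fun x => by
    change residueSum D (1 * x * N (1 * x)) = 0
    rw [one_mul]; exact hskew _
  -- the local form at `a v`: multiples of `∏_{u ≠ v} (X - a u) ^ n u` pair through a residue at `a v`
  let Bv : ∀ v, LinearMap.BilinForm K (degreeLT K (n v)) := fun v =>
    (residueForm D (E v) N).restrict (degreeLT K (n v))
  have hBv : ∀ v, (Bv v).IsAlt := fun v x => hskew _
  have hfin : ∀ k, finrank K (degreeLT K k) = k := fun k => by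
    rw [(degreeLTEquiv K k).finrank_eq]; simp
  have : ∀ k, FiniteDimensional K (degreeLT K k) := fun k =>
    LinearEquiv.finiteDimensional (degreeLTEquiv K k).symm
  have hmemker : ∀ v (x : degreeLT K (n v)), x ∈ LinearMap.ker (Bv v) ↔ τ v ∣ N (E v * x) := by
    intro v x
    rw [LinearMap.mem_ker]
    constructor
    · intro h
      refine dvd_of_residueSum_eq_zero (hτm v) fun G hG => ?_
      have hGm : G ∈ degreeLT K (n v) := mem_degreeLT.2 (by rwa [hτd] at hG)
      have h1 : residueSum D (E v * G * N (E v * x)) = 0 := congrArg (fun f => f ⟨G, hGm⟩) h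
      rwa [hDE v, show E v * G * N (E v * x) = G * N (E v * x) * E v by ring,
        residueSum_mul_right (hτm v) (hEm v)] at h1
    · intro h
      ext y
      change residueSum D (E v * y * N (E v * x)) = 0
      refine residueSum_eq_zero_of_dvd hDm ?_
      rw [hDE v, mul_comm (τ v), mul_assoc (E v)]
      exact mul_dvd_mul_left _ (h.mul_left _)
  have hkerfin : ∀ v, m v ≤ finrank K (LinearMap.ker (Bv v)) := by
    intro v
    -- the rank is even, so the nullity has the parity of `n v`
    have hpar := even_finrank_add_finrank_ker (hBv v)
    rw [hfin] at hpar
    rcases hrad v with ⟨hm, hodd⟩ | ⟨hm, hev, F, hF1, hF2, hF3⟩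
    · rw [hm]
      by_contra h0
      rw [show finrank K (LinearMap.ker (Bv v)) = 0 by omega, add_zero] at hpar
      exact (Nat.not_even_iff_odd.2 hodd) hpar
    · obtain ⟨H, rfl⟩ := hF1
      have hHm : H %ₘ τ v ∈ degreeLT K (n v) := mem_degreeLT.2 (by
        have := degree_modByMonic_lt H (hτm v)
        rwa [degree_eq_natDegree (hτm v).ne_zero, hτd] at this)
      have hdec : E v * H = E v * (H %ₘ τ v) + D * (H /ₘ τ v) := by
        rw [hDE v]; linear_combination (-E v) * modByMonic_add_div H (τ v)
      have hmem : (⟨H %ₘ τ v, hHm⟩ : degreeLT K (n v)) ∈ LinearMap.ker (Bv v) := by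
        rw [hmemker]
        have h1 : N (E v * (H %ₘ τ v)) = N (E v * H) - N (D * (H /ₘ τ v)) := by
          rw [hdec, map_add]; ring
        change τ v ∣ N (E v * (H %ₘ τ v))
        rw [h1]
        refine dvd_sub hF3 (hloc v _ ?_)
        rw [hDE v, mul_assoc]
        exact dvd_mul_right _ _
      have hne : (⟨H %ₘ τ v, hHm⟩ : degreeLT K (n v)) ≠ 0 := by
        intro h
        have h0 : H %ₘ τ v = 0 := congrArg Subtype.val h
        exact hF2 (((modByMonic_eq_zero_iff_dvd (hτm v)).1 h0).mul_left _)
      have hpos : 0 < finrank K (LinearMap.ker (Bv v)) :=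
        Module.finrank_pos_iff_exists_ne_zero.2 ⟨⟨_, hmem⟩, fun h => hne (congrArg Subtype.val h)⟩
      rw [hm]
      rcases hpar with ⟨k, hk⟩
      rcases hev with ⟨j, hj⟩
      omega
  -- the local radicals embed into the radical
  have hEdeg : ∀ v, (E v).natDegree + n v = ∑ u, n u := by
    intro v
    rw [← hDd, hDE v, (hτm v).natDegree_mul (hEm v), hτd, add_comm]
  have hΦV : ∀ v (x : degreeLT K (n v)), E v * (x : K[X]) ∈ V := by
    intro v x
    rw [mem_degreeLT]
    by_cases hx : (x : K[X]) = 0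
    · rw [hx, mul_zero, degree_zero]; exact WithBot.bot_lt_coe _
    have h1 := mem_degreeLT.1 x.2
    rw [degree_eq_natDegree hx] at h1
    have h1' : (x : K[X]).natDegree < n v := by exact_mod_cast h1
    rw [degree_eq_natDegree (mul_ne_zero (hEm v).ne_zero hx),
      natDegree_mul (hEm v).ne_zero hx]
    have := hEdeg v
    exact_mod_cast (by omega : (E v).natDegree + (x : K[X]).natDegree < ∑ u, n u)
  have hker : ∑ v, m v ≤ finrank K (LinearMap.ker B) := by
    refine (Finset.sum_le_sum fun v _ => hkerfin v).trans
      (sum_finrank_le_of_sum_injective (fun v => LinearMap.ker (Bv v)) (LinearMap.ker B)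
      (fun v => LinearMap.codRestrict V
        ((LinearMap.mulLeft K (E v)).comp (degreeLT K (n v)).subtype) (hΦV v)) ?_ ?_)
    · intro v x hx
      rw [LinearMap.mem_ker]
      ext y
      change residueSum D (1 * (y : K[X]) * N (1 * (E v * (x : K[X])))) = 0
      refine residueSum_eq_zero_of_dvd hDm (Dvd.dvd.mul_left (hDdvd _ fun u => ?_) _)
      rw [one_mul]
      by_cases huv : u = v
      · subst huv
        exact (hmemker u _).1 hx
      · exact hloc u _ ((hτE u v huv).mul_right _)
    · intro f _ hf v
      have hsum : ∑ v, E v * (f v : K[X]) = 0 := by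
        have := congrArg Subtype.val hf
        rwa [Submodule.coe_sum] at this
      have hdvd : τ v ∣ E v * (f v : K[X]) := by
        rw [← Finset.add_sum_erase _ _ (Finset.mem_univ v)] at hsum
        rw [eq_neg_of_add_eq_zero_left hsum, dvd_neg]
        exact Finset.dvd_sum fun u hu =>
          (hτE v u (Finset.ne_of_mem_erase hu).symm).mul_right _
      have h2 := (hEcop v).dvd_of_dvd_mul_left hdvd
      refine Subtype.ext (eq_zero_of_dvd_of_degree_lt h2 ?_)
      rw [degree_eq_natDegree (hτm v).ne_zero, hτd]
      exact mem_degreeLT.1 (f v).2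
  -- polynomials of degree at most `d` are isotropic, since `G · N F / D` has no residue at infinity
  let W : Submodule K V := (degreeLT K (d + 1)).comap V.subtype
  have hWV : degreeLT K (d + 1) ≤ V := degreeLT_mono (by omega)
  have hWfin : finrank K W = d + 1 := by
    rw [(Submodule.comapSubtypeEquivOfLe hWV).finrank_eq, hfin]
  have hWdeg : ∀ x ∈ W, ((x : V) : K[X]).natDegree ≤ d := by
    intro x hx
    have : (x : K[X]).degree < ((d + 1 : ℕ) : WithBot ℕ) := mem_degreeLT.1 hx
    by_cases h0 : (x : K[X]) = 0
    · simp [h0]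
    rw [degree_eq_natDegree h0] at this
    have : (x : K[X]).natDegree < d + 1 := by exact_mod_cast this
    omega
  obtain ⟨x, hxW, hx0, hxB⟩ := exists_mem_inf_ker_of_isotropic hB W (by
    intro x hx y hy
    change residueSum D (1 * (y : K[X]) * N (1 * x)) = 0
    rw [one_mul, one_mul]
    refine residueSum_eq_zero_of_natDegree hDm ?_
    have h1 := natDegree_mul_le (p := (y : K[X])) (q := N x)
    have h2 := hWdeg y hy
    have h3 := hdeg _ (hWdeg x hx)
    omega) (by rw [hfin, hWfin]; omega)
  refine ⟨x, fun h => hx0 (Subtype.ext h), hWdeg x hxW, ?_⟩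
  -- `x` lies in the radical, so `D` divides `N x`, which has smaller degree
  have hdvd : D ∣ N x := by
    refine dvd_of_residueSum_eq_zero hDm fun G hG => ?_
    have hGm : G ∈ V := mem_degreeLT.2 (by rwa [hDd] at hG)
    have h1 : residueSum D (1 * G * N (1 * (x : K[X]))) = 0 :=
      congrArg (fun f => f ⟨G, hGm⟩) hxB
    simpa using h1
  by_contra hne
  have h1 := natDegree_le_of_dvd hdvd hne
  have h2 := hdeg _ (hWdeg x hxW)
  omega

end Kernel

/-! ### The third order operator on polynomials -/

section CubicOp

open Polynomial Module

variable {K : Type*} [Field K]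

/-- The numerator of a derivative: if `h' / h = ν / g`, then the derivative of `A h / g ^ k` is
`twistedDeriv g ν k A * h / g ^ (k + 1)`. -/
noncomputable def twistedDeriv (g ν : K[X]) (k : ℕ) (A : K[X]) : K[X] :=
  derivative A * g + (ν - k * derivative g) * A

/-- The operator `p X''' + 3/2 p' X'' + 1/2 p'' X' - 4 W X' - 2 W' X`, with `W = w / (p τ²)`, in the
gauge `X = F h`, `h' / h = ν / (p τ)`, multiplied by `2 p² τ³ / h` (where `τ' = 1`). It is the symmetric square of
the second order equation, written in a coordinate in which the invariant differential is
`dz / √p`. -/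
noncomputable def cubicOp (p τ w ν F : K[X]) : K[X] :=
  2 * twistedDeriv (p * τ) ν 2 (twistedDeriv (p * τ) ν 1 (twistedDeriv (p * τ) ν 0 F))
    + 3 * derivative p * τ * twistedDeriv (p * τ) ν 1 (twistedDeriv (p * τ) ν 0 F)
    + (p * derivative (derivative p) * τ ^ 2 - 8 * w) * twistedDeriv (p * τ) ν 0 F
    - 4 * (derivative w * (p * τ) - w * (derivative p * τ + 2 * p)) * F

lemma twistedDeriv_add (g ν : K[X]) (k : ℕ) (A B : K[X]) :
    twistedDeriv g ν k (A + B) = twistedDeriv g ν k A + twistedDeriv g ν k B := by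
  simp only [twistedDeriv, derivative_add]; ring

lemma twistedDeriv_C_mul (g ν : K[X]) (k : ℕ) (c : K) (A : K[X]) :
    twistedDeriv g ν k (C c * A) = C c * twistedDeriv g ν k A := by
  simp only [twistedDeriv, derivative_C_mul]; ring

lemma twistedDeriv_mul {g ν e χ : K[X]} (he : g * derivative e = χ * e) (k : ℕ) (A : K[X]) :
    twistedDeriv g ν k (e * A) = e * twistedDeriv g (ν + χ) k A := by
  simp only [twistedDeriv, derivative_mul]; linear_combination A * he

lemma cubicOp_add (p τ w ν F G : K[X]) :
    cubicOp p τ w ν (F + G) = cubicOp p τ w ν F + cubicOp p τ w ν G := by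
  simp only [cubicOp, twistedDeriv_add]; ring

lemma cubicOp_C_mul (p τ w ν : K[X]) (c : K) (F : K[X]) :
    cubicOp p τ w ν (C c * F) = C c * cubicOp p τ w ν F := by
  simp only [cubicOp, twistedDeriv_C_mul]; ring

lemma cubicOp_sub (p τ w ν F G : K[X]) :
    cubicOp p τ w ν (F - G) = cubicOp p τ w ν F - cubicOp p τ w ν G := by
  have h := cubicOp_C_mul p τ w ν (-1 : K) G
  rw [map_neg, map_one, neg_one_mul, neg_one_mul] at h
  rw [sub_eq_add_neg, cubicOp_add, h, sub_eq_add_neg]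

/-- Change of gauge: a factor `e` of `F`, with logarithmic derivative `χ / (p τ)`, is moved into `h`. -/
lemma cubicOp_mul {p τ e χ : K[X]} (he : p * τ * derivative e = χ * e) (w ν F : K[X]) :
    cubicOp p τ w ν (e * F) = e * cubicOp p τ w (ν + χ) F := by
  simp only [cubicOp, twistedDeriv_mul he]; ring

/-- The polarisation of the quadratic first integral of the third order operator, which in terms of
the derivation `∂ = √p d/dz` is `2 X ∂²X - (∂X)² - 4 W X²`. Common denominators are cleared, and the
gauge factor is dropped. -/
noncomputable def bilinearConcomitant (p τ w ν F G : K[X]) : K[X] :=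
  2 * (G * twistedDeriv (p * τ) ν 1 (twistedDeriv (p * τ) ν 0 F)
      + F * twistedDeriv (p * τ) ν 1 (twistedDeriv (p * τ) ν 0 G)
      - twistedDeriv (p * τ) ν 0 F * twistedDeriv (p * τ) ν 0 G)
    + derivative p * τ * (G * twistedDeriv (p * τ) ν 0 F + F * twistedDeriv (p * τ) ν 0 G)
    - 8 * w * F * G

/-- The operator `T` is skew-adjoint: `G · T F + F · T G` is an exact derivative. -/
lemma cubicOp_skew {p τ : K[X]} (hτ : derivative τ = 1) (w ν F G : K[X]) :
    G * cubicOp p τ w ν F + F * cubicOp p τ w ν G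
      = p * τ * derivative (bilinearConcomitant p τ w ν F G)
        + (2 * ν - (derivative p * τ + 2 * p)) * bilinearConcomitant p τ w ν F G := by
  have key : ∀ k A, p * τ * derivative A
      = twistedDeriv (p * τ) ν k A - (ν - k * (derivative p * τ + p)) * A := by
    intro k A
    simp only [twistedDeriv, derivative_mul, hτ]; ring
  have f0 := key 0 F
  have g0 := key 0 G
  have f1 := key 1 (twistedDeriv (p * τ) ν 0 F)
  have g1 := key 1 (twistedDeriv (p * τ) ν 0 G)
  have f2 := key 2 (twistedDeriv (p * τ) ν 1 (twistedDeriv (p * τ) ν 0 F))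
  have g2 := key 2 (twistedDeriv (p * τ) ν 1 (twistedDeriv (p * τ) ν 0 G))
  simp only [cubicOp, bilinearConcomitant]
  generalize twistedDeriv (p * τ) ν 2 (twistedDeriv (p * τ) ν 1 (twistedDeriv (p * τ) ν 0 F)) = F3
    at *
  generalize twistedDeriv (p * τ) ν 2 (twistedDeriv (p * τ) ν 1 (twistedDeriv (p * τ) ν 0 G)) = G3
    at *
  generalize twistedDeriv (p * τ) ν 1 (twistedDeriv (p * τ) ν 0 F) = F2 at *
  generalize twistedDeriv (p * τ) ν 1 (twistedDeriv (p * τ) ν 0 G) = G2 at *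
  generalize twistedDeriv (p * τ) ν 0 F = F1 at *
  generalize twistedDeriv (p * τ) ν 0 G = G1 at *
  simp only [derivative_add, derivative_sub, derivative_mul, derivative_ofNat, hτ]
  push_cast at *
  linear_combination (-(2 * G2) - derivative p * τ * G1 + 8 * w * G) * f0
    + (-(2 * F2) - derivative p * τ * F1 + 8 * w * F) * g0
    + (2 * G1 - derivative p * τ * G) * f1 + (2 * F1 - derivative p * τ * F) * g1
    - 2 * G * f2 - 2 * F * g2

/-- The value at a zero of `p τ` is the indicial polynomial. -/
lemma eval_cubicOp {p τ : K[X]} (w ν F : K[X]) {x : K}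
    (hx : (p * τ).eval x = 0) :
    (cubicOp p τ w ν F).eval x = F.eval x *
      (2 * (ν.eval x * (ν.eval x - (derivative (p * τ)).eval x)
          * (ν.eval x - 2 * (derivative (p * τ)).eval x))
        + 3 * ((derivative p).eval x * τ.eval x)
          * (ν.eval x * (ν.eval x - (derivative (p * τ)).eval x))
        + (p.eval x * (derivative (derivative p)).eval x * τ.eval x ^ 2 - 8 * w.eval x) * ν.eval x
        + 4 * (w.eval x * ((derivative p).eval x * τ.eval x + 2 * p.eval x))) := by
  have key : ∀ k A, (twistedDeriv (p * τ) ν k A).eval x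
      = (ν.eval x - k * (derivative (p * τ)).eval x) * A.eval x := by
    intro k A
    simp only [twistedDeriv, eval_add, eval_mul (p := derivative A), hx]
    simp
  have hx' : p.eval x * τ.eval x = 0 := by simpa using hx
  simp only [cubicOp, eval_add, eval_sub, eval_mul (p := 2), eval_mul (p := 3 * derivative p * τ),
    eval_mul (p := 4 * _), eval_mul (p := _ - _), key]
  simp only [eval_mul, eval_sub, eval_ofNat, eval_pow, eval_add]
  push_cast
  linear_combination (-4 * (derivative w).eval x * F.eval x) * hx'

end CubicOp

/-! ### Behaviour of the third order operator at infinity -/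

section Degree

open Polynomial Module

variable {K : Type*} [Field K]

/-- The degree drops by one more than expected when the leading coefficients cancel. -/
lemma natDegree_derivative_mul_add_le {g ψ A : K[X]} {a m : ℕ} (hg : g.natDegree ≤ m + 1)
    (hψ : ψ.natDegree ≤ m) (hA : A.natDegree ≤ a) (h : a * g.coeff (m + 1) + ψ.coeff m = 0) :
    (derivative A * g + ψ * A).natDegree ≤ a + m - 1 := by
  have hcoeff : (derivative A * g + ψ * A).coeff (a + m) = 0 := by
    have h2 : (ψ * A).coeff (a + m) = ψ.coeff m * A.coeff a := by
      rw [add_comm, coeff_mul_add_eq_of_natDegree_le hψ hA]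
    rw [coeff_add, h2]
    rcases a with _ | a
    · have : derivative A = 0 := by
        rw [eq_C_of_natDegree_eq_zero (Nat.le_zero.1 hA), derivative_C]
      rw [this]
      simp only [Nat.cast_zero, zero_mul, zero_add] at h
      simp [h]
    · have hA' : (derivative A).natDegree ≤ a := by
        have := natDegree_derivative_le A
        omega
      have h1 : (derivative A * g).coeff (a + 1 + m) = (derivative A).coeff a * g.coeff (m + 1) := by
        rw [show a + 1 + m = a + (m + 1) by ring, coeff_mul_add_eq_of_natDegree_le hA' hg]
      rw [h1, coeff_derivative]
      push_cast at h
      linear_combination A.coeff (a + 1) * h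
  have hle : (derivative A * g + ψ * A).natDegree ≤ a + m := by
    refine (natDegree_add_le _ _).trans (max_le ?_ ?_)
    · by_cases ha : A.natDegree = 0
      · rw [eq_C_of_natDegree_eq_zero ha, derivative_C]; simp
      · refine natDegree_mul_le.trans ?_
        have := natDegree_derivative_le A
        omega
    · exact natDegree_mul_le.trans (by omega)
  rw [natDegree_le_iff_coeff_eq_zero]
  intro k hk
  by_cases hk' : k = a + m
  · rw [hk', hcoeff]
  · exact coeff_eq_zero_of_natDegree_lt (by omega)

lemma natDegree_derivative_le_of_le {A : K[X]} {a : ℕ} (hA : A.natDegree ≤ a + 1) :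
    (derivative A).natDegree ≤ a := by
  have := natDegree_derivative_le A
  omega

/-- `X` regular at infinity is mapped to a function with a double zero at infinity: infinity is
an ordinary point. -/
lemma natDegree_cubicOp_le {p τ w ν F : K[X]} {d : ℕ} (hp : p.Monic) (hp4 : p.natDegree = 4)
    (hτm : τ.Monic) (hτ1 : τ.natDegree = 1) (hτ : derivative τ = 1) (hw : w.natDegree ≤ 6)
    (hν : ν.natDegree ≤ 4) (hνc : ν.coeff 4 = -d) (hF : F.natDegree ≤ d) :
    (cubicOp p τ w ν F).natDegree ≤ d + 9 := by
  have hg : (p * τ).Monic := hp.mul hτm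
  have hg5 : (p * τ).natDegree = 5 := by rw [hp.natDegree_mul hτm, hp4, hτ1]
  have hgc : (p * τ).coeff 5 = 1 := by rw [← hg5]; exact hg.coeff_natDegree
  have hpc : p.coeff 4 = 1 := by rw [← hp4]; exact hp.coeff_natDegree
  have hτc : τ.coeff 1 = 1 := by rw [← hτ1]; exact hτm.coeff_natDegree
  have hg' : (derivative (p * τ)).natDegree ≤ 4 := natDegree_derivative_le_of_le hg5.le
  have hg'c : (derivative (p * τ)).coeff 4 = 5 := by
    rw [coeff_derivative, hgc]; norm_num
  have hp' : (derivative p).natDegree ≤ 3 := natDegree_derivative_le_of_le hp4.le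
  have hp'c : (derivative p).coeff 3 = 4 := by
    rw [coeff_derivative, hpc]; norm_num
  have hF1 : (twistedDeriv (p * τ) ν 0 F).natDegree ≤ d + 3 := by
    refine natDegree_derivative_mul_add_le (m := 4) hg5.le ?_ hF ?_
    · simpa using hν
    · rw [hgc]; simp [hνc]
  have hnat : ∀ k : ℕ, ((k : K[X]) * derivative (p * τ)).natDegree ≤ 4 := fun k => by
    refine natDegree_mul_le.trans ?_
    rw [natDegree_natCast]; omega
  have hnatc : ∀ k : ℕ, ((k : K[X]) * derivative (p * τ)).coeff 4 = k * 5 := fun k => by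
    rw [coeff_natCast_mul, hg'c]
  have hνk : ∀ k : ℕ, (ν - k * derivative (p * τ)).natDegree ≤ 4 := fun k =>
    (natDegree_sub_le _ _).trans (max_le hν (hnat k))
  have hνkc : ∀ k : ℕ, (ν - k * derivative (p * τ)).coeff 4 = -d - k * 5 := fun k => by
    rw [coeff_sub, hνc, hnatc]
  set F1 := twistedDeriv (p * τ) ν 0 F with hF1def
  set F2 := twistedDeriv (p * τ) ν 1 F1 with hF2def
  set Y := derivative F1 * (2 * (p * (p * τ)))
    + (2 * (p * (ν - (1 : ℕ) * derivative (p * τ))) + derivative p * (p * τ)) * F1 with hY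
  have h2 : ∀ (A : K[X]) (k : ℕ), A.natDegree ≤ k → (2 * A).natDegree ≤ k := fun A k h => by
    refine natDegree_mul_le.trans ?_
    rw [show (2 : K[X]) = C 2 from rfl, natDegree_C]; omega
  have h2c : ∀ (A : K[X]) (k : ℕ), (2 * A).coeff k = 2 * A.coeff k := fun A k => by
    rw [show (2 : K[X]) = C 2 from rfl, coeff_C_mul]
  have hYd : Y.natDegree ≤ d + 3 + 8 - 1 := by
    refine natDegree_derivative_mul_add_le ?_ ?_ hF1 ?_
    · exact h2 _ _ (natDegree_mul_le.trans (by omega))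
    · refine (natDegree_add_le _ _).trans (max_le (h2 _ _ ?_) ?_)
      · exact natDegree_mul_le.trans (by have := hνk 1; omega)
      · exact natDegree_mul_le.trans (by omega)
    · rw [coeff_add, h2c, h2c, show 8 + 1 = 4 + 5 by norm_num,
        coeff_mul_add_eq_of_natDegree_le hp4.le hg5.le, show 8 = 4 + 4 by norm_num,
        coeff_mul_add_eq_of_natDegree_le hp4.le (hνk 1), hνkc, show 4 + 4 = 3 + 5 by norm_num,
        coeff_mul_add_eq_of_natDegree_le hp' hg5.le, hpc, hgc, hp'c]
      push_cast; ring
  have hF4 : (derivative Y * (p * τ) + (ν - (2 : ℕ) * derivative (p * τ)) * Y).natDegree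
      ≤ d + 10 + 4 - 1 := by
    refine natDegree_derivative_mul_add_le hg5.le (hνk 2) (by omega) ?_
    rw [hgc, hνkc]; push_cast; ring
  have hw' : (derivative w * (p * τ) + (-(derivative p * τ + 2 * p)) * w).natDegree
      ≤ 6 + 4 - 1 := by
    refine natDegree_derivative_mul_add_le hg5.le ?_ hw ?_
    · rw [natDegree_neg]
      refine (natDegree_add_le _ _).trans (max_le (natDegree_mul_le.trans (by omega)) (h2 _ _ hp4.le))
    · rw [hgc, coeff_neg, coeff_add, h2c, show 4 = 3 + 1 by norm_num,
        coeff_mul_add_eq_of_natDegree_le hp' hτ1.le, hp'c, hτc, hpc]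
      push_cast; ring
  -- `Y / p` represents the second derivative `∂²X` for `∂ = √p d/dz`, so each of the three
  -- differentiations lowers the degree by one more than its terms show
  have hrel : p * cubicOp p τ w ν F
      = (derivative Y * (p * τ) + (ν - (2 : ℕ) * derivative (p * τ)) * Y)
        - p * (2 * (2 * (2 * (w * F1)))
          + 2 * (2 * ((derivative w * (p * τ) + (-(derivative p * τ + 2 * p)) * w) * F))) := by
    have hY2 : Y = 2 * (p * F2) + derivative p * (p * τ) * F1 := by
      rw [hY, hF2def, twistedDeriv]; push_cast; ring
    have hF2e : F2 = derivative F1 * (p * τ) + (ν - derivative (p * τ)) * F1 := by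
      rw [hF2def, twistedDeriv]; push_cast; ring
    rw [cubicOp, ← hF1def, ← hF2def, hY2, twistedDeriv]
    simp only [derivative_add, derivative_mul, hτ, derivative_ofNat] at hF2e ⊢
    push_cast
    linear_combination (derivative p * p * τ) * hF2e
  by_cases hT : cubicOp p τ w ν F = 0
  · rw [hT]; simp
  have hdeg := congrArg natDegree hrel
  rw [natDegree_mul hp.ne_zero hT, hp4] at hdeg
  have hle : (cubicOp p τ w ν F).natDegree + 4 ≤ d + 13 := by
    rw [add_comm, hdeg]
    refine (natDegree_sub_le _ _).trans (max_le hF4 (natDegree_mul_le.trans ?_))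
    have : (2 * (2 * (2 * (w * F1)))
          + 2 * (2 * ((derivative w * (p * τ) + (-(derivative p * τ + 2 * p)) * w) * F))).natDegree
        ≤ d + 9 := by
      refine (natDegree_add_le _ _).trans (max_le (h2 _ _ (h2 _ _ (h2 _ _ ?_))) (h2 _ _ (h2 _ _ ?_)))
      · exact natDegree_mul_le.trans (by omega)
      · exact natDegree_mul_le.trans (by omega)
    omega
  omega

end Degree

/-! ### Logarithmic derivatives of products of linear factors -/

section LogDeriv

open Polynomial Module

variable {K ι : Type*} [Field K] [Fintype ι] [DecidableEq ι]

/-- The numerator of `∑ k_v / (X - a_v)` over the common denominator `∏ (X - a_v)`. -/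
noncomputable def logDerivNum (a : ι → K) (k : ι → K) : K[X] :=
  ∑ v, C (k v) * ∏ u ∈ Finset.univ.erase v, (X - C (a u))

lemma logDerivNum_add (a k k' : ι → K) :
    logDerivNum a (k + k') = logDerivNum a k + logDerivNum a k' := by
  simp only [logDerivNum, Pi.add_apply, C_add, add_mul, Finset.sum_add_distrib]

lemma logDerivNum_neg (a k : ι → K) : logDerivNum a (-k) = -logDerivNum a k := by
  simp only [logDerivNum, Pi.neg_apply, C_neg, neg_mul, Finset.sum_neg_distrib]

lemma prod_mul_derivative_prod_pow (a : ι → K) (m : ι → ℕ) :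
    (∏ v, (X - C (a v))) * derivative (∏ v, (X - C (a v)) ^ m v)
      = logDerivNum a (fun v => (m v : K)) * ∏ v, (X - C (a v)) ^ m v := by
  rw [derivative_prod_finset, Finset.mul_sum, logDerivNum, Finset.sum_mul]
  refine Finset.sum_congr rfl fun v _ => ?_
  rw [← Finset.mul_prod_erase _ (fun v => X - C (a v)) (Finset.mem_univ v),
    ← Finset.mul_prod_erase _ (fun v => (X - C (a v)) ^ m v) (Finset.mem_univ v)]
  rcases hm : m v with _ | k
  · simp
  · rw [derivative_X_sub_C_pow]
    simp only [Nat.cast_add, Nat.cast_one, map_add, map_natCast, map_one, Nat.add_sub_cancel]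
    ring

lemma eval_logDerivNum (a k : ι → K) (v : ι) :
    (logDerivNum a k).eval (a v) = k v * ∏ u ∈ Finset.univ.erase v, (a v - a u) := by
  rw [logDerivNum, eval_finsetSum, Finset.sum_eq_single v]
  · simp [eval_prod]
  · intro u _ huv
    rw [eval_mul, eval_prod, Finset.prod_eq_zero (i := v) (by simp [huv.symm]) (by simp), mul_zero]
  · simp

lemma derivative_prod_X_sub_C (a : ι → K) :
    derivative (∏ v, (X - C (a v))) = logDerivNum a 1 := by
  rw [derivative_prod_finset, logDerivNum]
  refine Finset.sum_congr rfl fun v _ => ?_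
  simp

lemma natDegree_logDerivNum_le (a k : ι → K) {m : ℕ} (hm : Fintype.card ι = m + 1) :
    (logDerivNum a k).natDegree ≤ m := by
  refine natDegree_sum_le_of_forall_le _ _ fun v _ => (natDegree_C_mul_le _ _).trans ?_
  rw [natDegree_prod_of_monic _ _ fun u _ => monic_X_sub_C _]
  simp [Finset.card_erase_of_mem, hm]

lemma coeff_logDerivNum (a k : ι → K) {m : ℕ} (hm : Fintype.card ι = m + 1) :
    (logDerivNum a k).coeff m = ∑ v, k v := by
  rw [logDerivNum, finsetSum_coeff]
  refine Finset.sum_congr rfl fun v _ => ?_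
  have hmon : (∏ u ∈ Finset.univ.erase v, (X - C (a u))).Monic :=
    monic_prod_of_monic _ _ fun u _ => monic_X_sub_C _
  have hdeg : (∏ u ∈ Finset.univ.erase v, (X - C (a u))).natDegree = m := by
    rw [natDegree_prod_of_monic _ _ fun u _ => monic_X_sub_C _]
    simp [Finset.card_erase_of_mem, hm]
  rw [coeff_C_mul, ← hdeg, hmon.coeff_natDegree, mul_one]

end LogDeriv

/-! ### Existence of a polynomial solution -/

section Existence

open Polynomial Module

/-- The five finite singular points: `none` stands for `c`, and `some i` for `a i`. -/
def roots (a : Fin 4 → ℂ) (c : ℂ) : Option (Fin 4) → ℂ := fun o => o.elim c a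

/-- The orders of the denominator of the solution at the five finite singular points. -/
def mult (l : Fin 4 → ℕ) (r : ℕ) : Option (Fin 4) → ℕ := fun o => o.elim r l

/-- The numerator of the logarithmic derivative of `∏ (X - a_i) ^ (-l_i) (X - c) ^ (-r)`. -/
noncomputable def gauge (a : Fin 4 → ℂ) (c : ℂ) (l : Fin 4 → ℕ) (r : ℕ) : ℂ[X] :=
  -logDerivNum (roots a c) (fun v => (mult l r v : ℂ))

lemma prod_roots (a : Fin 4 → ℂ) (c : ℂ) :
    ∏ v, (X - C (roots a c v)) = (∏ i, (X - C (a i))) * (X - C c) := by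
  rw [Fintype.prod_option, mul_comm]; rfl

lemma roots_injective {a : Fin 4 → ℂ} {c : ℂ} (ha : Function.Injective a) (hc : ∀ i, a i ≠ c) :
    Function.Injective (roots a c) := by
  rintro (_ | i) (_ | j) h
  · rfl
  · exact absurd h.symm (hc j)
  · exact absurd h (hc i)
  · exact congrArg some (ha h)

variable {a : Fin 4 → ℂ} {c : ℂ} {l : Fin 4 → ℕ} {r : ℕ} {w : ℂ[X]}

/-- At the zeros `a_i` of `p` the indicial roots are `-l_i` and `l_i + 1` (and `1 / 2`), at the zero
`c` of `τ` they are `-r`, `r + 2` (and `1`). -/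
lemma eval_cubicOp_logDerivNum_eq_zero
    (hwa : ∀ i, 4 * w.eval (a i) = l i * (l i + 1) *
      ((derivative (∏ i, (X - C (a i)))).eval (a i) * (a i - c)) ^ 2)
    (hwc : 4 * w.eval c = r * (r + 2) * ((∏ i, (X - C (a i))).eval c) ^ 2)
    (v : Option (Fin 4)) (k : Option (Fin 4) → ℂ)
    (hk : k v = -(mult l r v : ℂ) ∨ k v = v.elim (r + 2 : ℂ) (fun i => l i + 1)) (F : ℂ[X]) :
    (cubicOp (∏ i, (X - C (a i))) (X - C c) w (logDerivNum (roots a c) k) F).eval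
      (roots a c v) = 0 := by
  have hx : ((∏ i, (X - C (a i))) * (X - C c)).eval (roots a c v) = 0 := by
    rw [← prod_roots, eval_prod]
    exact Finset.prod_eq_zero (Finset.mem_univ v) (by simp)
  have hν : (logDerivNum (roots a c) k).eval (roots a c v)
      = k v * (derivative ((∏ i, (X - C (a i))) * (X - C c))).eval (roots a c v) := by
    rw [← prod_roots, derivative_prod_X_sub_C, eval_logDerivNum, eval_logDerivNum]; simp
  have hg' : (derivative ((∏ i, (X - C (a i))) * (X - C c))).eval (roots a c v)
      = (derivative (∏ i, (X - C (a i)))).eval (roots a c v) * (roots a c v - c)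
        + (∏ i, (X - C (a i))).eval (roots a c v) := by
    rw [derivative_mul]; simp
  rw [eval_cubicOp _ _ _ hx, hν]
  rcases v with _ | i
  · have h1 : roots a c none = c := rfl
    simp only [h1, sub_self, mul_zero, zero_add] at hg'
    simp only [h1, hg', eval_sub, eval_X, eval_C, sub_self] at hwc ⊢
    have h2 : (mult l r none : ℂ) = r := rfl
    simp only [h2, Option.elim_none] at hk
    apply mul_eq_zero_of_right
    rcases hk with hk | hk <;> rw [hk]
    · linear_combination (2 * r + 2) * (∏ i, (X - C (a i))).eval c * hwc
    · linear_combination (-2 * (r + 1)) * (∏ i, (X - C (a i))).eval c * hwc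
  · have h1 : roots a c (some i) = a i := rfl
    have hp : (∏ i, (X - C (a i))).eval (a i) = 0 := by
      rw [eval_prod]; exact Finset.prod_eq_zero (Finset.mem_univ i) (by simp)
    have hwi := hwa i
    simp only [h1, hp, add_zero] at hg'
    simp only [h1, hg', hp, eval_sub, eval_X, eval_C]
    have h2 : (mult l r (some i) : ℂ) = l i := rfl
    simp only [h2, Option.elim_some] at hk
    apply mul_eq_zero_of_right
    rcases hk with hk | hk <;> rw [hk]
    · linear_combination (2 * l i + 1) * ((derivative (∏ i, (X - C (a i)))).eval (a i) * (a i - c))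
        * hwi
    · linear_combination (-2 * l i - 1) * ((derivative (∏ i, (X - C (a i)))).eval (a i) * (a i - c))
        * hwi

lemma cubicOp_sub_X_sub_C_pow_mul (p : ℂ[X]) (c : ℂ) (w ν F G : ℂ[X]) (k : ℕ) :
    cubicOp p (X - C c) w ν (F - (X - C c) ^ k * G) = cubicOp p (X - C c) w ν F
      - (X - C c) ^ k * cubicOp p (X - C c) w (ν + (k : ℂ[X]) * p) G := by
  have he : p * (X - C c) * derivative ((X - C c) ^ k) = ((k : ℂ[X]) * p) * (X - C c) ^ k := by
    rcases k with _ | k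
    · simp
    · rw [derivative_X_sub_C_pow]
      simp only [map_natCast, Nat.add_sub_cancel]
      ring
  rw [← cubicOp_mul he, cubicOp_sub]

/-- The third order equation has a nonzero solution `F / (∏ (X - a_i) ^ l_i (X - c) ^ r)` regular at
infinity, provided that it has a formal solution, up to the order that matters, at `c` which does not
belong to the largest exponent. With `d = ∑ l_i + r`, the numerators of degree at most `d` form an
isotropic space of dimension `d + 1` for a form of rank at most `2 d`: its denominator has degree
`2 d + 6`, and each `a_i` contributes `1` to the nullity, for parity reasons, while `c` contributes `2`. -/
theorem exists_cubicOp_eq_zero (ha : Function.Injective a) (hc : ∀ i, a i ≠ c)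
    (hw : w.natDegree ≤ 6)
    (hwa : ∀ i, 4 * w.eval (a i) = l i * (l i + 1) *
      ((derivative (∏ i, (X - C (a i)))).eval (a i) * (a i - c)) ^ 2)
    (hwc : 4 * w.eval c = r * (r + 2) * ((∏ i, (X - C (a i))).eval c) ^ 2)
    {Y : ℂ[X]} (hY : ¬ (X - C c) ^ (r + 2) ∣ Y)
    (hY' : (X - C c) ^ (r + 3) ∣ cubicOp (∏ i, (X - C (a i))) (X - C c) w 0 Y) :
    ∃ F : ℂ[X], F ≠ 0 ∧ F.natDegree ≤ ∑ i, l i + r ∧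
      cubicOp (∏ i, (X - C (a i))) (X - C c) w (gauge a c l r) F = 0 := by
  set p : ℂ[X] := ∏ i, (X - C (a i)) with hp
  set τ : ℂ[X] := X - C c with hτ
  set ρ := roots a c with hρ
  set ν := gauge a c l r with hν
  have hρinj : Function.Injective ρ := roots_injective ha hc
  have hg : ∏ v, (X - C (ρ v)) = p * τ := prod_roots a c
  have hpm : p.Monic := monic_prod_of_monic _ _ fun i _ => monic_X_sub_C _
  have hp4 : p.natDegree = 4 := by
    rw [hp, natDegree_prod_of_monic _ _ fun i _ => monic_X_sub_C _]; simp
  have hτm : τ.Monic := monic_X_sub_C _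
  have hτ1 : τ.natDegree = 1 := natDegree_X_sub_C _
  have hτ' : derivative τ = 1 := derivative_X_sub_C _
  have hgm : (p * τ).Monic := hpm.mul hτm
  have hcop : ∀ u v, u ≠ v → IsCoprime (X - C (ρ u)) (X - C (ρ v)) := fun u v huv =>
    pairwise_coprime_X_sub_C hρinj huv
  have hνeq : ν = logDerivNum ρ (-fun v => (mult l r v : ℂ)) := by
    rw [hν, gauge, logDerivNum_neg]
  -- the values of the operator are divisible by `p τ`, since the gauge is an exponent at every point
  have hdvd : ∀ F, p * τ ∣ cubicOp p τ w ν F := by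
    intro F
    rw [← hg]
    refine Finset.prod_dvd_of_coprime (fun u _ v _ huv => hcop u v huv) fun v _ => ?_
    rw [dvd_iff_isRoot, IsRoot, hνeq]
    exact eval_cubicOp_logDerivNum_eq_zero hwa hwc v _ (Or.inl rfl) F
  choose N₀ hN₀ using hdvd
  obtain ⟨N, hN⟩ : ∃ N : ℂ[X] →ₗ[ℂ] ℂ[X], ∀ F, p * τ * N F = cubicOp p τ w ν F :=
    ⟨{ toFun := N₀
       map_add' := fun F G => mul_left_cancel₀ hgm.ne_zero (by
        rw [mul_add, ← hN₀, ← hN₀, ← hN₀, cubicOp_add])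
       map_smul' := fun k F => mul_left_cancel₀ hgm.ne_zero (by
        rw [RingHom.id_apply, smul_eq_C_mul, smul_eq_C_mul, mul_left_comm, ← hN₀, ← hN₀,
          cubicOp_C_mul]) }, fun F => (hN₀ F).symm⟩
  -- the order of the denominator `D₁² p τ²` of the residue form at each point: the difference of
  -- the exponents `-l_i` and `l_i + 1`, or `-r` and `r + 2`
  let n : Option (Fin 4) → ℕ := fun o => o.elim (2 * r + 2) (fun i => 2 * l i + 1)
  -- lower bounds for the nullities of the local forms
  let m : Option (Fin 4) → ℕ := fun o => o.elim 2 (fun _ => 1)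
  have hnsum : ∑ v, n v = 2 * (∑ i, l i + r) + 6 := by
    rw [Fintype.sum_option]
    simp only [n, Option.elim_none, Option.elim_some, Finset.sum_add_distrib, ← Finset.mul_sum]
    simp; ring
  have hmsum : ∑ v, m v = 6 := by
    rw [Fintype.sum_option]; simp [m]
  -- powers of the linear factors are preserved
  have hloc : ∀ v F, (X - C (ρ v)) ^ n v ∣ F → (X - C (ρ v)) ^ n v ∣ N F := by
    rintro v F ⟨H, rfl⟩
    have hsingle : ∏ u, (X - C (ρ u)) ^ (Pi.single v (n v) : Option (Fin 4) → ℕ) u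
        = (X - C (ρ v)) ^ n v := by
      rw [Finset.prod_eq_single v] <;> simp +contextual
    have he := prod_mul_derivative_prod_pow ρ (Pi.single v (n v))
    rw [hsingle, hg] at he
    have h1 := hN ((X - C (ρ v)) ^ n v * H)
    rw [cubicOp_mul he, hνeq, ← logDerivNum_add] at h1
    have h2 := eval_cubicOp_logDerivNum_eq_zero hwa hwc v
      ((-fun v => (mult l r v : ℂ)) + fun u => (((Pi.single v (n v) : Option (Fin 4) → ℕ) u : ℕ) : ℂ))
      (by
        right
        rcases v with _ | i
        · simp [n, mult]; ring
        · simp [n, mult]; ring) H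
    rw [← IsRoot, ← dvd_iff_isRoot] at h2
    have h3 : (X - C (ρ v)) * (X - C (ρ v)) ^ n v ∣ p * τ * N ((X - C (ρ v)) ^ n v * H) := by
      rw [h1, mul_comm (X - C (ρ v))]
      exact mul_dvd_mul_left _ h2
    rw [← hg, ← Finset.mul_prod_erase _ _ (Finset.mem_univ v), mul_assoc] at h3
    have h4 := (mul_dvd_mul_iff_left (monic_X_sub_C (ρ v)).ne_zero).1 h3
    refine IsCoprime.dvd_of_dvd_mul_left (IsCoprime.pow_left ?_) h4
    exact IsCoprime.prod_right fun u hu => hcop v u (Finset.ne_of_mem_erase hu).symm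
  -- the denominator `D₁` of the solution, and the denominator of the residue form
  set D₁ : ℂ[X] := ∏ v, (X - C (ρ v)) ^ mult l r v with hD₁
  have hD₁g : p * τ * derivative D₁ = -ν * D₁ := by
    rw [← hg, prod_mul_derivative_prod_pow, hν, gauge, neg_neg]
  have hD₃ : ∏ v, (X - C (ρ v)) ^ n v = D₁ ^ 2 * (p * τ ^ 2) := by
    rw [hD₁, Fintype.prod_option, Fintype.prod_option, hp, mul_pow, ← Finset.prod_pow]
    have : ∀ i, (X - C (ρ (some i))) ^ n (some i)
        = ((X - C (ρ (some i))) ^ mult l r (some i)) ^ 2 * (X - C (a i)) := by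
      intro i
      change (X - C (a i)) ^ (2 * l i + 1) = ((X - C (a i)) ^ l i) ^ 2 * (X - C (a i))
      ring
    rw [Finset.prod_congr rfl fun i _ => this i, Finset.prod_mul_distrib]
    change (X - C c) ^ (2 * r + 2) * _ = ((X - C c) ^ r) ^ 2 * _ * _
    rw [hτ]; ring
  have hD₃m : (∏ v, (X - C (ρ v)) ^ n v).Monic :=
    monic_prod_of_monic _ _ fun v _ => (monic_X_sub_C _).pow _
  have hskew : ∀ F, residueSum (∏ v, (X - C (ρ v)) ^ n v) (F * N F) = 0 := by
    intro F
    have hex := cubicOp_skew (p := p) hτ' w ν F F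
    -- in the gauge `h = 1 / D₁` the form is the derivative of `J / (D₁² p τ²)`
    set J := bilinearConcomitant p τ w ν F F with hJ
    have h2 : residueSum (∏ v, (X - C (ρ v)) ^ n v) (2 * (F * N F)) = 0 := by
      refine residueSum_eq_zero_of_exact (J := J) hD₃m ?_
      rw [hD₃]
      apply mul_left_cancel₀ hgm.ne_zero
      simp only [derivative_mul, derivative_pow, hτ', Nat.cast_ofNat, Nat.reduceSub, pow_one,
        map_ofNat, mul_one]
      linear_combination (2 * (D₁ ^ 2 * (p * τ ^ 2)) * F) * hN F + (D₁ ^ 2 * (p * τ ^ 2)) * hex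
        + (2 * J * D₁ * p * τ ^ 2) * hD₁g
    have h3 : (2 : ℂ[X]) * (F * N F) = (2 : ℂ) • (F * N F) := by
      rw [smul_eq_C_mul]; rfl
    rw [h3, map_smul, smul_eq_mul] at h2
    simpa using h2
  have hdeg : ∀ F : ℂ[X], F.natDegree ≤ ∑ i, l i + r → (N F).natDegree ≤ ∑ i, l i + r + 4 := by
    intro F hF
    have hcard : Fintype.card (Option (Fin 4)) = 4 + 1 := by simp
    have hνc : ν.coeff 4 = -((∑ i, l i + r : ℕ) : ℂ) := by
      rw [hνeq, coeff_logDerivNum _ _ hcard, Fintype.sum_option]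
      simp [mult, Finset.sum_neg_distrib]
    have h1 := natDegree_cubicOp_le hpm hp4 hτm hτ1 hτ' hw
      (hνeq ▸ natDegree_logDerivNum_le _ _ hcard) hνc hF
    rw [← hN] at h1
    by_cases h0 : N F = 0
    · rw [h0]; simp
    rw [natDegree_mul hgm.ne_zero h0, hpm.natDegree_mul hτm, hp4, hτ1] at h1
    omega
  -- a vector of the local radical at `c`: the formal solution `Y`, cut off by a partition of unity
  have hrad : ∃ F : ℂ[X], (∏ u ∈ Finset.univ.erase none, (X - C (ρ u)) ^ n u) ∣ F ∧
      ¬ (X - C (ρ none)) ^ n none ∣ F ∧ (X - C (ρ none)) ^ n none ∣ N F := by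
    set Q := ∏ u ∈ Finset.univ.erase none, (X - C (ρ u)) ^ n u with hQ
    have hcopQ : IsCoprime (τ ^ (2 * r + 6)) Q := by
      refine IsCoprime.prod_right fun u hu => IsCoprime.pow ?_
      exact hcop none u (Finset.ne_of_mem_erase hu).symm
    obtain ⟨α, β, hαβ⟩ := hcopQ
    have hD₁s : D₁ = τ ^ r * ∏ i, (X - C (a i)) ^ l i := by
      rw [hD₁, Fintype.prod_option]; rfl
    have hτD : τ ^ r ∣ D₁ := ⟨_, hD₁s⟩
    have hYdec : Y * (β * Q) = Y - τ ^ (2 * r + 6) * (α * Y) := by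
      linear_combination Y * hαβ
    refine ⟨D₁ * (Y * (β * Q)), ⟨D₁ * Y * β, by ring⟩, ?_, ?_⟩
    · change ¬ τ ^ (2 * r + 2) ∣ _
      intro h
      rw [hD₁s, mul_assoc, show 2 * r + 2 = r + (r + 2) by ring, pow_add τ r] at h
      have h1 := (mul_dvd_mul_iff_left (hτm.pow r).ne_zero).1 h
      have hcl : IsCoprime (τ ^ (r + 2)) (∏ i, (X - C (a i)) ^ l i) :=
        IsCoprime.prod_right fun i _ => IsCoprime.pow (hcop none (some i) (by simp))
      have h2 := hcl.dvd_of_dvd_mul_left h1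
      rw [hYdec, dvd_sub_left] at h2
      · exact hY h2
      · exact (pow_dvd_pow τ (by omega)).mul_right _
    · change τ ^ (2 * r + 2) ∣ _
      have h1 := hN (D₁ * (Y * (β * Q)))
      rw [cubicOp_mul hD₁g, add_neg_cancel, hYdec] at h1
      have hsplit := cubicOp_sub_X_sub_C_pow_mul p c w 0 Y (α * Y) (2 * r + 6)
      have h4 : τ ^ (2 * r + 3) ∣ p * τ * N (D₁ * (Y * (β * Q))) := by
        rw [hYdec, h1, show 2 * r + 3 = r + (r + 3) by ring, pow_add]
        refine mul_dvd_mul hτD ?_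
        rw [hsplit]
        exact dvd_sub hY' ((pow_dvd_pow τ (by omega)).mul_right _)
      rw [mul_comm p, mul_assoc, show 2 * r + 3 = (2 * r + 2) + 1 by ring, pow_succ'] at h4
      have h5 := (mul_dvd_mul_iff_left hτm.ne_zero).1 h4
      refine IsCoprime.dvd_of_dvd_mul_left (IsCoprime.pow_left ?_) h5
      exact IsCoprime.prod_right fun i _ => hcop none (some i) (by simp)
  obtain ⟨F, hF0, hFd, hF⟩ := exists_ne_zero_of_residueForm_isAlt ρ hρinj n m N (∑ i, l i + r)
    (∑ i, l i + r + 4) hskew hloc hdeg (by omega) (by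
      rintro (_ | i)
      · exact Or.inr ⟨rfl, ⟨r + 1, by simp only [n, Option.elim_none]; ring⟩, hrad⟩
      · exact Or.inl ⟨rfl, ⟨l i, rfl⟩⟩) (by omega)
  exact ⟨F, hF0, hFd, by rw [← hN, hF, mul_zero]⟩

end Existence

/-! ### Elliptic functions -/

section Elliptic

lemma meromorphic_comp_add_const {f : ℂ → ℂ} (hf : Meromorphic f) (c : ℂ) :
    Meromorphic (fun x => f (x + c)) := fun x =>
  (meromorphicAt_comp_add_const_iff_meromorphicAt (c := c) (f := f) (x := x)).2 (hf (x + c))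

lemma order_nonneg_of_tendsto {f : ℂ → ℂ} {x c : ℂ} (hf : MeromorphicAt f x)
    (h : Tendsto f (𝓝[≠] x) (𝓝 c)) : 0 ≤ meromorphicOrderAt f x :=
  (tendsto_nhds_iff_meromorphicOrderAt_nonneg hf).1 ⟨c, h⟩

lemma order_nonneg_of_continuousAt {f : ℂ → ℂ} {x : ℂ} (hf : MeromorphicAt f x)
    (h : ContinuousAt f x) : 0 ≤ meromorphicOrderAt f x :=
  order_nonneg_of_tendsto hf (h.tendsto.mono_left nhdsWithin_le_nhds)

/-- Liouville's theorem: an elliptic function without poles is constant. -/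
theorem exists_eventually_eq_const_of_periodic (L : PeriodPair) {f : ℂ → ℂ} (hf : Meromorphic f)
    (hper : ∀ x, ∀ ω ∈ L.lattice, f (x + ω) = f x) (hord : ∀ x, 0 ≤ meromorphicOrderAt f x) :
    ∃ c, ∀ x, ∀ᶠ y in 𝓝[≠] x, f y = c := by
  have hfU : MeromorphicOn f Set.univ := fun x _ => hf x
  -- remove the removable singularities
  set F := toMeromorphicNFOn f Set.univ with hF
  have hFf : ∀ x, F =ᶠ[𝓝[≠] x] f := fun x =>
    hfU.toMeromorphicNFOn_eq_self_on_nhdsNE (Set.mem_univ x)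
  have hFan : ∀ x, AnalyticAt ℂ F x := by
    intro x
    have h1 := (hf x).meromorphicOrderAt_nonneg_iff_analyticAt_toMeromorphicNFAt.1 (hord x)
    exact h1.congr (toMeromorphicNFOn_eq_toMeromorphicNFAt_on_nhds hfU (Set.mem_univ x)).symm
  have hFper : ∀ x, ∀ ω ∈ L.lattice, F (x + ω) = F x := by
    intro x ω hω
    have hmap : Tendsto (fun y => y + ω) (𝓝[≠] x) (𝓝[≠] (x + ω)) := by
      refine tendsto_nhdsWithin_iff.2 ⟨?_, ?_⟩
      · exact ((continuous_id.add continuous_const).tendsto x).mono_left nhdsWithin_le_nhds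
      · filter_upwards [self_mem_nhdsWithin] with y hy
        simpa using hy
    have h1 : Tendsto (fun y => F (y + ω)) (𝓝[≠] x) (𝓝 (F (x + ω))) :=
      ((hFan (x + ω)).continuousAt.tendsto.mono_left nhdsWithin_le_nhds).comp hmap
    have h2 : Tendsto F (𝓝[≠] x) (𝓝 (F x)) :=
      (hFan x).continuousAt.tendsto.mono_left nhdsWithin_le_nhds
    refine tendsto_nhds_unique (h1.congr' ?_) h2
    filter_upwards [hmap.eventually (hFf (x + ω)), hFf x] with y hy1 hy2
    rw [hy1, hy2, hper y ω hω]
  have hFdiff : Differentiable ℂ F := fun x => (hFan x).differentiableAt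
  refine ⟨F 0, fun x => ?_⟩
  filter_upwards [hFf x] with y hy
  rw [← hy]
  exact hFdiff.apply_eq_apply_of_bounded
    (IsZLattice.isCompact_range_of_periodic L.lattice F hFdiff.continuous hFper).isBounded y 0

lemma order_add_of_periodic {L : PeriodPair} {f : ℂ → ℂ}
    (hper : ∀ x, ∀ ω ∈ L.lattice, f (x + ω) = f x) (x : ℂ) {ω : ℂ} (hω : ω ∈ L.lattice) :
    meromorphicOrderAt f (x + ω) = meromorphicOrderAt f x := by
  rw [← meromorphicOrderAt_comp_add_const_eq_meromorphicOrderAt (c := ω)]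
  exact congrArg (fun g => meromorphicOrderAt g x) (funext fun y => hper y ω hω)

/-- A function which is even or odd about `x₀` has even or odd order there. -/
lemma neg_one_zpow_order_of_reflection {f : ℂ → ℂ} {x₀ ε : ℂ} (hf : MeromorphicAt f x₀)
    (hε : ∀ᶠ t in 𝓝[≠] (0 : ℂ), f (x₀ - t) = ε * f (x₀ + t)) {n : ℤ}
    (hn : meromorphicOrderAt f x₀ = n) : (-1 : ℂ) ^ n = ε := by
  obtain ⟨g, hg, hg0, hfg⟩ := (meromorphicOrderAt_eq_int_iff hf).1 hn
  have hm1 : Tendsto (fun t : ℂ => x₀ + t) (𝓝[≠] 0) (𝓝[≠] x₀) := by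
    refine tendsto_nhdsWithin_iff.2 ⟨?_, ?_⟩
    · refine Tendsto.mono_left ?_ nhdsWithin_le_nhds
      exact Continuous.tendsto' (by fun_prop) _ _ (by simp)
    · filter_upwards [self_mem_nhdsWithin] with t ht
      simpa using ht
  have hm2 : Tendsto (fun t : ℂ => x₀ - t) (𝓝[≠] 0) (𝓝[≠] x₀) := by
    refine tendsto_nhdsWithin_iff.2 ⟨?_, ?_⟩
    · refine Tendsto.mono_left ?_ nhdsWithin_le_nhds
      exact Continuous.tendsto' (by fun_prop) _ _ (by simp)
    · filter_upwards [self_mem_nhdsWithin] with t ht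
      simpa using ht
  have key : ∀ᶠ t in 𝓝[≠] (0 : ℂ), (-1 : ℂ) ^ n * g (x₀ - t) = ε * g (x₀ + t) := by
    filter_upwards [hε, hm1.eventually hfg, hm2.eventually hfg, self_mem_nhdsWithin]
      with t h1 h2 h3 ht
    have ht0 : (t : ℂ) ^ n ≠ 0 := zpow_ne_zero _ ht
    rw [h2, h3] at h1
    simp only [smul_eq_mul, add_sub_cancel_left] at h1
    rw [show x₀ - t - x₀ = -1 * t by ring, mul_zpow] at h1
    apply mul_left_cancel₀ ht0
    linear_combination h1
  have hc1 : Tendsto (fun t => (-1 : ℂ) ^ n * g (x₀ - t)) (𝓝[≠] 0) (𝓝 ((-1 : ℂ) ^ n * g x₀)) :=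
    ((hg.continuousAt.tendsto.mono_left nhdsWithin_le_nhds).comp hm2).const_mul _
  have hc2 : Tendsto (fun t => ε * g (x₀ + t)) (𝓝[≠] 0) (𝓝 (ε * g x₀)) :=
    ((hg.continuousAt.tendsto.mono_left nhdsWithin_le_nhds).comp hm1).const_mul _
  exact mul_right_cancel₀ hg0 (tendsto_nhds_unique (hc1.congr' key) hc2)

/-- An analytic function with a double zero, divided by the square. -/
lemma exists_eq_sq_mul {g : ℂ → ℂ} {x₀ : ℂ} (hg : AnalyticAt ℂ g x₀) (h0 : g x₀ = 0)
    (h1 : deriv g x₀ = 0) : ∃ G : ℂ → ℂ, AnalyticAt ℂ G x₀ ∧ G x₀ = deriv (deriv g) x₀ / 2 ∧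
      ∀ᶠ x in 𝓝 x₀, g x = (x - x₀) ^ 2 * G x := by
  have hord : ((2 : ℕ) : ℕ∞) ≤ analyticOrderAt g x₀ := by
    rw [natCast_le_analyticOrderAt_iff_iteratedDeriv_eq_zero hg]
    intro i hi
    interval_cases i
    · simpa using h0
    · simpa using h1
  obtain ⟨G, hG, hgG⟩ := (natCast_le_analyticOrderAt hg).1 hord
  simp only [smul_eq_mul] at hgG
  refine ⟨G, hG, ?_, hgG⟩
  have hd1 : deriv g =ᶠ[𝓝 x₀] fun x => 2 * (x - x₀) * G x + (x - x₀) ^ 2 * deriv G x := by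
    filter_upwards [eventually_eventually_nhds.2 hgG, hG.eventually_analyticAt] with x hx hGx
    rw [EventuallyEq.deriv_eq (show g =ᶠ[𝓝 x] fun y => (y - x₀) ^ 2 * G y from hx)]
    have h2 : HasDerivAt (fun y : ℂ => (y - x₀) ^ 2) (2 * (x - x₀)) x := by
      simpa using ((hasDerivAt_id x).sub_const x₀).fun_pow 2
    exact (h2.mul hGx.differentiableAt.hasDerivAt).deriv
  rw [hd1.deriv_eq]
  have h2 : HasDerivAt (fun y : ℂ => 2 * (y - x₀)) 2 x₀ := by
    simpa using ((hasDerivAt_id x₀).sub_const x₀).const_mul 2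
  have h3 : HasDerivAt (fun y : ℂ => (y - x₀) ^ 2) 0 x₀ := by
    simpa using ((hasDerivAt_id x₀).sub_const x₀).fun_pow 2
  have h4 := (h2.mul hG.differentiableAt.hasDerivAt).add
    (h3.mul hG.deriv.differentiableAt.hasDerivAt)
  have h5 : deriv (fun x => 2 * (x - x₀) * G x + (x - x₀) ^ 2 * deriv G x) x₀ = _ := h4.deriv
  rw [h5]; simp

end Elliptic

/-! ### The Weierstrass function -/

section Weierstrass

variable (L : PeriodPair)

lemma weierstrassP_add_lattice (x : ℂ) {ω : ℂ} (hω : ω ∈ L.lattice) :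
    L.weierstrassP (x + ω) = L.weierstrassP x := L.weierstrassP_add_coe x ⟨ω, hω⟩

lemma derivWeierstrassP_add_lattice (x : ℂ) {ω : ℂ} (hω : ω ∈ L.lattice) :
    L.derivWeierstrassP (x + ω) = L.derivWeierstrassP x := L.derivWeierstrassP_add_coe x ⟨ω, hω⟩

lemma hasDerivAt_weierstrassP {x : ℂ} (hx : x ∉ L.lattice) :
    HasDerivAt L.weierstrassP (L.derivWeierstrassP x) x := by
  have := (L.analyticOnNhd_weierstrassP x hx).differentiableAt.hasDerivAt
  rwa [L.deriv_weierstrassP] at this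

lemma eventually_notMem_lattice (x : ℂ) : ∀ᶠ y in 𝓝[≠] x, y ∉ L.lattice := by
  filter_upwards [self_mem_nhdsWithin, mem_nhdsWithin_of_mem_nhds
    (L.compl_lattice_sdiff_singleton_mem_nhds x)] with y hy hy' h
  exact hy' ⟨h, hy⟩

lemma eventually_notMem_lattice_of_notMem {x : ℂ} (hx : x ∉ L.lattice) :
    ∀ᶠ y in 𝓝 x, y ∉ L.lattice := L.isClosed_lattice.isOpen_compl.mem_nhds hx

lemma tendsto_sq_mul_weierstrassP {ω : ℂ} (hω : ω ∈ L.lattice) :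
    Tendsto (fun x => (x - ω) ^ 2 * L.weierstrassP x) (𝓝[≠] ω) (𝓝 1) := by
  have h1 : Tendsto (fun z => (z - ω) ^ 2 * L.weierstrassPExcept ω z + 1 - (z - ω) ^ 2 / ω ^ 2)
      (𝓝[≠] ω) (𝓝 1) := by
    refine Tendsto.mono_left ?_ nhdsWithin_le_nhds
    have hc : ContinuousAt (fun z => (z - ω) ^ 2 * L.weierstrassPExcept ω z + 1
        - (z - ω) ^ 2 / ω ^ 2) ω := by
      have := (L.analyticAt_weierstrassPExcept ω).continuousAt
      fun_prop
    simpa [ContinuousAt] using hc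
  refine h1.congr' ?_
  filter_upwards [self_mem_nhdsWithin] with z hz
  have := L.ite_eq_one_sub_sq_mul_weierstrassP ω hω z
  rwa [if_neg (by simpa using hz), eq_comm] at this

lemma order_weierstrassP_sub_const {ω : ℂ} (hω : ω ∈ L.lattice) (c : ℂ) :
    meromorphicOrderAt (fun x => L.weierstrassP x - c) ω = (-2 : ℤ) := by
  have h1 := L.order_weierstrassP ω hω
  have h2 : meromorphicOrderAt (fun _ : ℂ => -c) ω ≥ 0 := analyticAt_const.meromorphicOrderAt_nonneg
  have : (fun x => L.weierstrassP x - c) = L.weierstrassP + fun _ => -c := by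
    funext x; simp [sub_eq_add_neg]
  rw [this, meromorphicOrderAt_add_eq_left_of_lt (MeromorphicAt.const _ _), h1]
  · rfl
  · rw [h1]
    exact lt_of_lt_of_le (by decide) h2

lemma meromorphic_weierstrassP_sub_const (c : ℂ) : Meromorphic (fun x => L.weierstrassP x - c) :=
  fun x => (L.meromorphic_weierstrassP x).fun_sub (MeromorphicAt.const _ _)

lemma order_weierstrassP_sub_const_ne_top (c x : ℂ) :
    meromorphicOrderAt (fun x => L.weierstrassP x - c) x ≠ ⊤ := by
  refine MeromorphicOn.meromorphicOrderAt_ne_top_of_isPreconnected (U := Set.univ) (x := 0)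
    (fun y _ => meromorphic_weierstrassP_sub_const L c y) isPreconnected_univ (Set.mem_univ _)
    (Set.mem_univ _) ?_
  rw [order_weierstrassP_sub_const L L.lattice.zero_mem]
  exact WithTop.coe_ne_top

lemma eventually_weierstrassP_ne (c x : ℂ) : ∀ᶠ y in 𝓝[≠] x, L.weierstrassP y ≠ c := by
  have := (meromorphicOrderAt_ne_top_iff_eventually_ne_zero
    (meromorphic_weierstrassP_sub_const L c x)).1 (order_weierstrassP_sub_const_ne_top L c x)
  filter_upwards [this] with y hy
  exact sub_ne_zero.1 hy

lemma derivWeierstrassP_eq_zero {η : ℂ} (hη : 2 * η ∈ L.lattice) : L.derivWeierstrassP η = 0 := by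
  have h1 := L.derivWeierstrassP_neg η
  have h2 := derivWeierstrassP_add_lattice L (-η) hη
  rw [show -η + 2 * η = η by ring, h1] at h2
  exact CharZero.eq_neg_self_iff.1 h2

/-- At a half period `℘ - ℘(η)` has a double zero; here it is evaluated near all translates of
`η` at once. -/
lemma order_weierstrassP_add_sub_ge {η ω : ℂ} (hη : 2 * η ∈ L.lattice) (hη' : η ∉ L.lattice)
    (hω : ω ∈ L.lattice) :
    2 ≤ meromorphicOrderAt (fun x => L.weierstrassP (x + η) - L.weierstrassP η) ω := by
  have hmem : ω + η ∉ L.lattice := fun h => hη' (by simpa using L.lattice.sub_mem h hω)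
  have hd : ∀ᶠ x in 𝓝 ω, HasDerivAt (fun x => L.weierstrassP (x + η) - L.weierstrassP η)
      (L.derivWeierstrassP (x + η)) x := by
    have : ∀ᶠ x in 𝓝 ω, x + η ∉ L.lattice :=
      (Continuous.tendsto (by fun_prop : Continuous fun x : ℂ => x + η) ω).eventually
        (eventually_notMem_lattice_of_notMem L hmem)
    filter_upwards [this] with x hx
    exact ((hasDerivAt_weierstrassP L hx).comp_add_const x η).sub_const _
  have han : AnalyticAt ℂ (fun x => L.weierstrassP (x + η) - L.weierstrassP η) ω := by
    have h1 := L.analyticOnNhd_weierstrassP (ω + η) hmem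
    have h2 : AnalyticAt ℂ (fun x : ℂ => x + η) ω := by fun_prop
    exact (AnalyticAt.fun_comp (g := L.weierstrassP) (f := fun x => x + η) h1 h2).sub analyticAt_const
  have h0 : L.weierstrassP (ω + η) - L.weierstrassP η = 0 := by
    rw [add_comm, weierstrassP_add_lattice L _ hω, sub_self]
  have h1 : deriv (fun x => L.weierstrassP (x + η) - L.weierstrassP η) ω = 0 := by
    rw [hd.self_of_nhds.deriv, add_comm, derivWeierstrassP_add_lattice L _ hω,
      derivWeierstrassP_eq_zero L hη]
  rw [han.meromorphicOrderAt_eq]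
  refine ENat.monotone_map_iff.mpr Nat.mono_cast
    ((natCast_le_analyticOrderAt_iff_iteratedDeriv_eq_zero (n := 2) han).mpr fun i hi ↦ ?_)
  interval_cases i
  · simpa using h0
  · simpa using h1

/-- Translation by a half period acts on `℘` by a Möbius involution. -/
theorem exists_weierstrassP_halfPeriod_mul {η : ℂ} (hη : 2 * η ∈ L.lattice) (hη' : η ∉ L.lattice) :
    ∃ h : ℂ, h ≠ 0 ∧ ∀ x, x ∉ L.lattice → x + η ∉ L.lattice →
      (L.weierstrassP (x + η) - L.weierstrassP η) * (L.weierstrassP x - L.weierstrassP η) = h := by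
  set e := L.weierstrassP η with he
  set f : ℂ → ℂ := fun x => (L.weierstrassP (x + η) - e) * (L.weierstrassP x - e) with hf
  have hm1 : Meromorphic (fun x => L.weierstrassP (x + η) - e) :=
    meromorphic_comp_add_const (meromorphic_weierstrassP_sub_const L e) η
  have hm2 := meromorphic_weierstrassP_sub_const L e
  have hfm : Meromorphic f := fun x => (hm1 x).fun_mul (hm2 x)
  have hper : ∀ x, ∀ ω ∈ L.lattice, f (x + ω) = f x := by
    intro x ω hω
    simp only [hf]
    rw [weierstrassP_add_lattice L x hω, show x + ω + η = x + η + ω by ring,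
      weierstrassP_add_lattice L (x + η) hω]
  have hcont : ∀ x, x ∉ L.lattice → x + η ∉ L.lattice → ContinuousAt f x := by
    intro x hx hx'
    exact (((hasDerivAt_weierstrassP L hx').comp_add_const x η).continuousAt.sub
      continuousAt_const).mul ((hasDerivAt_weierstrassP L hx).continuousAt.sub continuousAt_const)
  have hlat : ∀ ω ∈ L.lattice, 0 ≤ meromorphicOrderAt f ω := by
    intro ω hω
    rw [hf, fun_meromorphicOrderAt_mul (hm1 ω) (hm2 ω), order_weierstrassP_sub_const L hω]
    have := order_weierstrassP_add_sub_ge L hη hη' hω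
    calc (0 : WithTop ℤ) = 2 + ((-2 : ℤ) : WithTop ℤ) := rfl
      _ ≤ _ := by gcongr
  -- the two factors are exchanged by `x ↦ x + η`, up to a period
  have hsymm : ∀ x, f (x + η) = f x := by
    intro x
    simp only [hf]
    rw [show x + η + η = x + 2 * η by ring, weierstrassP_add_lattice L x hη]; ring
  have hord : ∀ x, 0 ≤ meromorphicOrderAt f x := by
    intro x
    by_cases hx : x ∈ L.lattice
    · exact hlat x hx
    by_cases hx' : x + η ∈ L.lattice
    · have h1 := hlat _ hx'
      rw [← meromorphicOrderAt_comp_add_const_eq_meromorphicOrderAt] at h1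
      rwa [show f ∘ (· + η) = f from funext hsymm] at h1
    · exact order_nonneg_of_continuousAt (hfm x) (hcont x hx hx')
  obtain ⟨h, hh⟩ := exists_eventually_eq_const_of_periodic L hfm hper hord
  refine ⟨h, ?_, ?_⟩
  · rintro rfl
    have h1 : ∀ᶠ x in 𝓝[≠] (0 : ℂ), L.weierstrassP (x + η) - e = 0 := by
      filter_upwards [hh 0, eventually_weierstrassP_ne L e 0] with x hx hx'
      exact (mul_eq_zero.1 hx).resolve_right (sub_ne_zero.2 hx')
    have h2 := order_weierstrassP_sub_const_ne_top L e (0 + η)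
    rw [← meromorphicOrderAt_comp_add_const_eq_meromorphicOrderAt] at h2
    exact h2 (meromorphicOrderAt_eq_top_iff.2 h1)
  · intro x hx hx'
    have h1 : Tendsto f (𝓝[≠] x) (𝓝 (f x)) :=
      (hcont x hx hx').tendsto.mono_left nhdsWithin_le_nhds
    refine tendsto_nhds_unique h1 (tendsto_const_nhds.congr' ?_)
    filter_upwards [hh x] with y hy using hy.symm

end Weierstrass

/-! ### Half periods and addition formulas -/

section HalfPeriods

variable (L : PeriodPair)

lemma two_mul_halfPeriod_mem (i : Fin 4) : 2 * halfPeriod L i ∈ L.lattice := by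
  rw [PeriodPair.mem_lattice]
  fin_cases i
  · exact ⟨0, 0, by simp [halfPeriod]⟩
  · exact ⟨1, 0, by simp [halfPeriod]; ring⟩
  · exact ⟨-1, -1, by simp [halfPeriod]; ring⟩
  · exact ⟨0, 1, by simp [halfPeriod]; ring⟩

lemma halfPeriod_sub_notMem {i j : Fin 4} (hij : i ≠ j) :
    halfPeriod L i - halfPeriod L j ∉ L.lattice := by
  have key : ∀ α β : ℚ, ¬ (α.den = 1 ∧ β.den = 1) → ∀ x : ℂ, x = α * L.ω₁ + β * L.ω₂ →
      x ∉ L.lattice := by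
    rintro α β h x rfl
    exact L.mul_ω₁_add_mul_ω₂_mem_lattice.not.2 h
  fin_cases i <;> fin_cases j <;> first | exact absurd rfl hij | skip
  · exact key (-1 / 2) 0 (by norm_num) _ (by simp [halfPeriod]; ring)
  · exact key (1 / 2) (1 / 2) (by norm_num) _ (by simp [halfPeriod]; ring)
  · exact key 0 (-1 / 2) (by norm_num) _ (by simp [halfPeriod]; ring)
  · exact key (1 / 2) 0 (by norm_num) _ (by simp [halfPeriod]; ring)
  · exact key 1 (1 / 2) (by norm_num) _ (by simp [halfPeriod]; ring)
  · exact key (1 / 2) (-1 / 2) (by norm_num) _ (by simp [halfPeriod]; ring)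
  · exact key (-1 / 2) (-1 / 2) (by norm_num) _ (by simp [halfPeriod]; ring)
  · exact key (-1) (-1 / 2) (by norm_num) _ (by simp [halfPeriod]; ring)
  · exact key (-1 / 2) (-1) (by norm_num) _ (by simp [halfPeriod]; ring)
  · exact key 0 (1 / 2) (by norm_num) _ (by simp [halfPeriod]; ring)
  · exact key (-1 / 2) (1 / 2) (by norm_num) _ (by simp [halfPeriod]; ring)
  · exact key (1 / 2) 1 (by norm_num) _ (by simp [halfPeriod]; ring)

lemma halfPeriod_zero : halfPeriod L 0 = 0 := rfl

lemma halfPeriod_notMem {i : Fin 4} (hi : i ≠ 0) : halfPeriod L i ∉ L.lattice := by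
  simpa [halfPeriod_zero] using halfPeriod_sub_notMem L hi

lemma sub_halfPeriod_mem_iff (x : ℂ) (i : Fin 4) :
    x - halfPeriod L i ∈ L.lattice ↔ x + halfPeriod L i ∈ L.lattice := by
  have h := two_mul_halfPeriod_mem L i
  constructor <;> intro h'
  · have := L.lattice.add_mem h' h
    rwa [show x - halfPeriod L i + 2 * halfPeriod L i = x + halfPeriod L i by ring] at this
  · have := L.lattice.sub_mem h' h
    rwa [show x + halfPeriod L i - 2 * halfPeriod L i = x - halfPeriod L i by ring] at this

lemma halfPeriod_add_notMem {i j : Fin 4} (hij : i ≠ j) :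
    halfPeriod L i + halfPeriod L j ∉ L.lattice := fun h =>
  halfPeriod_sub_notMem L hij ((sub_halfPeriod_mem_iff L _ j).2 h)

lemma halfPeriod_add {i j k : Fin 4} (hi : i ≠ 0) (hj : j ≠ 0) (hk : k ≠ 0) (hij : i ≠ j)
    (hik : i ≠ k) (hjk : j ≠ k) : halfPeriod L j + halfPeriod L i = -halfPeriod L k := by
  fin_cases i <;> fin_cases j <;> first | simp_all; done | skip
  all_goals fin_cases k <;>
    first | simp_all; done | (simp [halfPeriod]; done) | (simp [halfPeriod]; ring)

/-- The Möbius involution `(℘(x + ω_i) - e_i) (℘(x) - e_i) = (e_j - e_i) (e_k - e_i)`. -/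
theorem weierstrassP_add_halfPeriod_mul {i j k : Fin 4} (hi : i ≠ 0) (hj : j ≠ 0) (hk : k ≠ 0)
    (hij : i ≠ j) (hik : i ≠ k) (hjk : j ≠ k) {x : ℂ} (hx : x ∉ L.lattice)
    (hx' : x + halfPeriod L i ∉ L.lattice) :
    (L.weierstrassP (x + halfPeriod L i) - eVal L i) * (L.weierstrassP x - eVal L i)
      = (eVal L j - eVal L i) * (eVal L k - eVal L i) := by
  obtain ⟨h, -, hh⟩ := exists_weierstrassP_halfPeriod_mul L (two_mul_halfPeriod_mem L i)
    (halfPeriod_notMem L hi)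
  have h1 := hh _ (halfPeriod_notMem L hj) (halfPeriod_add_notMem L hij.symm)
  rw [halfPeriod_add L hi hj hk hij hik hjk, L.weierstrassP_neg] at h1
  have h2 := hh x hx hx'
  simp only [eVal]
  rw [h2, ← h1]; ring

lemma eVal_injective {i j : Fin 4} (hi : i ≠ 0) (hj : j ≠ 0) (hij : i ≠ j) :
    eVal L i ≠ eVal L j := by
  obtain ⟨h, h0, hh⟩ := exists_weierstrassP_halfPeriod_mul L (two_mul_halfPeriod_mem L i)
    (halfPeriod_notMem L hi)
  have h1 := hh _ (halfPeriod_notMem L hj) (halfPeriod_add_notMem L hij.symm)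
  intro he
  simp only [eVal] at he
  rw [he, sub_self, mul_zero] at h1
  exact h0 h1.symm

/-- `℘` takes the value `e_i` only at the translates of `ω_i`. -/
lemma weierstrassP_ne_eVal {i : Fin 4} (hi : i ≠ 0) {x : ℂ} (hx : x ∉ L.lattice)
    (hx' : x - halfPeriod L i ∉ L.lattice) : L.weierstrassP x ≠ eVal L i := by
  rw [sub_halfPeriod_mem_iff] at hx'
  obtain ⟨h, h0, hh⟩ := exists_weierstrassP_halfPeriod_mul L (two_mul_halfPeriod_mem L i)
    (halfPeriod_notMem L hi)
  have h1 := hh x hx hx'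
  intro he
  simp only [eVal] at he
  rw [he, sub_self, mul_zero] at h1
  exact h0 h1.symm

/-- Vieta's relations between the `e_i` and the invariants of the lattice. -/
lemma eVal_relations : eVal L 1 + eVal L 2 + eVal L 3 = 0 ∧ L.g₂ = g2 L ∧ L.g₃ = g3 L := by
  have hroot : ∀ i : Fin 4, i ≠ 0 → 4 * eVal L i ^ 3 - L.g₂ * eVal L i - L.g₃ = 0 := by
    intro i hi
    have := L.derivWeierstrassP_sq _ (halfPeriod_notMem L hi)
    rw [derivWeierstrassP_eq_zero L (two_mul_halfPeriod_mem L i)] at this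
    rw [eVal, ← this]; ring
  have r1 := hroot 1 (by decide)
  have r2 := hroot 2 (by decide)
  have r3 := hroot 3 (by decide)
  have h12 := sub_ne_zero.2 (eVal_injective L (i := 1) (j := 2) (by decide) (by decide) (by decide))
  have h13 := sub_ne_zero.2 (eVal_injective L (i := 1) (j := 3) (by decide) (by decide) (by decide))
  have h23 := sub_ne_zero.2 (eVal_injective L (i := 2) (j := 3) (by decide) (by decide) (by decide))
  simp only [g2, g3]
  generalize eVal L 1 = e1 at *
  generalize eVal L 2 = e2 at *
  generalize eVal L 3 = e3 at *
  have s12 : 4 * (e1 ^ 2 + e1 * e2 + e2 ^ 2) - L.g₂ = 0 := by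
    apply mul_left_cancel₀ h12; linear_combination r1 - r2
  have s13 : 4 * (e1 ^ 2 + e1 * e3 + e3 ^ 2) - L.g₂ = 0 := by
    apply mul_left_cancel₀ h13; linear_combination r1 - r3
  have hsum : e1 + e2 + e3 = 0 := by
    apply mul_left_cancel₀ h23; linear_combination (s12 - s13) / 4
  have hg2 : L.g₂ = -4 * (e1 * e2 + e2 * e3 + e3 * e1) := by
    linear_combination -s12 + 4 * (e1 + e2) * hsum
  refine ⟨hsum, hg2, ?_⟩
  linear_combination -r1 - e1 * hg2 + (4 * e1 ^ 2) * hsum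

lemma derivWeierstrassP_sq_eq_prod {x : ℂ} (hx : x ∉ L.lattice) :
    L.derivWeierstrassP x ^ 2 = 4 * ((L.weierstrassP x - eVal L 1) * (L.weierstrassP x - eVal L 2)
      * (L.weierstrassP x - eVal L 3)) := by
  obtain ⟨h1, h2, h3⟩ := eVal_relations L
  rw [L.derivWeierstrassP_sq x hx, h2, h3, g2, g3]
  linear_combination (4 * L.weierstrassP x ^ 2) * h1

lemma two_mul_mem_of_sub_halfPeriod_mem {x : ℂ} {i : Fin 4} (h : x - halfPeriod L i ∈ L.lattice) :
    2 * x ∈ L.lattice := by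
  have h1 := L.lattice.add_mem (L.lattice.add_mem h h) (two_mul_halfPeriod_mem L i)
  rwa [show x - halfPeriod L i + (x - halfPeriod L i) + 2 * halfPeriod L i = 2 * x by ring] at h1

lemma notMem_of_two_mul_notMem {x : ℂ} (hx : 2 * x ∉ L.lattice) : x ∉ L.lattice := fun h =>
  hx (by rw [two_mul]; exact L.lattice.add_mem h h)

lemma weierstrassP_ne_eVal_of_two_mul_notMem {x : ℂ} (hx : 2 * x ∉ L.lattice) {i : Fin 4}
    (hi : i ≠ 0) : L.weierstrassP x ≠ eVal L i :=
  weierstrassP_ne_eVal L hi (notMem_of_two_mul_notMem L hx) fun h =>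
    hx (two_mul_mem_of_sub_halfPeriod_mem L h)

lemma derivWeierstrassP_ne_zero {x : ℂ} (hx : 2 * x ∉ L.lattice) : L.derivWeierstrassP x ≠ 0 := by
  intro h
  have h1 := derivWeierstrassP_sq_eq_prod L (notMem_of_two_mul_notMem L hx)
  rw [h] at h1
  have a1 := sub_ne_zero.2 (weierstrassP_ne_eVal_of_two_mul_notMem L hx (i := 1) (by decide))
  have a2 := sub_ne_zero.2 (weierstrassP_ne_eVal_of_two_mul_notMem L hx (i := 2) (by decide))
  have a3 := sub_ne_zero.2 (weierstrassP_ne_eVal_of_two_mul_notMem L hx (i := 3) (by decide))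
  have : (4 : ℂ) * ((L.weierstrassP x - eVal L 1) * (L.weierstrassP x - eVal L 2)
      * (L.weierstrassP x - eVal L 3)) ≠ 0 :=
    mul_ne_zero (by norm_num) (mul_ne_zero (mul_ne_zero a1 a2) a3)
  exact this (by rw [← h1]; ring)

lemma hasDerivAt_derivWeierstrassP {x : ℂ} (hx : 2 * x ∉ L.lattice) :
    HasDerivAt L.derivWeierstrassP (6 * L.weierstrassP x ^ 2 - g2 L / 2) x := by
  have hxl := notMem_of_two_mul_notMem L hx
  have hd := (L.analyticOnNhd_derivWeierstrassP x hxl).differentiableAt.hasDerivAt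
  have hP := hasDerivAt_weierstrassP L hxl
  have h1 := hd.fun_pow 2
  have h2 : HasDerivAt (fun y => L.derivWeierstrassP y ^ 2)
      (4 * (3 * L.weierstrassP x ^ 2 * L.derivWeierstrassP x) - L.g₂ * L.derivWeierstrassP x) x := by
    have h3 := (((hP.fun_pow 3).const_mul 4).sub (hP.const_mul L.g₂)).sub_const L.g₃
    refine HasDerivAt.congr_of_eventuallyEq (h3.congr_deriv (by push_cast; ring)) ?_
    filter_upwards [eventually_notMem_lattice_of_notMem L hxl] with y hy
    exact L.derivWeierstrassP_sq y hy
  have h3 := h1.unique h2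
  have h0 := derivWeierstrassP_ne_zero L hx
  have h4 : deriv L.derivWeierstrassP x = 6 * L.weierstrassP x ^ 2 - g2 L / 2 := by
    apply mul_left_cancel₀ h0
    rw [(eVal_relations L).2.1] at h3
    push_cast at h3
    linear_combination h3 / 2
  rwa [h4] at hd

/-- `℘(x + δ) + ℘(x - δ)` as a rational function of `℘(x)`, by Liouville's theorem. The coefficient
`6 ℘(δ)² - g₂ / 2` is `℘''(δ)`. -/
theorem weierstrassP_add_add_sub_mul {δ : ℂ} (hδ : 2 * δ ∉ L.lattice) {x : ℂ} (hx : x ∉ L.lattice)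
    (hx1 : x - δ ∉ L.lattice) (hx2 : x + δ ∉ L.lattice) :
    (L.weierstrassP (x + δ) + L.weierstrassP (x - δ) - 2 * L.weierstrassP δ)
        * (L.weierstrassP x - L.weierstrassP δ) ^ 2
      = L.derivWeierstrassP δ ^ 2 + (6 * L.weierstrassP δ ^ 2 - g2 L / 2)
        * (L.weierstrassP x - L.weierstrassP δ) := by
  set b := L.weierstrassP δ with hb
  set d1 := L.derivWeierstrassP δ with hd1
  set d2 := 6 * b ^ 2 - g2 L / 2 with hd2
  have hδl := notMem_of_two_mul_notMem L hδ
  set T : ℂ → ℂ := fun x => L.weierstrassP (x + δ) + L.weierstrassP (x - δ) - 2 * b with hT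
  set f : ℂ → ℂ := fun x => T x * (L.weierstrassP x - b) ^ 2
    - (d1 ^ 2 + d2 * (L.weierstrassP x - b)) with hf
  have hmb := meromorphic_weierstrassP_sub_const L b
  have hm1 : Meromorphic (fun x => L.weierstrassP (x + δ)) :=
    meromorphic_comp_add_const L.meromorphic_weierstrassP δ
  have hm2 : Meromorphic (fun x => L.weierstrassP (x - δ)) := by
    simpa [sub_eq_add_neg] using meromorphic_comp_add_const L.meromorphic_weierstrassP (-δ)
  have hTm : Meromorphic T := fun x => ((hm1 x).fun_add (hm2 x)).fun_sub (MeromorphicAt.const _ _)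
  have hfm : Meromorphic f := fun x => ((hTm x).fun_mul ((hmb x).fun_pow 2)).fun_sub
    ((MeromorphicAt.const _ _).fun_add ((MeromorphicAt.const _ _).fun_mul (hmb x)))
  have hTper : ∀ x, ∀ ω ∈ L.lattice, T (x + ω) = T x := by
    intro x ω hω
    simp only [hT]
    rw [show x + ω + δ = x + δ + ω by ring, show x + ω - δ = x - δ + ω by ring,
      weierstrassP_add_lattice L _ hω, weierstrassP_add_lattice L _ hω]
  have hper : ∀ x, ∀ ω ∈ L.lattice, f (x + ω) = f x := by
    intro x ω hω
    simp only [hf]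
    rw [hTper x ω hω, weierstrassP_add_lattice L x hω]
  have hTeven : ∀ x, T (-x) = T x := by
    intro x
    simp only [hT]
    rw [show -x + δ = -(x - δ) by ring, show -x - δ = -(x + δ) by ring, L.weierstrassP_neg,
      L.weierstrassP_neg]; ring
  have heven : ∀ x, f (-x) = f x := by
    intro x
    simp only [hf]
    rw [hTeven, L.weierstrassP_neg]
  have hcont : ∀ x, x ∉ L.lattice → x - δ ∉ L.lattice → x + δ ∉ L.lattice → ContinuousAt f x := by
    intro x hx hx1 hx2
    have c1 := ((hasDerivAt_weierstrassP L hx2).comp_add_const x δ).continuousAt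
    have c2 := ((hasDerivAt_weierstrassP L hx1).comp_sub_const x δ).continuousAt
    have c3 := (hasDerivAt_weierstrassP L hx).continuousAt
    simp only [hf, hT]
    fun_prop
  -- the behaviour at `δ`
  have hlimδ : Tendsto f (𝓝[≠] δ) (𝓝 0) := by
    have h1 : Tendsto (fun x => (x - δ) ^ 2 * L.weierstrassP (x - δ)) (𝓝[≠] δ) (𝓝 1) := by
      have h := tendsto_sq_mul_weierstrassP L L.lattice.zero_mem
      have hm : Tendsto (fun x => x - δ) (𝓝[≠] δ) (𝓝[≠] 0) := by
        refine tendsto_nhdsWithin_iff.2 ⟨?_, ?_⟩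
        · exact (Continuous.tendsto' (by fun_prop) _ _ (by simp)).mono_left nhdsWithin_le_nhds
        · filter_upwards [self_mem_nhdsWithin] with x hx
          simpa [sub_eq_zero] using hx
      refine (h.comp hm).congr fun x => ?_
      simp
    have h2 : Tendsto (fun x => (L.weierstrassP x - b) / (x - δ)) (𝓝[≠] δ) (𝓝 d1) := by
      have := (hasDerivAt_weierstrassP L hδl).tendsto_slope
      refine this.congr fun x => ?_
      rw [slope_def_field]
    have h3 : Tendsto (fun x => L.weierstrassP x - b) (𝓝[≠] δ) (𝓝 0) := by
      have : ContinuousAt (fun x => L.weierstrassP x - b) δ :=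
        (hasDerivAt_weierstrassP L hδl).continuousAt.sub continuousAt_const
      simpa [ContinuousAt, hb] using this.tendsto.mono_left (nhdsWithin_le_nhds (s := {δ}ᶜ))
    have h4 : Tendsto (fun x => L.weierstrassP (x + δ) - 2 * b) (𝓝[≠] δ)
        (𝓝 (L.weierstrassP (δ + δ) - 2 * b)) := by
      have : ContinuousAt (fun x => L.weierstrassP (x + δ) - 2 * b) δ :=
        ((hasDerivAt_weierstrassP L (by rwa [← two_mul])).comp_add_const δ δ).continuousAt.sub
          continuousAt_const
      exact this.tendsto.mono_left nhdsWithin_le_nhds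
    have h5 := ((h4.mul (h3.pow 2)).add (h1.mul (h2.pow 2))).sub
      ((h3.const_mul d2).const_add (d1 ^ 2))
    have h6 : (L.weierstrassP (δ + δ) - 2 * b) * 0 ^ 2 + 1 * d1 ^ 2 - (d1 ^ 2 + d2 * 0) = 0 := by
      ring
    rw [h6] at h5
    refine h5.congr' ?_
    filter_upwards [self_mem_nhdsWithin] with x hx
    have hx0 : x - δ ≠ 0 := sub_ne_zero.2 hx
    simp only [hf, hT]
    field_simp
    ring
  -- the behaviour at `0`: the double pole cancels, and a simple pole is excluded by parity
  have hord0 : 0 ≤ meromorphicOrderAt f 0 := by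
    have hTan : AnalyticAt ℂ T 0 := by
      have a1 : AnalyticAt ℂ (fun x => L.weierstrassP (x + δ)) 0 :=
        AnalyticAt.fun_comp (g := L.weierstrassP) (f := fun x => x + δ)
          (by simpa using L.analyticOnNhd_weierstrassP δ hδl) (by fun_prop)
      have a2 : AnalyticAt ℂ (fun x => L.weierstrassP (x - δ)) 0 :=
        AnalyticAt.fun_comp (g := L.weierstrassP) (f := fun x => x - δ)
          (by simpa using L.analyticOnNhd_weierstrassP (-δ) (by simpa using hδl)) (by fun_prop)
      exact (a1.fun_add a2).fun_sub analyticAt_const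
    have hT1 : ∀ᶠ x in 𝓝 (0 : ℂ), HasDerivAt T
        (L.derivWeierstrassP (x + δ) + L.derivWeierstrassP (x - δ)) x := by
      have e1 : ∀ᶠ x in 𝓝 (0 : ℂ), x + δ ∉ L.lattice :=
        (Continuous.tendsto' (by fun_prop : Continuous fun x : ℂ => x + δ) 0 δ (by simp)).eventually
          (eventually_notMem_lattice_of_notMem L hδl)
      have e2 : ∀ᶠ x in 𝓝 (0 : ℂ), x - δ ∉ L.lattice :=
        (Continuous.tendsto' (by fun_prop : Continuous fun x : ℂ => x - δ) 0 (-δ)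
          (by simp)).eventually (eventually_notMem_lattice_of_notMem L (by simpa using hδl))
      filter_upwards [e1, e2] with x h1 h2
      exact (((hasDerivAt_weierstrassP L h1).comp_add_const x δ).add
        ((hasDerivAt_weierstrassP L h2).comp_sub_const x δ)).sub_const _
    have hT1d : deriv T =ᶠ[𝓝 0] fun x => L.derivWeierstrassP (x + δ) + L.derivWeierstrassP (x - δ) := by
      filter_upwards [hT1] with x hx using hx.deriv
    have hδ2 : 2 * -δ ∉ L.lattice := by simpa using hδ
    have hT2 : deriv (deriv T) 0 = 2 * d2 := by
      rw [hT1d.deriv_eq]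
      have q1 := (hasDerivAt_derivWeierstrassP L (x := 0 + δ) (by simpa using hδ)).comp_add_const 0 δ
      have q2 := (hasDerivAt_derivWeierstrassP L (x := 0 - δ) (by simpa using hδ)).comp_sub_const 0 δ
      rw [(q1.fun_add q2).deriv]
      simp only [zero_add, zero_sub, L.weierstrassP_neg, ← hb, hd2]; ring
    obtain ⟨G, hG, hG0, hTG⟩ := exists_eq_sq_mul hTan
      (by simp only [hT, zero_add, zero_sub, L.weierstrassP_neg, ← hb]; ring)
      (by rw [hT1.self_of_nhds.deriv, zero_add, zero_sub, L.derivWeierstrassP_neg]; ring)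
    rw [hT2] at hG0
    have hP := tendsto_sq_mul_weierstrassP L L.lattice.zero_mem
    simp only [sub_zero] at hP
    have hPb : Tendsto (fun x : ℂ => x ^ 2 * (L.weierstrassP x - b)) (𝓝[≠] 0) (𝓝 1) := by
      have h0 : Tendsto (fun x : ℂ => x ^ 2 * b) (𝓝[≠] 0) (𝓝 0) :=
        (Continuous.tendsto' (by fun_prop) _ _ (by simp)).mono_left nhdsWithin_le_nhds
      simpa [mul_sub] using hP.sub h0
    have hG' : Tendsto G (𝓝[≠] 0) (𝓝 d2) := by
      have := hG.continuousAt.tendsto.mono_left (nhdsWithin_le_nhds (s := {(0 : ℂ)}ᶜ))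
      rwa [hG0, mul_div_cancel_left₀ _ two_ne_zero] at this
    have hx2 : Tendsto (fun x : ℂ => x ^ 2 * d1 ^ 2) (𝓝[≠] 0) (𝓝 0) :=
      (Continuous.tendsto' (by fun_prop) _ _ (by simp)).mono_left nhdsWithin_le_nhds
    have hlim : Tendsto (fun x => x ^ 2 * f x) (𝓝[≠] 0) (𝓝 0) := by
      have h := ((hG'.mul (hPb.pow 2)).sub hx2).sub (hPb.const_mul d2)
      rw [show d2 * 1 ^ 2 - 0 - d2 * 1 = 0 by ring] at h
      refine h.congr' ?_
      filter_upwards [hTG.filter_mono nhdsWithin_le_nhds] with x hx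
      simp only [hf, hx, sub_zero]; ring
    have hpos : 0 < meromorphicOrderAt (fun x => x ^ 2 * f x) 0 :=
      (tendsto_zero_iff_meromorphicOrderAt_pos
        (MeromorphicAt.fun_mul (by fun_prop) (hfm 0))).1 hlim
    have hsq : meromorphicOrderAt (fun x : ℂ => x ^ 2) 0 = (2 : ℕ) := by
      simpa using fun_meromorphicOrderAt_pow_id_sub_const (𝕜 := ℂ) (x := 0) (n := 2)
    rw [fun_meromorphicOrderAt_mul (by fun_prop) (hfm 0), hsq] at hpos
    by_cases htop : meromorphicOrderAt f 0 = ⊤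
    · rw [htop]; exact le_top
    lift meromorphicOrderAt f 0 to ℤ using htop with n hn
    have hpar := neg_one_zpow_order_of_reflection (f := f) (x₀ := 0) (ε := 1) (hfm 0)
      (by filter_upwards with t; simp [heven]) hn.symm
    have hn2 : 0 < 2 + n := by
      have : ((0 : ℤ) : WithTop ℤ) < ((2 + n : ℤ) : WithTop ℤ) := hpos
      exact WithTop.coe_lt_coe.1 this
    have hn1 : n ≠ -1 := by
      rintro rfl; norm_num at hpar
    exact_mod_cast (by omega : 0 ≤ n)
  have hord : ∀ x, 0 ≤ meromorphicOrderAt f x := by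
    intro x
    by_cases hx : x ∈ L.lattice
    · have := order_add_of_periodic hper 0 hx
      rw [zero_add] at this
      rwa [this]
    by_cases hx1 : x - δ ∈ L.lattice
    · have h := order_add_of_periodic hper δ hx1
      rw [show δ + (x - δ) = x by ring] at h
      rw [h]
      exact order_nonneg_of_tendsto (hfm δ) hlimδ
    by_cases hx2 : x + δ ∈ L.lattice
    · have h := order_add_of_periodic hper (-δ) hx2
      rw [show -δ + (x + δ) = x by ring] at h
      rw [h]
      refine order_nonneg_of_tendsto (c := 0) (hfm (-δ)) ?_
      have hm : Tendsto (fun x : ℂ => -x) (𝓝[≠] (-δ)) (𝓝[≠] δ) := by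
        refine tendsto_nhdsWithin_iff.2 ⟨?_, ?_⟩
        · exact (Continuous.tendsto' (by fun_prop) _ _ (by simp)).mono_left nhdsWithin_le_nhds
        · filter_upwards [self_mem_nhdsWithin] with x hx
          simpa [neg_eq_iff_eq_neg] using hx
      exact (hlimδ.comp hm).congr fun x => heven x
    exact order_nonneg_of_continuousAt (hfm x) (hcont x hx hx1 hx2)
  obtain ⟨c, hc⟩ := exists_eventually_eq_const_of_periodic L hfm hper hord
  have hc0 : c = 0 := tendsto_nhds_unique (tendsto_const_nhds.congr' (by
    filter_upwards [hc δ] with y hy using hy.symm)) hlimδ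
  have hfx : f x = 0 := by
    have h1 : Tendsto f (𝓝[≠] x) (𝓝 (f x)) :=
      (hcont x hx hx1 hx2).tendsto.mono_left nhdsWithin_le_nhds
    refine tendsto_nhds_unique h1 (tendsto_const_nhds.congr' ?_)
    filter_upwards [hc x] with y hy
    rw [hy, hc0]
  exact sub_eq_zero.1 hfx

/-- `℘` takes the value `℘(δ)` only at the translates of `δ` and `-δ`. -/
lemma weierstrassP_ne_weierstrassP {δ : ℂ} (hδ : 2 * δ ∉ L.lattice) {x : ℂ} (hx : x ∉ L.lattice)
    (hx1 : x - δ ∉ L.lattice) (hx2 : x + δ ∉ L.lattice) : L.weierstrassP x ≠ L.weierstrassP δ := by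
  intro h
  have h1 := weierstrassP_add_add_sub_mul L hδ hx hx1 hx2
  rw [h, sub_self] at h1
  exact pow_ne_zero 2 (derivWeierstrassP_ne_zero L hδ) (by linear_combination -h1)

end HalfPeriods

/-! ### Frobenius' method at a point with exponents `0` and `2` -/

section Frobenius

/-- The Taylor series of `f` at `b`. -/
noncomputable def taylorAt (b : ℂ) (f : ℂ → ℂ) : PowerSeries ℂ :=
  PowerSeries.mk fun n => iteratedDeriv n f b / n.factorial

lemma coeff_taylorAt (b : ℂ) (f : ℂ → ℂ) (n : ℕ) :
    PowerSeries.coeff n (taylorAt b f) = iteratedDeriv n f b / n.factorial :=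
  PowerSeries.coeff_mk _ _

lemma taylorAt_add {b : ℂ} {f g : ℂ → ℂ} (hf : AnalyticAt ℂ f b) (hg : AnalyticAt ℂ g b) :
    taylorAt b (fun z => f z + g z) = taylorAt b f + taylorAt b g := by
  ext n
  rw [map_add, coeff_taylorAt, coeff_taylorAt, coeff_taylorAt,
    iteratedDeriv_fun_add hf.contDiffAt hg.contDiffAt, add_div]

lemma taylorAt_mul {b : ℂ} {f g : ℂ → ℂ} (hf : AnalyticAt ℂ f b) (hg : AnalyticAt ℂ g b) :
    taylorAt b (fun z => f z * g z) = taylorAt b f * taylorAt b g := by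
  ext n
  rw [PowerSeries.coeff_mul, coeff_taylorAt, iteratedDeriv_fun_mul hf.contDiffAt hg.contDiffAt,
    Finset.Nat.sum_antidiagonal_eq_sum_range_succ_mk, Finset.sum_div]
  refine Finset.sum_congr rfl fun i hi => ?_
  have hi' : i ≤ n := Nat.lt_succ_iff.1 (Finset.mem_range.1 hi)
  rw [coeff_taylorAt, coeff_taylorAt, Nat.cast_choose ℂ hi']
  have h1 : (n.factorial : ℂ) ≠ 0 := Nat.cast_ne_zero.2 (Nat.factorial_ne_zero _)
  have h2 : (i.factorial : ℂ) ≠ 0 := Nat.cast_ne_zero.2 (Nat.factorial_ne_zero _)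
  have h3 : ((n - i).factorial : ℂ) ≠ 0 := Nat.cast_ne_zero.2 (Nat.factorial_ne_zero _)
  field_simp

lemma taylorAt_deriv (b : ℂ) (f : ℂ → ℂ) :
    taylorAt b (deriv f) = PowerSeries.derivative ℂ (taylorAt b f) := by
  ext n
  rw [PowerSeries.coeff_derivative, coeff_taylorAt, coeff_taylorAt, iteratedDeriv_succ',
    Nat.factorial_succ]
  have h1 : (n.factorial : ℂ) ≠ 0 := Nat.cast_ne_zero.2 (Nat.factorial_ne_zero _)
  have h2 : (n : ℂ) + 1 ≠ 0 := Nat.cast_add_one_ne_zero n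
  push_cast
  field_simp

lemma eventually_eq_zero_of_taylorAt {b : ℂ} {f : ℂ → ℂ} (hf : AnalyticAt ℂ f b)
    (h : taylorAt b f = 0) : ∀ᶠ z in 𝓝 b, f z = 0 := by
  have h1 := hf.hasFPowerSeriesAt
  have h2 : (fun n : ℕ => iteratedDeriv n f b / (n.factorial : ℂ)) = 0 := by
    funext n
    rw [← coeff_taylorAt, h]; rfl
  rw [h2, FormalMultilinearSeries.ofScalars_series_eq_zero_of_scalar_zero] at h1
  exact h1.eventually_eq_zero

/-- A power series with geometrically bounded coefficients is a Taylor series. -/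
lemma exists_taylorAt_eq (b : ℂ) {c : PowerSeries ℂ} {S : ℝ} (hS : 0 < S)
    (hc : ∀ n, ‖PowerSeries.coeff n c‖ ≤ S ^ n) :
    ∃ f : ℂ → ℂ, AnalyticAt ℂ f b ∧ taylorAt b f = c := by
  set p := FormalMultilinearSeries.ofScalars ℂ (fun n => PowerSeries.coeff n c) with hp
  have hrad : 0 < p.radius := by
    have h1 : ((S.toNNReal⁻¹ : NNReal) : ENNReal) ≤ p.radius := by
      refine p.le_radius_of_bound 1 fun n => ?_
      rw [hp, FormalMultilinearSeries.ofScalars_norm]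
      have : ((S.toNNReal⁻¹ : NNReal) : ℝ) = S⁻¹ := by
        rw [NNReal.coe_inv, Real.coe_toNNReal _ hS.le]
      rw [this]
      calc _ ≤ S ^ n * S⁻¹ ^ n := by gcongr; exact hc n
        _ = 1 := by rw [← mul_pow, mul_inv_cancel₀ hS.ne', one_pow]
    exact lt_of_lt_of_le (by simpa using hS) h1
  have h2 := (p.hasFPowerSeriesOnBall hrad).comp_sub b
  rw [zero_add] at h2
  have h3 : HasFPowerSeriesAt (fun z => p.sum (z - b)) p b := h2.hasFPowerSeriesAt
  refine ⟨fun z => p.sum (z - b), h3.analyticAt, ?_⟩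
  have h4 := h3.eq_formalMultilinearSeries h3.analyticAt.hasFPowerSeriesAt
  ext n
  have h5 := congrArg (fun q => FormalMultilinearSeries.coeff q n) h4
  rw [hp] at h5
  simp only [FormalMultilinearSeries.coeff_ofScalars] at h5
  rw [coeff_taylorAt, ← h5]

lemma taylorAt_sub_self (b : ℂ) : taylorAt b (fun z => z - b) = PowerSeries.X := by
  ext n
  rw [coeff_taylorAt, PowerSeries.coeff_X]
  rcases n with _ | _ | n
  · simp
  · rw [zero_add, iteratedDeriv_one]; simp
  · have : deriv (fun z : ℂ => z - b) = fun _ => 1 := by funext z; simp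
    rw [iteratedDeriv_succ', this, iteratedDeriv_succ']
    simp

/-- Analytic functions have geometrically bounded Taylor coefficients. -/
lemma exists_norm_coeff_taylorAt_le {b : ℂ} {f : ℂ → ℂ} (hf : AnalyticAt ℂ f b) :
    ∃ K R : ℝ, 0 < K ∧ 0 < R ∧ ∀ n, ‖PowerSeries.coeff n (taylorAt b f)‖ ≤ K * R ^ n := by
  obtain ⟨K, R, hK, hR, h⟩ := FormalMultilinearSeries.le_mul_pow_of_radius_pos _
    hf.hasFPowerSeriesAt.radius_pos
  refine ⟨K, R, hK, hR, fun n => ?_⟩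
  have := h n
  rwa [FormalMultilinearSeries.ofScalars_norm, ← coeff_taylorAt] at this

/-- The coefficients of the holomorphic solution, normalised at the origin, of
`t φ'' + 3 φ' + t A φ' + C φ = 0`, where `A = ∑ a_n tⁿ` and `C = ∑ c_n tⁿ`. -/
noncomputable def frobeniusCoeff (a c : ℕ → ℂ) : ℕ → ℂ
  | 0 => 1
  | n + 1 => -(∑ k : Fin (n + 1), (k * a (n - k) + c (n - k)) * frobeniusCoeff a c k)
      / ((n + 1) * (n + 3))
  decreasing_by exact k.2

lemma norm_frobeniusCoeff_le {a c : ℕ → ℂ} {K S : ℝ} (hK : 0 < K) (hKS : K ≤ S)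
    (ha : ∀ n, ‖a n‖ ≤ K * S ^ n) (hc : ∀ n, ‖c n‖ ≤ K * S ^ n) (n : ℕ) :
    ‖frobeniusCoeff a c n‖ ≤ S ^ n := by
  induction n using Nat.strong_induction_on with
  | _ n ih =>
    rcases n with _ | n
    · simp [frobeniusCoeff]
    have hS : 0 < S := hK.trans_le hKS
    rw [frobeniusCoeff, norm_div, norm_neg]
    have h1 : ‖((n : ℂ) + 1) * (n + 3)‖ = (n + 1) * (n + 3) := by
      rw [show ((n : ℂ) + 1) * (n + 3) = (((n + 1) * (n + 3) : ℕ) : ℂ) by push_cast; ring,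
        Complex.norm_natCast]
      push_cast; ring
    rw [h1, div_le_iff₀ (by positivity)]
    have h2 : ∀ k : Fin (n + 1), ‖((k : ℕ) * a (n - k) + c (n - k)) * frobeniusCoeff a c k‖
        ≤ (n + 1) * (K * S ^ n) := by
      intro k
      have hk : (k : ℕ) ≤ n := Nat.lt_succ_iff.1 k.2
      have h3 : ‖((k : ℕ) : ℂ) * a (n - k) + c (n - k)‖ ≤ (n + 1) * (K * S ^ (n - k)) := by
        calc _ ≤ ‖((k : ℕ) : ℂ) * a (n - k)‖ + ‖c (n - k)‖ := norm_add_le _ _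
          _ ≤ k * (K * S ^ (n - k)) + K * S ^ (n - k) := by
              rw [norm_mul, Complex.norm_natCast]
              gcongr
              · exact ha _
              · exact hc _
          _ = (k + 1) * (K * S ^ (n - k)) := by ring
          _ ≤ _ := by gcongr
      calc _ ≤ ((n + 1) * (K * S ^ (n - k))) * S ^ (k : ℕ) := by
            rw [norm_mul]
            gcongr
            exact ih k (by omega)
        _ = (n + 1) * (K * S ^ (n - k + k)) := by rw [pow_add]; ring
        _ = _ := by rw [Nat.sub_add_cancel hk]
    calc _ ≤ ∑ k : Fin (n + 1), (n + 1) * (K * S ^ n) :=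
          (norm_sum_le _ _).trans (Finset.sum_le_sum fun k _ => h2 k)
      _ = (n + 1) * (n + 1) * S ^ n * K := by simp; ring
      _ ≤ (n + 1) * (n + 3) * S ^ n * S := by gcongr; norm_num
      _ = _ := by rw [pow_succ]; ring

/-- Existence of the Frobenius solution `(z - b)² φ` belonging to the larger exponent. -/
theorem exists_frobenius_solution {A C : ℂ → ℂ} {b : ℂ} (hA : AnalyticAt ℂ A b)
    (hC : AnalyticAt ℂ C b) : ∃ φ : ℂ → ℂ, AnalyticAt ℂ φ b ∧ φ b = 1 ∧ ∀ᶠ z in 𝓝 b,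
      (z - b) * deriv (deriv φ) z + 3 * deriv φ z + (z - b) * A z * deriv φ z + C z * φ z = 0 := by
  obtain ⟨K₁, R₁, hK₁, hR₁, h₁⟩ := exists_norm_coeff_taylorAt_le hA
  obtain ⟨K₂, R₂, hK₂, hR₂, h₂⟩ := exists_norm_coeff_taylorAt_le hC
  set a : ℕ → ℂ := fun n => PowerSeries.coeff n (taylorAt b A) with ha
  set c : ℕ → ℂ := fun n => PowerSeries.coeff n (taylorAt b C) with hc
  set K := K₁ + K₂ with hK
  set S := K + R₁ + R₂ with hS
  have hbound := norm_frobeniusCoeff_le (a := a) (c := c) (K := K) (S := S) (by positivity)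
    (by linarith)
    (fun n => (h₁ n).trans (by gcongr <;> linarith)) (fun n => (h₂ n).trans (by gcongr <;> linarith))
  obtain ⟨φ, hφ, hT⟩ := exists_taylorAt_eq b (c := PowerSeries.mk (frobeniusCoeff a c)) (S := S)
    (by positivity) (by simpa using hbound)
  refine ⟨φ, hφ, ?_, ?_⟩
  · have := congrArg (PowerSeries.coeff 0) hT
    rw [coeff_taylorAt, PowerSeries.coeff_mk] at this
    simpa [frobeniusCoeff] using this
  have hφ1 := hφ.deriv
  have hφ2 := hφ1.deriv
  have ht : AnalyticAt ℂ (fun z : ℂ => z - b) b := by fun_prop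
  have h3 : AnalyticAt ℂ (fun _ : ℂ => (3 : ℂ)) b := analyticAt_const
  have a1 := ht.fun_mul hφ2
  have a2 : AnalyticAt ℂ (fun z => deriv φ z + deriv φ z + deriv φ z) b :=
    (hφ1.fun_add hφ1).fun_add hφ1
  have a3 := (ht.fun_mul hA).fun_mul hφ1
  have a4 := hC.fun_mul hφ
  have key := eventually_eq_zero_of_taylorAt (((a1.fun_add a2).fun_add a3).fun_add a4) ?_
  · filter_upwards [key] with z hz
    linear_combination hz
  rw [taylorAt_add ((a1.fun_add a2).fun_add a3) a4, taylorAt_add (a1.fun_add a2) a3,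
    taylorAt_add a1 a2, taylorAt_add (hφ1.fun_add hφ1) hφ1, taylorAt_add hφ1 hφ1,
    taylorAt_mul ht hφ2, taylorAt_mul (ht.fun_mul hA) hφ1, taylorAt_mul ht hA, taylorAt_mul hC hφ,
    taylorAt_deriv, taylorAt_deriv, hT, taylorAt_sub_self]
  -- compare coefficients with the recursion defining `frobeniusCoeff`
  ext n
  set c₀ := frobeniusCoeff a c with hc₀
  have q0 : ∀ m, PowerSeries.coeff m (PowerSeries.derivative ℂ (PowerSeries.mk c₀))
      = c₀ (m + 1) * (m + 1) := by
    intro m; rw [PowerSeries.coeff_derivative, PowerSeries.coeff_mk]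
  have q1 : PowerSeries.coeff n (PowerSeries.X * PowerSeries.derivative ℂ
      (PowerSeries.derivative ℂ (PowerSeries.mk c₀))) = n * (c₀ (n + 1) * (n + 1)) := by
    rcases n with _ | n
    · simp
    · rw [PowerSeries.coeff_succ_X_mul, PowerSeries.coeff_derivative, q0]; push_cast; ring
  have q2 : ∀ m, PowerSeries.coeff m (PowerSeries.X * PowerSeries.derivative ℂ (PowerSeries.mk c₀))
      = m * c₀ m := by
    intro m
    rcases m with _ | m
    · simp
    · rw [PowerSeries.coeff_succ_X_mul, q0]; push_cast; ring
  have q3 : PowerSeries.coeff n (PowerSeries.X * taylorAt b A *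
      PowerSeries.derivative ℂ (PowerSeries.mk c₀)) + PowerSeries.coeff n (taylorAt b C *
        PowerSeries.mk c₀) = ∑ k : Fin (n + 1), (k * a (n - k) + c (n - k)) * c₀ k := by
    rw [show PowerSeries.X * taylorAt b A * PowerSeries.derivative ℂ (PowerSeries.mk c₀)
      = (PowerSeries.X * PowerSeries.derivative ℂ (PowerSeries.mk c₀)) * taylorAt b A by ring,
      mul_comm (taylorAt b C), PowerSeries.coeff_mul, PowerSeries.coeff_mul,
      Finset.Nat.sum_antidiagonal_eq_sum_range_succ_mk,
      Finset.Nat.sum_antidiagonal_eq_sum_range_succ_mk, ← Finset.sum_add_distrib,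
      Finset.sum_range]
    refine Finset.sum_congr rfl fun k _ => ?_
    simp only [q2, PowerSeries.coeff_mk, ha, hc]
    ring
  have q4 : c₀ (n + 1) * ((n + 1) * (n + 3)) =
      -(∑ k : Fin (n + 1), (k * a (n - k) + c (n - k)) * c₀ k) := by
    rw [hc₀, frobeniusCoeff]
    have : ((n : ℂ) + 1) * (n + 3) ≠ 0 := by
      rw [show ((n : ℂ) + 1) * (n + 3) = (((n + 1) * (n + 3) : ℕ) : ℂ) by push_cast; ring]
      exact Nat.cast_ne_zero.2 (by positivity)
    rw [div_mul_cancel₀ _ this]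
  simp only [map_add, q1, q0, map_zero]
  linear_combination q3 + q4

end Frobenius

/-! ### Logarithms at a point with exponents `0` and `2` -/

section SecondSolution

lemma exists_primitive {f : ℂ → ℂ} {b : ℂ} (hf : AnalyticAt ℂ f b) :
    ∃ F : ℂ → ℂ, AnalyticAt ℂ F b ∧ ∀ᶠ z in 𝓝 b, HasDerivAt F (f z) z := by
  obtain ⟨ρ, hρ, h⟩ := Metric.eventually_nhds_iff_ball.1 hf.eventually_analyticAt
  obtain ⟨F, hF⟩ := DifferentiableOn.isExactOn_ball (c := b) (r := ρ) (f := f)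
    fun z hz => (h z hz).differentiableAt.differentiableWithinAt
  have hd : ∀ᶠ z in 𝓝 b, HasDerivAt F (f z) z := by
    filter_upwards [Metric.ball_mem_nhds b hρ] with z hz using hF z hz
  refine ⟨F, ?_, hd⟩
  rw [Complex.analyticAt_iff_eventually_differentiableAt]
  filter_upwards [hd] with z hz using hz.differentiableAt

lemma AnalyticAt.dslope_self {f : ℂ → ℂ} {b : ℂ} (hf : AnalyticAt ℂ f b) :
    AnalyticAt ℂ (dslope f b) b := by
  obtain ⟨p, hp⟩ := hf
  exact hp.has_fpower_series_dslope_fslope.analyticAt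

lemma eq_add_mul_dslope (f : ℂ → ℂ) (b z : ℂ) : f z = f b + (z - b) * dslope f b z := by
  have := sub_smul_dslope f b z
  rw [smul_eq_mul] at this
  rw [this]; ring

lemma SolvesAt.congr {P Q f g : ℂ → ℂ} {z : ℂ} (h : SolvesAt P Q f z) (hfg : f =ᶠ[𝓝 z] g) :
    SolvesAt P Q g z := by
  rw [SolvesAt, hfg.deriv.deriv_eq, hfg.deriv_eq, hfg.self_of_nhds] at h
  exact h

/-- Reduction of order: if `w = (z - b)² φ` is a solution and `W = (z - b) ε` a Wronskian, then
`w V` with `V' = W / w²` is a solution. -/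
lemma solvesAt_mul {P Q A B φ ε V : ℂ → ℂ} {b q z : ℂ} (hz : z ≠ b)
    (hP : P z = -1 / (z - b) + A z) (hQ : Q z = q / (z - b) + B z)
    (hφ : AnalyticAt ℂ φ z) (hφ0 : φ z ≠ 0)
    (hode : (z - b) * deriv (deriv φ) z + 3 * deriv φ z + (z - b) * A z * deriv φ z
      + (2 * A z + q + (z - b) * B z) * φ z = 0)
    (hε : HasDerivAt ε (-A z * ε z) z)
    (hV : ∀ᶠ y in 𝓝 z, HasDerivAt V (ε y / ((y - b) ^ 3 * φ y ^ 2)) y) :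
    SolvesAt P Q (fun y => (y - b) ^ 2 * φ y * V y) z := by
  have hzb := sub_ne_zero.2 hz
  have ht : ∀ y, HasDerivAt (fun y : ℂ => y - b) 1 y := fun y => (hasDerivAt_id y).sub_const b
  have h1 : ∀ᶠ y in 𝓝 z, HasDerivAt (fun y => (y - b) ^ 2 * φ y * V y)
      ((2 * (y - b) * φ y + (y - b) ^ 2 * deriv φ y) * V y + ε y / ((y - b) * φ y)) y := by
    filter_upwards [hV, hφ.eventually_analyticAt, hφ.continuousAt.eventually_ne hφ0,
      eventually_ne_nhds hz] with y hy hφy hφy0 hyb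
    have hyb' := sub_ne_zero.2 hyb
    refine ((((ht y).fun_pow 2).fun_mul hφy.differentiableAt.hasDerivAt).fun_mul hy).congr_deriv ?_
    simp only [Nat.cast_ofNat, Nat.add_one_sub_one, pow_one]
    field_simp
  have h1' : deriv (fun y => (y - b) ^ 2 * φ y * V y) =ᶠ[𝓝 z] fun y =>
      (2 * (y - b) * φ y + (y - b) ^ 2 * deriv φ y) * V y + ε y / ((y - b) * φ y) := by
    filter_upwards [h1] with y hy using hy.deriv
  have d0 := hφ.differentiableAt.hasDerivAt
  have d1 := hφ.deriv.differentiableAt.hasDerivAt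
  have h2 := (((((ht z).const_mul 2).fun_mul d0).fun_add (((ht z).fun_pow 2).fun_mul d1)).fun_mul
    hV.self_of_nhds).fun_add (hε.fun_div ((ht z).fun_mul d0) (mul_ne_zero hzb hφ0))
  rw [SolvesAt, h1'.deriv_eq, h2.deriv, h1.self_of_nhds.deriv, hP, hQ]
  simp only [Nat.cast_ofNat, Nat.add_one_sub_one, pow_one]
  have e : (z - b) * deriv (deriv φ) z = -(3 * deriv φ z + (z - b) * A z * deriv φ z
      + (2 * A z + q + (z - b) * B z) * φ z) := by linear_combination hode
  field_simp
  linear_combination ((z - b) ^ 3 * φ z ^ 2 * V z) * e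

/-- At a singular point with exponents `0` and `2`, the absence of logarithms gives the classical
condition on the coefficients: otherwise the second solution contains a logarithm. -/
theorem coeff_condition_of_not_hasLogarithmicSolution {P Q A B : ℂ → ℂ} {b q : ℂ}
    (hA : AnalyticAt ℂ A b) (hB : AnalyticAt ℂ B b)
    (hP : ∀ᶠ z in 𝓝[≠] b, P z = -1 / (z - b) + A z)
    (hQ : ∀ᶠ z in 𝓝[≠] b, Q z = q / (z - b) + B z)
    (hlog : ¬ HasLogarithmicSolution P Q b) : q * (A b + q) + B b = 0 := by
  obtain ⟨φ, hφ, hφ1, hode⟩ := exists_frobenius_solution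
    (A := A) (C := fun z => 2 * A z + q + (z - b) * B z) hA (by fun_prop)
  obtain ⟨a, ha, hda⟩ := exists_primitive hA
  set ε : ℂ → ℂ := fun z => Complex.exp (-(a z - a b)) with hε
  have hεan : AnalyticAt ℂ ε b := by
    have : AnalyticAt ℂ (fun z => -(a z - a b)) b := by fun_prop
    exact this.cexp
  have hεd : ∀ᶠ z in 𝓝 b, HasDerivAt ε (-A z * ε z) z := by
    filter_upwards [hda] with z hz
    refine ((hz.sub_const (a b)).fun_neg.cexp).congr_deriv ?_
    simp only [hε]; ring
  have hφ0 : φ b ≠ 0 := by rw [hφ1]; exact one_ne_zero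
  -- the second solution is `w ∫ ψ / (z - b)³`, and its logarithm has the coefficient `ψ₂ b`
  set ψ : ℂ → ℂ := fun z => ε z / φ z ^ 2 with hψ
  have hψan : AnalyticAt ℂ ψ b := hεan.fun_div (hφ.fun_pow 2) (pow_ne_zero 2 hφ0)
  have hψb : ψ b = 1 := by simp [hψ, hε, hφ1]
  set ψ₁ := dslope ψ b
  set ψ₂ := dslope ψ₁ b
  set ψ₃ := dslope ψ₂ b
  have hψ₁ : AnalyticAt ℂ ψ₁ b := AnalyticAt.dslope_self hψan
  have hψ₂ : AnalyticAt ℂ ψ₂ b := AnalyticAt.dslope_self hψ₁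
  have hψ₃ : AnalyticAt ℂ ψ₃ b := AnalyticAt.dslope_self hψ₂
  have hexp : ∀ z, ψ z = 1 + ψ₁ b * (z - b) + ψ₂ b * (z - b) ^ 2 + ψ₃ z * (z - b) ^ 3 := by
    intro z
    have e1 := eq_add_mul_dslope ψ b z
    have e2 := eq_add_mul_dslope ψ₁ b z
    have e3 := eq_add_mul_dslope ψ₂ b z
    rw [hψb] at e1
    linear_combination e1 + (z - b) * e2 + (z - b) ^ 2 * e3
  obtain ⟨Ψ, hΨ, hΨd⟩ := exists_primitive hψ₃
  -- the principal part of the antiderivative of `ψ / (z - b) ^ 3`, without the logarithm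
  set V : ℂ → ℂ := fun z => -(1 / 2) * (1 / (z - b) ^ 2) - ψ₁ b * (1 / (z - b)) + Ψ z with hV
  have hVd : ∀ᶠ z in 𝓝[≠] b, HasDerivAt V
      (1 / (z - b) ^ 3 + ψ₁ b / (z - b) ^ 2 + ψ₃ z) z := by
    filter_upwards [hΨd.filter_mono nhdsWithin_le_nhds, self_mem_nhdsWithin] with z hz hzb
    have hzb' : z - b ≠ 0 := sub_ne_zero.2 hzb
    have ht : HasDerivAt (fun y : ℂ => y - b) 1 z := (hasDerivAt_id z).sub_const b
    have c1 := (hasDerivAt_const z (1 : ℂ)).fun_div (ht.fun_pow 2) (pow_ne_zero 2 hzb')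
    have c2 := (hasDerivAt_const z (1 : ℂ)).fun_div ht hzb'
    refine (((c1.const_mul (-(1 / 2))).fun_sub (c2.const_mul (ψ₁ b))).fun_add hz).congr_deriv ?_
    simp only [Nat.cast_ofNat, Nat.add_one_sub_one, pow_one]
    field_simp
    ring
  -- near each point `z ≠ b` close to `b`, everything is regular
  have hgood : ∀ᶠ z in 𝓝[≠] b, ∀ V₁ : ℂ → ℂ,
      (∀ᶠ y in 𝓝 z, HasDerivAt V₁ (ψ y / (y - b) ^ 3) y) →
      SolvesAt P Q (fun y => (y - b) ^ 2 * φ y * V₁ y) z := by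
    have n1 : ∀ᶠ z in 𝓝 b, φ z ≠ 0 := hφ.continuousAt.eventually_ne hφ0
    filter_upwards [hP, hQ, n1.filter_mono nhdsWithin_le_nhds,
      hφ.eventually_analyticAt.filter_mono nhdsWithin_le_nhds,
      hode.filter_mono nhdsWithin_le_nhds, hεd.filter_mono nhdsWithin_le_nhds,
      self_mem_nhdsWithin] with z z1 z2 z3 z4 z5 z6 z7 V₁ hV₁
    refine solvesAt_mul z7 z1 z2 z4 z3 z5 z6 ?_
    filter_upwards [hV₁] with y hy
    refine hy.congr_deriv ?_
    simp only [hψ]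
    rw [div_div, mul_comm]
  have hVd2 : ∀ᶠ z in 𝓝[≠] b, ∀ᶠ y in 𝓝 z, y ≠ b ∧ HasDerivAt V
      (1 / (y - b) ^ 3 + ψ₁ b / (y - b) ^ 2 + ψ₃ y) y := by
    have := eventually_nhdsNE_eventually_nhds_iff.2 (hVd.and self_mem_nhdsWithin)
    filter_upwards [this] with z hz
    filter_upwards [hz] with y hy using ⟨hy.2, hy.1⟩
  -- the coefficient of the logarithm vanishes
  have hψ₂0 : ψ₂ b = 0 := by
    by_contra hne
    refine hlog ⟨fun z => (z - b) ^ 2 * φ z * V z, fun z => (z - b) ^ 2 * φ z * ψ₂ b, ?_, ?_, ?_, ?_⟩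
    · have hm : MeromorphicAt φ b := hφ.meromorphicAt
      have hm' : MeromorphicAt Ψ b := hΨ.meromorphicAt
      simp only [hV]
      fun_prop
    · have hm : MeromorphicAt φ b := hφ.meromorphicAt
      fun_prop
    · intro h
      have n1 : ∀ᶠ z in 𝓝[≠] b, φ z ≠ 0 :=
        (hφ.continuousAt.eventually_ne hφ0).filter_mono nhdsWithin_le_nhds
      obtain ⟨z, h1, h2, h3⟩ := (h.and (n1.and self_mem_nhdsWithin)).exists
      exact mul_ne_zero (mul_ne_zero (pow_ne_zero 2 (sub_ne_zero.2 h3)) h2) hne h1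
    · filter_upwards [hgood, hVd2] with z h1 h2 h3
      have h4 : ∀ᶠ y in 𝓝 z, y - b ∈ Complex.slitPlane :=
        (Continuous.continuousAt (by fun_prop : Continuous fun y : ℂ => y - b)).eventually
          (Complex.isOpen_slitPlane.mem_nhds h3)
      refine (h1 (fun y => V y + ψ₂ b * Complex.log (y - b)) ?_).congr
        (Eventually.of_forall fun y => by ring)
      filter_upwards [h2, h4] with y h5 h6
      have ht : HasDerivAt (fun y : ℂ => y - b) 1 y := (hasDerivAt_id y).sub_const b
      have hy := sub_ne_zero.2 h5.1
      refine (h5.2.fun_add ((ht.clog h6).const_mul (ψ₂ b))).congr_deriv ?_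
      rw [hexp y]
      field_simp
      ring
  -- hence there is a holomorphic solution which does not vanish at `b`
  set U : ℂ → ℂ := fun z => φ z * (-(1 / 2) - ψ₁ b * (z - b) + (z - b) ^ 2 * Ψ z) with hU
  have hUan : AnalyticAt ℂ U b := by simp only [hU]; fun_prop
  have hUb : U b ≠ 0 := by simp [hU, hφ1]
  have hUsol : ∀ᶠ z in 𝓝[≠] b, SolvesAt P Q U z := by
    filter_upwards [hgood, hVd2] with z h1 h2
    refine (h1 V ?_).congr ?_
    · filter_upwards [h2] with y h5
      have hy := sub_ne_zero.2 h5.1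
      refine h5.2.congr_deriv ?_
      rw [hexp y, hψ₂0]
      field_simp
      ring
    · filter_upwards [h2] with y h5
      have hy := sub_ne_zero.2 h5.1
      simp only [hU, hV]
      field_simp
  have hU1 := hUan.deriv
  have hU2 := hU1.deriv
  -- the equation for `U`, multiplied by `z - b`; its value and derivative at `b` give the condition
  set G : ℂ → ℂ := fun z => (z - b) * deriv (deriv U) z - deriv U z + (z - b) * A z * deriv U z
    + q * U z + (z - b) * B z * U z with hG
  have hGan : AnalyticAt ℂ G b := by simp only [hG]; fun_prop
  have hG0 : ∀ᶠ z in 𝓝 b, G z = 0 := by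
    refine hGan.frequently_zero_iff_eventually_zero.1 (Eventually.frequently ?_)
    filter_upwards [hUsol, hP, hQ, self_mem_nhdsWithin] with z z1 z2 z3 z4
    have hz : z - b ≠ 0 := sub_ne_zero.2 z4
    rw [SolvesAt, z2, z3] at z1
    simp only [hG]
    rw [show deriv (deriv U) z = -((-1 / (z - b) + A z) * deriv U z + (q / (z - b) + B z) * U z) by
      linear_combination z1]
    field_simp
    ring
  have e1 : deriv U b = q * U b := by
    have := hG0.self_of_nhds
    simp only [hG, sub_self] at this
    linear_combination -this
  have e2 : deriv G b = 0 := by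
    have : G =ᶠ[𝓝 b] fun _ => 0 := hG0
    rw [this.deriv_eq]; simp
  have ht : HasDerivAt (fun y : ℂ => y - b) 1 b := (hasDerivAt_id b).sub_const b
  have dU := hUan.differentiableAt.hasDerivAt
  have dU1 := hU1.differentiableAt.hasDerivAt
  have dU2 := hU2.differentiableAt.hasDerivAt
  have dG := (((((ht.fun_mul dU2).fun_sub dU1).fun_add
    ((ht.fun_mul hA.differentiableAt.hasDerivAt).fun_mul dU1)).fun_add (dU.const_mul q)).fun_add
    ((ht.fun_mul hB.differentiableAt.hasDerivAt).fun_mul dU)).deriv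
  rw [show deriv (fun z => (z - b) * deriv (deriv U) z - deriv U z + (z - b) * A z * deriv U z
    + q * U z + (z - b) * B z * U z) b = deriv G b from rfl, e2] at dG
  simp only [sub_self] at dG
  apply mul_right_cancel₀ hUb
  rw [e1] at dG
  linear_combination -dG

end SecondSolution

/-! ### Potentials in partial fraction form -/

section PartialFractions

open Polynomial

lemma X_sub_C_pow_three_dvd {S : ℂ[X]} {c : ℂ} (h0 : S.eval c = 0) (h1 : (derivative S).eval c = 0)
    (h2 : (derivative (derivative S)).eval c = 0) : (X - C c) ^ 3 ∣ S := by
  by_cases hS : S = 0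
  · rw [hS]; exact dvd_zero _
  rw [← le_rootMultiplicity_iff hS, Nat.succ_le_iff,
    lt_rootMultiplicity_iff_isRoot_iterate_derivative hS]
  intro m hm
  interval_cases m
  · exact h0
  · exact h1
  · exact h2

/-- On a function without gauge factor, the operator is `2 g³ Y''' + 3 p' τ g² Y'' + ⋯`. -/
lemma cubicOp_zero (p τ w Y : ℂ[X]) :
    cubicOp p τ w 0 Y = 2 * (p * τ) ^ 3 * derivative (derivative (derivative Y))
      + 3 * derivative p * τ * (p * τ) ^ 2 * derivative (derivative Y)
      + (p * derivative (derivative p) * τ ^ 2 - 8 * w) * (p * τ) * derivative Y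
      - 4 * (derivative w * (p * τ) - w * (derivative p * τ + 2 * p)) * Y := by
  simp only [cubicOp, twistedDeriv, derivative_mul, derivative_add, Nat.cast_zero, Nat.cast_one,
    Nat.cast_ofNat, zero_mul, sub_zero, zero_sub, one_mul, add_zero, derivative_neg]
  ring

/-- If the double pole of the potential at `c` is absent, the constant `1` solves the equation to
the required order. -/
lemma pow_dvd_cubicOp_one (p v : ℂ[X]) (c : ℂ) :
    (X - C c) ^ 3 ∣ cubicOp p (X - C c) ((X - C c) ^ 2 * v) 0 1 := by
  rw [cubicOp_zero]
  refine ⟨4 * (v * derivative p - derivative v * p), ?_⟩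
  simp only [derivative_one, derivative_zero, derivative_mul, derivative_pow, derivative_sub,
    derivative_X, derivative_C, Nat.cast_ofNat, Nat.add_one_sub_one, pow_one]
  simp only [map_ofNat]
  ring

/-- At a double pole of the potential with leading coefficient `3/4 p(c)`, the polynomial `τ + α τ²`
with `3 p(c) α = -2 β` solves the equation to the required order, under the condition on `β` and `γ`
which excludes logarithms. -/
lemma pow_dvd_cubicOp_linear {p N : ℂ[X]} {c β γ : ℂ} (hp : p.eval c ≠ 0)
    (h : N.eval c / p.eval c + γ = β ^ 2 / p.eval c
      - β * (derivative p).eval c / (2 * p.eval c) + (derivative (derivative p)).eval c / 8) :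
    (X - C c) ^ 4 ∣ cubicOp p (X - C c) (N * (X - C c) ^ 2 + C (3 / 4 * p.eval c) * p
        + C β * ((X - C c) * p) + C γ * ((X - C c) ^ 2 * p)) 0
      ((X - C c) + C (-2 * β / (3 * p.eval c)) * (X - C c) ^ 2) := by
  set τ : ℂ[X] := X - C c with hτ
  set α : ℂ := -2 * β / (3 * p.eval c) with hα
  set w : ℂ[X] := N * τ ^ 2 + C (3 / 4 * p.eval c) * p + C β * (τ * p) + C γ * (τ ^ 2 * p) with hw
  have hτ' : derivative τ = 1 := by simp [hτ]
  have hτc : τ.eval c = 0 := by simp [hτ]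
  set S : ℂ[X] := C (6 * α) * derivative p * p ^ 2 * τ ^ 2
    + (p * derivative (derivative p) * τ ^ 2 - C 8 * w) * p * (1 + C (2 * α) * τ)
    - C 4 * (derivative w * p * τ - w * derivative p * τ - C 2 * (w * p)) * (1 + C α * τ) with hS
  have hfac : cubicOp p τ w 0 (τ + C α * τ ^ 2) = τ * S := by
    rw [cubicOp_zero, hS]
    have d1 : derivative (τ + C α * τ ^ 2) = 1 + C (2 * α) * τ := by
      simp only [derivative_add, derivative_C_mul, derivative_pow, hτ', Nat.cast_ofNat,
        Nat.add_one_sub_one, pow_one, mul_one, map_mul, map_ofNat]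
      ring
    have d2 : derivative (1 + C (2 * α) * τ) = C (2 * α) := by
      simp only [derivative_add, derivative_C_mul, derivative_one, hτ', zero_add, mul_one]
    rw [d1, d2, derivative_C]
    simp only [map_mul, map_ofNat]
    ring
  set p0 := p.eval c with hp0
  set p1 := (derivative p).eval c with hp1
  set p2 := (derivative (derivative p)).eval c with hp2
  have w0 : w.eval c = 3 / 4 * p0 ^ 2 := by
    simp only [hw, eval_add, eval_mul, eval_pow, eval_C, hτc, ← hp0]; ring
  have dw : derivative w = derivative N * τ ^ 2 + C 2 * (N * τ) + C (3 / 4 * p0) * derivative p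
      + C β * (p + τ * derivative p) + C γ * (C 2 * (τ * p) + τ ^ 2 * derivative p) := by
    simp only [hw, derivative_add, derivative_mul, derivative_pow, derivative_C, hτ',
      Nat.cast_ofNat, Nat.add_one_sub_one, pow_one, map_mul, map_ofNat]
    ring
  have w1 : (derivative w).eval c = 3 / 4 * p0 * p1 + β * p0 := by
    rw [dw]
    simp only [eval_add, eval_mul, eval_pow, eval_C, hτc, ← hp0, ← hp1]; ring
  have w2 : (derivative (derivative w)).eval c
      = 2 * N.eval c + 3 / 4 * p0 * p2 + 2 * β * p1 + 2 * γ * p0 := by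
    rw [dw]
    simp only [derivative_add, derivative_mul, derivative_pow, derivative_C, hτ',
      Nat.cast_ofNat, Nat.add_one_sub_one, pow_one, map_ofNat, eval_add, eval_mul, eval_pow, eval_C,
      hτc, ← hp0, ← hp1, ← hp2, eval_ofNat, eval_zero, eval_one]
    ring
  have hα' : 3 * p0 * α = -2 * β := by rw [hα]; field_simp
  have hN : N.eval c = β ^ 2 - β * p1 / 2 + p0 * p2 / 8 - γ * p0 := by
    have : N.eval c = p0 * (N.eval c / p0 + γ) - γ * p0 := by field_simp; ring
    rw [this, h]; field_simp
  have hβ : β = -(3 / 2) * p0 * α := by linear_combination hα' / 2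
  rw [hfac, pow_succ' _ 3]
  refine mul_dvd_mul_left _ (X_sub_C_pow_three_dvd ?_ ?_ ?_)
  · simp only [hS, eval_add, eval_sub, eval_mul, eval_pow, eval_C, eval_one, hτc, w0, ← hp0]
    ring
  · simp only [hS, derivative_add, derivative_sub, derivative_mul, derivative_pow, derivative_C,
      derivative_one, hτ', Nat.cast_ofNat, Nat.add_one_sub_one, pow_one, map_ofNat, eval_add,
      eval_sub, eval_mul, eval_pow, eval_C, eval_one, eval_zero, eval_ofNat, hτc, w0, w1, ← hp0,
      ← hp1, derivative_ofNat]
    rw [hβ]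
    ring
  · simp only [hS, derivative_add, derivative_sub, derivative_mul, derivative_pow, derivative_C,
      derivative_one, hτ', Nat.cast_ofNat, Nat.add_one_sub_one, pow_one, map_ofNat, eval_add,
      eval_sub, eval_mul, eval_pow, eval_C, eval_one, eval_zero, eval_ofNat, hτc, w0, w1, w2, ← hp0,
      ← hp1, ← hp2, derivative_zero, derivative_ofNat]
    rw [hN, hβ]
    ring

variable (a : Fin 4 → ℂ) (c : ℂ) (l : Fin 4 → ℕ) (r : ℕ) (β γ : ℂ)

/-- The residue of the potential at the `i`-th root `a i` of `p`. -/
noncomputable def rootResidue (i : Fin 4) : ℂ :=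
  (l i : ℂ) * (l i + 1) / 4 * (derivative (∏ i, (X - C (a i)))).eval (a i)

/-- The numerator `w` of the potential `W = w / (p τ²)`, where `p = ∏ (X - a_i)`, `τ = X - c`, and
`W = ∑ l_i (l_i + 1) / 4 p'(a_i) / (X - a_i) + r (r + 2) / 4 p(c) / τ² + β / τ + γ`. -/
noncomputable def potentialNum : ℂ[X] :=
  (∑ i, C (rootResidue a l i) * Lagrange.nodal (Finset.univ.erase i) a) * (X - C c) ^ 2
    + C ((r : ℂ) * (r + 2) / 4 * (∏ i, (X - C (a i))).eval c) * (∏ i, (X - C (a i)))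
    + C β * ((X - C c) * ∏ i, (X - C (a i))) + C γ * ((X - C c) ^ 2 * ∏ i, (X - C (a i)))

lemma prod_eq_nodal : ∏ i, (X - C (a i)) = Lagrange.nodal Finset.univ a := rfl

lemma prod_eq_mul_nodal_erase (i : Fin 4) :
    ∏ i, (X - C (a i)) = (X - C (a i)) * Lagrange.nodal (Finset.univ.erase i) a :=
  Lagrange.nodal_eq_mul_nodal_erase (Finset.mem_univ i)

lemma natDegree_potentialNum_le : (potentialNum a c l r β γ).natDegree ≤ 6 := by
  have hp : (∏ i, (X - C (a i))).natDegree = 4 := by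
    rw [prod_eq_nodal, Lagrange.natDegree_nodal]; rfl
  have hτ : (X - C c).natDegree = 1 := natDegree_X_sub_C c
  have hτ2 : ((X - C c) ^ 2).natDegree ≤ 2 := by rw [natDegree_pow, hτ]
  have hN : (∑ i, C (rootResidue a l i) * Lagrange.nodal (Finset.univ.erase i) a).natDegree ≤ 3 := by
    refine natDegree_sum_le_of_forall_le _ _ fun i _ => (natDegree_C_mul_le _ _).trans ?_
    rw [Lagrange.natDegree_nodal, Finset.card_erase_of_mem (Finset.mem_univ i)]; rfl
  refine natDegree_add_le_of_degree_le (natDegree_add_le_of_degree_le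
    (natDegree_add_le_of_degree_le ?_ ?_) ?_) ?_
  · exact natDegree_mul_le.trans (by omega)
  · exact (natDegree_C_mul_le _ _).trans (by omega)
  · exact (natDegree_C_mul_le _ _).trans (natDegree_mul_le.trans (by omega))
  · exact (natDegree_C_mul_le _ _).trans (natDegree_mul_le.trans (by omega))

lemma eval_potentialNum_root (i : Fin 4) : 4 * (potentialNum a c l r β γ).eval (a i)
    = l i * (l i + 1) * ((derivative (∏ i, (X - C (a i)))).eval (a i) * (a i - c)) ^ 2 := by
  have hp : (∏ i, (X - C (a i))).eval (a i) = 0 := by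
    rw [prod_eq_mul_nodal_erase a i]; simp
  have hs : ∑ j, rootResidue a l j * (Lagrange.nodal (Finset.univ.erase j) a).eval (a i)
      = rootResidue a l i * (derivative (∏ i, (X - C (a i)))).eval (a i) := by
    rw [Finset.sum_eq_single i]
    · rw [prod_eq_nodal, Lagrange.eval_nodal_derivative_eval_node_eq (Finset.mem_univ i)]
    · intro j _ hj
      rw [Lagrange.eval_nodal_at_node (by simpa using hj.symm), mul_zero]
    · simp
  simp only [potentialNum, eval_add, eval_mul, eval_finsetSum, eval_C, hp, hs, eval_pow, eval_sub,
    eval_X]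
  rw [rootResidue]
  ring

lemma eval_potentialNum_pole : 4 * (potentialNum a c l r β γ).eval c
    = r * (r + 2) * ((∏ i, (X - C (a i))).eval c) ^ 2 := by
  simp only [potentialNum, eval_add, eval_mul, eval_C, eval_pow, eval_sub, eval_X, sub_self]
  ring

/-- The partial fraction expansion of the potential. -/
lemma eval_potentialNum {ζ : ℂ} (hζ : ∀ i, ζ ≠ a i) (hζ' : ζ ≠ c) :
    (potentialNum a c l r β γ).eval ζ = (∏ i, (X - C (a i))).eval ζ * (ζ - c) ^ 2 *
      (∑ i, rootResidue a l i / (ζ - a i)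
        + r * (r + 2) / 4 * (∏ i, (X - C (a i))).eval c / (ζ - c) ^ 2 + β / (ζ - c) + γ) := by
  have h1 : ∀ i, (Lagrange.nodal (Finset.univ.erase i) a).eval ζ
      = (∏ i, (X - C (a i))).eval ζ / (ζ - a i) := by
    intro i
    rw [prod_eq_mul_nodal_erase a i, eval_mul]
    simp only [eval_sub, eval_X, eval_C]
    rw [mul_div_cancel_left₀ _ (sub_ne_zero.2 (hζ i))]
  have hc' := sub_ne_zero.2 hζ'
  simp only [potentialNum, eval_add, eval_mul, eval_finsetSum, eval_C, eval_pow, eval_sub, eval_X,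
    h1]
  have h2 : ∑ i, rootResidue a l i * ((∏ i, (X - C (a i))).eval ζ / (ζ - a i))
      = (∏ i, (X - C (a i))).eval ζ * ∑ i, rootResidue a l i / (ζ - a i) := by
    rw [Finset.mul_sum]
    exact Finset.sum_congr rfl fun i _ => by ring
  rw [h2]
  field_simp

/-- Rational solutions for a potential in partial fraction form, with at most one singular point apart
from the roots of `p`: for `r = 0` the point `c` is an ordinary one, and for `r = 1` the condition on
the coefficients excludes logarithms at `c`. -/
theorem exists_cubicOp_potentialNum_eq_zero (ha : Function.Injective a) (hc : ∀ i, a i ≠ c)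
    (h : (r = 0 ∧ β = 0) ∨ (r = 1 ∧ ∑ i, rootResidue a l i / (c - a i) + γ
      = β ^ 2 / (∏ i, (X - C (a i))).eval c
        - β * (derivative (∏ i, (X - C (a i)))).eval c / (2 * (∏ i, (X - C (a i))).eval c)
        + (derivative (derivative (∏ i, (X - C (a i))))).eval c / 8)) :
    ∃ F : ℂ[X], F ≠ 0 ∧ F.natDegree ≤ ∑ i, l i + r ∧
      cubicOp (∏ i, (X - C (a i))) (X - C c) (potentialNum a c l r β γ) (gauge a c l r) F = 0 := by
  have hτ : Irreducible (X - C c) := irreducible_X_sub_C c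
  have hτ0 : (X - C c) ≠ 0 := X_sub_C_ne_zero c
  rcases h with ⟨rfl, rfl⟩ | ⟨rfl, h⟩
  · refine exists_cubicOp_eq_zero ha hc (natDegree_potentialNum_le a c l 0 0 γ)
      (eval_potentialNum_root a c l 0 0 γ) (eval_potentialNum_pole a c l 0 0 γ) (Y := 1) ?_ ?_
    · intro hd
      exact hτ.not_isUnit (isUnit_of_dvd_one ((dvd_pow_self _ (by norm_num)).trans hd))
    · have := pow_dvd_cubicOp_one (∏ i, (X - C (a i)))
        ((∑ i, C (rootResidue a l i) * Lagrange.nodal (Finset.univ.erase i) a)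
          + C γ * ∏ i, (X - C (a i))) c
      convert this using 2
      simp only [potentialNum, Nat.cast_zero, zero_mul, zero_div, map_zero]
      ring
  · have hpc : (∏ i, (X - C (a i))).eval c ≠ 0 := by
      rw [prod_eq_nodal, Lagrange.eval_nodal]
      exact Finset.prod_ne_zero_iff.2 fun i _ => sub_ne_zero.2 (hc i).symm
    have hNc : (∑ i, C (rootResidue a l i) * Lagrange.nodal (Finset.univ.erase i) a).eval c
        / (∏ i, (X - C (a i))).eval c = ∑ i, rootResidue a l i / (c - a i) := by
      rw [eval_finsetSum, Finset.sum_div]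
      refine Finset.sum_congr rfl fun i _ => ?_
      have hi : c - a i ≠ 0 := sub_ne_zero.2 (hc i).symm
      rw [prod_eq_mul_nodal_erase a i, eval_mul, eval_mul, eval_C, eval_sub, eval_X, eval_C] at *
      have := right_ne_zero_of_mul hpc
      field_simp
    refine exists_cubicOp_eq_zero ha hc (natDegree_potentialNum_le a c l 1 β γ)
      (eval_potentialNum_root a c l 1 β γ) (eval_potentialNum_pole a c l 1 β γ) ?_
      (Y := (X - C c) + C (-2 * β / (3 * (∏ i, (X - C (a i))).eval c)) * (X - C c) ^ 2) ?_
    · intro hd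
      have h1 : (X - C c) ^ 2 ∣ (X - C c) := by
        have h2 : (X - C c) ^ 2 ∣ (X - C c) + C (-2 * β / (3 * (∏ i, (X - C (a i))).eval c))
            * (X - C c) ^ 2 := (pow_dvd_pow _ (by norm_num)).trans hd
        exact (dvd_add_left (dvd_mul_left _ _)).1 h2
      rw [pow_two] at h1
      have h3 : (X - C c) ∣ 1 := by
        refine (mul_dvd_mul_iff_left hτ0).1 ?_
        rwa [mul_one]
      exact hτ.not_isUnit (isUnit_of_dvd_one h3)
    · rw [← hNc] at h
      have := pow_dvd_cubicOp_linear hpc h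
      convert this using 2
      simp only [potentialNum, Nat.cast_one]
      norm_num

end PartialFractions

/-! ### The coordinate `ζ = 1 / (z - θ)` -/

section Moebius

open Polynomial

variable (e₁ e₂ e₃ b θ : ℂ)

/-- The images of `∞, e₁, e₂, e₃` under `z ↦ 1 / (z - θ)`. -/
noncomputable def moebiusRoots : Fin 4 → ℂ := ![0, 1 / (e₁ - θ), 1 / (e₂ - θ), 1 / (e₃ - θ)]

variable {e₁ e₂ e₃ b θ}

lemma moebiusRoots_injective (h12 : e₁ ≠ e₂) (h13 : e₁ ≠ e₃) (h23 : e₂ ≠ e₃) (h1 : e₁ ≠ θ)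
    (h2 : e₂ ≠ θ) (h3 : e₃ ≠ θ) : Function.Injective (moebiusRoots e₁ e₂ e₃ θ) := by
  have key : ∀ {x y : ℂ}, x ≠ y → 1 / (x - θ) ≠ 1 / (y - θ) := by
    intro x y hxy h
    rw [one_div, one_div, inv_inj] at h
    exact hxy (sub_left_injective h)
  have key0 : ∀ {x : ℂ}, x ≠ θ → 1 / (x - θ) ≠ 0 := fun h => one_div_ne_zero (sub_ne_zero.2 h)
  intro i j hij
  fin_cases i <;> fin_cases j <;> simp only [moebiusRoots] at hij ⊢ <;> exfalso
  · exact key0 h1 hij.symm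
  · exact key0 h2 hij.symm
  · exact key0 h3 hij.symm
  · exact key0 h1 hij
  · exact key h12 hij
  · exact key h13 hij
  · exact key0 h2 hij
  · exact key h12.symm hij
  · exact key h23 hij
  · exact key0 h3 hij
  · exact key h13.symm hij
  · exact key h23.symm hij

lemma moebiusRoots_ne {x : ℂ} (h : x ≠ θ) (h1 : x ≠ e₁) (h2 : x ≠ e₂) (h3 : x ≠ e₃) (i : Fin 4) :
    moebiusRoots e₁ e₂ e₃ θ i ≠ 1 / (x - θ) := by
  have key : ∀ {y : ℂ}, x ≠ y → 1 / (y - θ) ≠ 1 / (x - θ) := by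
    intro y hxy h
    rw [one_div, one_div, inv_inj] at h
    exact hxy (sub_left_injective h).symm
  fin_cases i
  · exact (one_div_ne_zero (sub_ne_zero.2 h)).symm
  · exact key h1
  · exact key h2
  · exact key h3

lemma prod_moebiusRoots : ∏ i, (X - C (moebiusRoots e₁ e₂ e₃ θ i)) = X * (X - C (1 / (e₁ - θ)))
    * (X - C (1 / (e₂ - θ))) * (X - C (1 / (e₃ - θ))) := by
  rw [Fin.prod_univ_four]
  simp [moebiusRoots]

/-- One polynomial `p` of degree four in `ζ = 1 / (z - θ)` replaces `4 (z - e₁) (z - e₂) (z - e₃)`. -/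
lemma eval_prod_moebiusRoots (h1 : e₁ ≠ θ) (h2 : e₂ ≠ θ) (h3 : e₃ ≠ θ) {z : ℂ} (hz : z ≠ θ) :
    4 * (θ - e₁) * (θ - e₂) * (θ - e₃)
        * (∏ i, (X - C (moebiusRoots e₁ e₂ e₃ θ i))).eval (1 / (z - θ))
      = 4 * (z - e₁) * (z - e₂) * (z - e₃) * (1 / (z - θ)) ^ 4 := by
  have h1' := sub_ne_zero.2 h1
  have h2' := sub_ne_zero.2 h2
  have h3' := sub_ne_zero.2 h3
  have hz' := sub_ne_zero.2 hz
  rw [prod_moebiusRoots]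
  simp only [eval_mul, eval_sub, eval_X, eval_C]
  field_simp
  ring

lemma eval_derivative_prod_moebiusRoots (h1 : e₁ ≠ θ) (h2 : e₂ ≠ θ) (h3 : e₃ ≠ θ) {z : ℂ}
    (hz : z ≠ θ) : 4 * (θ - e₁) * (θ - e₂) * (θ - e₃)
        * (derivative (∏ i, (X - C (moebiusRoots e₁ e₂ e₃ θ i)))).eval (1 / (z - θ))
      = -(4 * ((z - e₁) * (z - e₂) + (z - e₁) * (z - e₃) + (z - e₂) * (z - e₃)))
          * (1 / (z - θ)) ^ 2 + 4 * (4 * (z - e₁) * (z - e₂) * (z - e₃)) * (1 / (z - θ)) ^ 3 := by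
  have h1' := sub_ne_zero.2 h1
  have h2' := sub_ne_zero.2 h2
  have h3' := sub_ne_zero.2 h3
  have hz' := sub_ne_zero.2 hz
  rw [prod_moebiusRoots]
  simp only [derivative_mul, derivative_sub, derivative_X, derivative_C, eval_add, eval_mul,
    eval_sub, eval_X, eval_C, sub_zero, one_mul, mul_one]
  field_simp
  ring

lemma eval_derivative_derivative_prod_moebiusRoots (h1 : e₁ ≠ θ) (h2 : e₂ ≠ θ) (h3 : e₃ ≠ θ) {z : ℂ}
    (hz : z ≠ θ) : 4 * (θ - e₁) * (θ - e₂) * (θ - e₃)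
        * (derivative (derivative (∏ i, (X - C (moebiusRoots e₁ e₂ e₃ θ i))))).eval (1 / (z - θ))
      = 8 * (3 * z - e₁ - e₂ - e₃)
          - 6 * (4 * ((z - e₁) * (z - e₂) + (z - e₁) * (z - e₃) + (z - e₂) * (z - e₃)))
            * (1 / (z - θ))
          + 12 * (4 * (z - e₁) * (z - e₂) * (z - e₃)) * (1 / (z - θ)) ^ 2 := by
  have h1' := sub_ne_zero.2 h1
  have h2' := sub_ne_zero.2 h2
  have h3' := sub_ne_zero.2 h3
  have hz' := sub_ne_zero.2 hz
  rw [prod_moebiusRoots]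
  simp only [derivative_mul, derivative_sub, derivative_X, derivative_C, derivative_add, eval_add,
    eval_mul, eval_sub, eval_X, eval_C, eval_one, sub_zero, one_mul, mul_one]
  field_simp
  ring

lemma mul_rootResidue_moebiusRoots (h1 : e₁ ≠ θ) (h2 : e₂ ≠ θ) (h3 : e₃ ≠ θ) (l : Fin 4 → ℕ) :
    4 * (θ - e₁) * (θ - e₂) * (θ - e₃) * rootResidue (moebiusRoots e₁ e₂ e₃ θ) l 0
        = l 0 * (l 0 + 1) ∧
    4 * (θ - e₁) * (θ - e₂) * (θ - e₃) * rootResidue (moebiusRoots e₁ e₂ e₃ θ) l 1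
        = -(l 1 * (l 1 + 1) * ((e₁ - e₂) * (e₁ - e₃)) * (1 / (e₁ - θ)) ^ 2) ∧
    4 * (θ - e₁) * (θ - e₂) * (θ - e₃) * rootResidue (moebiusRoots e₁ e₂ e₃ θ) l 2
        = -(l 2 * (l 2 + 1) * ((e₂ - e₁) * (e₂ - e₃)) * (1 / (e₂ - θ)) ^ 2) ∧
    4 * (θ - e₁) * (θ - e₂) * (θ - e₃) * rootResidue (moebiusRoots e₁ e₂ e₃ θ) l 3
        = -(l 3 * (l 3 + 1) * ((e₃ - e₁) * (e₃ - e₂)) * (1 / (e₃ - θ)) ^ 2) := by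
  have h1' := sub_ne_zero.2 h1
  have h2' := sub_ne_zero.2 h2
  have h3' := sub_ne_zero.2 h3
  have hd : ∀ i, 4 * (θ - e₁) * (θ - e₂) * (θ - e₃) * rootResidue (moebiusRoots e₁ e₂ e₃ θ) l i
      = l i * (l i + 1) / 4 * (4 * (θ - e₁) * (θ - e₂) * (θ - e₃) * (derivative (∏ i,
        (X - C (moebiusRoots e₁ e₂ e₃ θ i)))).eval (moebiusRoots e₁ e₂ e₃ θ i)) := by
    intro i; rw [rootResidue]; ring
  refine ⟨?_, ?_, ?_, ?_⟩
  · rw [hd, prod_moebiusRoots, show moebiusRoots e₁ e₂ e₃ θ 0 = 0 from rfl]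
    simp only [derivative_mul, derivative_sub, derivative_X, derivative_C, eval_add, eval_mul,
      eval_sub, eval_X, eval_C, sub_zero, one_mul, mul_one, zero_mul, zero_sub, add_zero]
    field_simp
    ring
  · rw [hd, show moebiusRoots e₁ e₂ e₃ θ 1 = 1 / (e₁ - θ) from rfl,
      eval_derivative_prod_moebiusRoots h1 h2 h3 h1]
    ring
  · rw [hd, show moebiusRoots e₁ e₂ e₃ θ 2 = 1 / (e₂ - θ) from rfl,
      eval_derivative_prod_moebiusRoots h1 h2 h3 h2]
    ring
  · rw [hd, show moebiusRoots e₁ e₂ e₃ θ 3 = 1 / (e₃ - θ) from rfl,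
      eval_derivative_prod_moebiusRoots h1 h2 h3 h3]
    ring

lemma one_div_sub_eq {x z : ℂ} (hx : x ≠ θ) (hz : z ≠ θ) (hxz : z ≠ x) :
    1 / (z - x) = -(1 / (x - θ)) - (1 / (x - θ)) ^ 2 / (1 / (z - θ) - 1 / (x - θ)) := by
  have h1 := sub_ne_zero.2 hx
  have h2 := sub_ne_zero.2 hz
  have h3 := sub_ne_zero.2 hxz
  have h5 : (1 : ℂ) / (z - θ) - 1 / (x - θ) = -(z - x) / ((z - θ) * (x - θ)) := by
    field_simp; ring
  rw [h5]
  field_simp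
  ring

variable (e₁ e₂ e₃) in
/-- The part `∑ l_i (l_i + 1) ℘(x + ω_i)` of the potential, as a function of `z = ℘(x)`:
`l₀ (l₀ + 1) z + ∑ l_i (l_i + 1) (e_i + (e_i - e_j) (e_i - e_k) / (z - e_i))`. -/
noncomputable def halfPeriodPotential (l : Fin 4 → ℕ) (z : ℂ) : ℂ :=
  l 0 * (l 0 + 1) * z
    + (l 1 * (l 1 + 1) * (e₁ + (e₁ - e₂) * (e₁ - e₃) / (z - e₁))
      + l 2 * (l 2 + 1) * (e₂ + (e₂ - e₁) * (e₂ - e₃) / (z - e₂))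
      + l 3 * (l 3 + 1) * (e₃ + (e₃ - e₁) * (e₃ - e₂) / (z - e₃)))

/-- The partial fraction expansion of `halfPeriodPotential` in the coordinate `1 / (z - θ)`. -/
lemma halfPeriodPotential_eq (h1 : e₁ ≠ θ) (h2 : e₂ ≠ θ) (h3 : e₃ ≠ θ) (l : Fin 4 → ℕ) :
    ∃ k : ℂ, ∀ z, z ≠ θ → z ≠ e₁ → z ≠ e₂ → z ≠ e₃ → halfPeriodPotential e₁ e₂ e₃ l z
      = 4 * (θ - e₁) * (θ - e₂) * (θ - e₃) * ∑ i, rootResidue (moebiusRoots e₁ e₂ e₃ θ) l i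
        / (1 / (z - θ) - moebiusRoots e₁ e₂ e₃ θ i) + k := by
  obtain ⟨k0, k1, k2, k3⟩ := mul_rootResidue_moebiusRoots h1 h2 h3 l
  refine ⟨l 0 * (l 0 + 1) * θ
    + (l 1 * (l 1 + 1) * (e₁ - (e₁ - e₂) * (e₁ - e₃) * (1 / (e₁ - θ)))
      + l 2 * (l 2 + 1) * (e₂ - (e₂ - e₁) * (e₂ - e₃) * (1 / (e₂ - θ)))
      + l 3 * (l 3 + 1) * (e₃ - (e₃ - e₁) * (e₃ - e₂) * (1 / (e₃ - θ)))), ?_⟩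
  intro z hz hz1 hz2 hz3
  rw [Finset.mul_sum, Fin.sum_univ_four]
  simp only [← mul_div_assoc, k0, k1, k2, k3]
  rw [show moebiusRoots e₁ e₂ e₃ θ 0 = 0 from rfl,
    show moebiusRoots e₁ e₂ e₃ θ 1 = 1 / (e₁ - θ) from rfl,
    show moebiusRoots e₁ e₂ e₃ θ 2 = 1 / (e₂ - θ) from rfl,
    show moebiusRoots e₁ e₂ e₃ θ 3 = 1 / (e₃ - θ) from rfl, sub_zero, halfPeriodPotential,
    div_eq_mul_one_div _ (z - e₁), div_eq_mul_one_div _ (z - e₂), div_eq_mul_one_div _ (z - e₃),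
    one_div_sub_eq h1 hz hz1, one_div_sub_eq h2 hz hz2, one_div_sub_eq h3 hz hz3, div_div_eq_mul_div,
    div_one]
  ring

/-- Rational solutions in the coordinate `ζ = 1 / (z - θ)`, for a potential given as a rational
function of `z`. -/
theorem exists_cubicOp_moebius_eq_zero (h12 : e₁ ≠ e₂) (h13 : e₁ ≠ e₃) (h23 : e₂ ≠ e₃)
    (h1 : e₁ ≠ θ) (h2 : e₂ ≠ θ) (h3 : e₃ ≠ θ) (hb : b ≠ θ) (hb1 : b ≠ e₁) (hb2 : b ≠ e₂)
    (hb3 : b ≠ e₃) (l : Fin 4 → ℕ) (r : ℕ) (β K : ℂ)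
    (h : (r = 0 ∧ β = 0) ∨ (r = 1 ∧ halfPeriodPotential e₁ e₂ e₃ l b + K
      = β ^ 2 / (4 * (b - e₁) * (b - e₂) * (b - e₃))
        - β * (4 * ((b - e₁) * (b - e₂) + (b - e₁) * (b - e₃) + (b - e₂) * (b - e₃)))
          / (2 * (4 * (b - e₁) * (b - e₂) * (b - e₃))) + (3 * b - e₁ - e₂ - e₃))) :
    ∃ (w F : ℂ[X]), F ≠ 0 ∧ F.natDegree ≤ ∑ i, l i + r ∧
      cubicOp (∏ i, (X - C (moebiusRoots e₁ e₂ e₃ θ i))) (X - C (1 / (b - θ))) w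
        (gauge (moebiusRoots e₁ e₂ e₃ θ) (1 / (b - θ)) l r) F = 0 ∧
      ∀ z, z ≠ θ → z ≠ e₁ → z ≠ e₂ → z ≠ e₃ → z ≠ b →
        (halfPeriodPotential e₁ e₂ e₃ l z
          + r * (r + 2) / 4 * (4 * (b - e₁) * (b - e₂) * (b - e₃)) / (z - b) ^ 2 + β / (z - b) + K)
        * ((∏ i, (X - C (moebiusRoots e₁ e₂ e₃ θ i))).eval (1 / (z - θ))
          * (1 / (z - θ) - 1 / (b - θ)) ^ 2)
        = 4 * (θ - e₁) * (θ - e₂) * (θ - e₃) * w.eval (1 / (z - θ)) := by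
  obtain ⟨k, hk⟩ := halfPeriodPotential_eq h1 h2 h3 l
  have E0 := eval_prod_moebiusRoots h1 h2 h3 hb
  have E1 := eval_derivative_prod_moebiusRoots h1 h2 h3 hb
  have E2 := eval_derivative_derivative_prod_moebiusRoots h1 h2 h3 hb
  set a := moebiusRoots e₁ e₂ e₃ θ with ha
  set p : ℂ[X] := ∏ i, (X - C (a i)) with hp
  set κ : ℂ := 4 * (θ - e₁) * (θ - e₂) * (θ - e₃) with hκ
  set Q0 : ℂ := 4 * (b - e₁) * (b - e₂) * (b - e₃) with hQ0
  set Q1 : ℂ := 4 * ((b - e₁) * (b - e₂) + (b - e₁) * (b - e₃) + (b - e₂) * (b - e₃)) with hQ1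
  set Q2 : ℂ := 3 * b - e₁ - e₂ - e₃ with hQ2
  set c : ℂ := 1 / (b - θ) with hc
  have hκ0 : κ ≠ 0 := by
    rw [hκ]
    exact mul_ne_zero (mul_ne_zero (mul_ne_zero (by norm_num) (sub_ne_zero.2 h1.symm))
      (sub_ne_zero.2 h2.symm)) (sub_ne_zero.2 h3.symm)
  have hQ00 : Q0 ≠ 0 := by
    rw [hQ0]
    exact mul_ne_zero (mul_ne_zero (mul_ne_zero (by norm_num) (sub_ne_zero.2 hb1))
      (sub_ne_zero.2 hb2)) (sub_ne_zero.2 hb3)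
  have hc0 : c ≠ 0 := one_div_ne_zero (sub_ne_zero.2 hb)
  -- the coefficients of the partial fraction expansion at `c` in the coordinate `ζ`
  set β' : ℂ := (2 * (r * (r + 2) / 4 * Q0) * c ^ 3 - β * c ^ 2) / κ with hβ'
  set γ' : ℂ := (k + r * (r + 2) / 4 * Q0 * c ^ 2 - β * c + K) / κ with hγ'
  have hainj : Function.Injective a := moebiusRoots_injective h12 h13 h23 h1 h2 h3
  have hac : ∀ i, a i ≠ c := moebiusRoots_ne hb hb1 hb2 hb3
  have hcond : (r = 0 ∧ β' = 0) ∨ (r = 1 ∧ ∑ i, rootResidue a l i / (c - a i) + γ'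
      = β' ^ 2 / p.eval c - β' * (derivative p).eval c / (2 * p.eval c)
        + (derivative (derivative p)).eval c / 8) := by
    rcases h with ⟨hr, hβ⟩ | ⟨hr, h⟩
    · left
      refine ⟨hr, ?_⟩
      rw [hβ', hr, hβ]; simp
    · right
      refine ⟨hr, ?_⟩
      have e0 : p.eval c = Q0 * c ^ 4 / κ := by rw [eq_div_iff hκ0, mul_comm, E0]
      have e1 : (derivative p).eval c = (-Q1 * c ^ 2 + 4 * Q0 * c ^ 3) / κ := by
        rw [eq_div_iff hκ0, mul_comm, E1]
      have e2 : (derivative (derivative p)).eval c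
          = (8 * Q2 - 6 * Q1 * c + 12 * Q0 * c ^ 2) / κ := by
        rw [eq_div_iff hκ0, mul_comm, E2]
      have hS : ∑ i, rootResidue a l i / (c - a i)
          = (β ^ 2 / Q0 - β * Q1 / (2 * Q0) + Q2 - K - k) / κ := by
        rw [eq_div_iff hκ0]
        linear_combination h - hk b hb hb1 hb2 hb3
      rw [hS, e0, e1, e2, hβ', hγ', hr]
      field_simp
      push_cast
      ring
  obtain ⟨F, hF0, hFd, hF⟩ := exists_cubicOp_potentialNum_eq_zero a c l r β' γ' hainj hac hcond
  refine ⟨potentialNum a c l r β' γ', F, hF0, hFd, hF, ?_⟩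
  intro z hz hz1 hz2 hz3 hzb
  have hζa : ∀ i, 1 / (z - θ) ≠ a i := fun i => (moebiusRoots_ne hz hz1 hz2 hz3 i).symm
  have hζc : 1 / (z - θ) ≠ c := by
    intro h
    rw [hc, one_div, one_div, inv_inj] at h
    exact hzb (sub_left_injective h)
  rw [eval_potentialNum a c l r β' γ' hζa hζc, hk z hz hz1 hz2 hz3,
    div_eq_mul_one_div β (z - b), show r * (r + 2) / 4 * Q0 / (z - b) ^ 2
      = r * (r + 2) / 4 * Q0 * (1 / (z - b)) ^ 2 by
        rw [one_div, inv_pow, div_eq_mul_inv], one_div_sub_eq hb hz hzb]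
  change _ = κ * (p.eval (1 / (z - θ)) * (1 / (z - θ) - c) ^ 2 * (_ + _ * p.eval c / _ + _ + _))
  rw [show p.eval c = Q0 * c ^ 4 / κ by rw [eq_div_iff hκ0, mul_comm, E0], hβ', hγ']
  generalize p.eval (1 / (z - θ)) = P
  rw [← hc]
  have hζc' := sub_ne_zero.2 hζc
  generalize ∑ i, rootResidue a l i / (1 / (z - θ) - a i) = S
  generalize hT : 1 / (z - θ) - c = T at hζc' ⊢
  field_simp
  ring

end Moebius

/-! ### Solutions in the uniformising variable -/

section Pullback

open Polynomial

lemma hasDerivAt_eval_div {g ν D : ℂ[X]} (hD : g * derivative D = -ν * D) (k : ℕ) (A : ℂ[X]) {ζ : ℂ}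
    (hg : g.eval ζ ≠ 0) (hD0 : D.eval ζ ≠ 0) :
    HasDerivAt (fun ζ => A.eval ζ / (D.eval ζ * g.eval ζ ^ k))
      ((twistedDeriv g ν k A).eval ζ / (D.eval ζ * g.eval ζ ^ (k + 1))) ζ := by
  have h1 := (A.hasDerivAt ζ).fun_div ((D.hasDerivAt ζ).fun_mul ((g.hasDerivAt ζ).fun_pow k))
    (mul_ne_zero hD0 (pow_ne_zero k hg))
  refine h1.congr_deriv ?_
  have h2 := congrArg (eval ζ) hD
  simp only [eval_mul, eval_neg] at h2
  simp only [twistedDeriv, eval_add, eval_sub, eval_mul, eval_natCast]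
  rcases k with _ | k
  · simp only [pow_zero, mul_one, Nat.cast_zero, zero_mul, sub_zero, zero_add, pow_one]
    field_simp
    linear_combination -A.eval ζ * h2
  · simp only [Nat.add_sub_cancel, Nat.cast_add, Nat.cast_one]
    field_simp
    linear_combination -A.eval ζ * g.eval ζ ^ (2 * (k + 1)) * h2

/-- Polynomial solutions pull back along `ζ` with `ζ'² = κ p(ζ)` to solutions of the third order
equation. -/
theorem solves_of_cubicOp_eq_zero {p τ w ν D F : ℂ[X]} {κ : ℂ} {ζ η u f : ℂ → ℂ} {x : ℂ}
    (hτ : derivative τ = 1) (hD : p * τ * derivative D = -ν * D) (hF : cubicOp p τ w ν F = 0)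
    (hζ : ∀ᶠ y in 𝓝 x, HasDerivAt ζ (η y) y)
    (hη : ∀ᶠ y in 𝓝 x, HasDerivAt η (κ / 2 * (derivative p).eval (ζ y)) y)
    (hsq : ∀ᶠ y in 𝓝 x, η y ^ 2 = κ * p.eval (ζ y))
    (h0 : ∀ᶠ y in 𝓝 x, p.eval (ζ y) ≠ 0 ∧ τ.eval (ζ y) ≠ 0 ∧ D.eval (ζ y) ≠ 0)
    (hu : ∀ᶠ y in 𝓝 x, u y = κ * w.eval (ζ y) / (p.eval (ζ y) * τ.eval (ζ y) ^ 2))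
    (hf : ∀ᶠ y in 𝓝 x, f y = F.eval (ζ y) / D.eval (ζ y)) :
    iteratedDeriv 3 f x - 4 * u x * deriv f x - 2 * deriv u x * f x = 0 := by
  set g := p * τ with hg
  set F1 := twistedDeriv g ν 0 F with hF1
  set F2 := twistedDeriv g ν 1 F1 with hF2
  set F3 := twistedDeriv g ν 2 F2 with hF3
  have hgy : ∀ y, g.eval y = p.eval y * τ.eval y := fun y => by rw [hg, eval_mul]
  have hder : ∀ k A, ∀ᶠ y in 𝓝 x, HasDerivAt
      (fun y => A.eval (ζ y) / (D.eval (ζ y) * g.eval (ζ y) ^ k))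
      ((twistedDeriv g ν k A).eval (ζ y) / (D.eval (ζ y) * g.eval (ζ y) ^ (k + 1)) * η y) y := by
    intro k A
    filter_upwards [hζ, h0] with y h1 h2
    exact HasDerivAt.comp y (hasDerivAt_eval_div hD k A
      (by rw [hgy]; exact mul_ne_zero h2.1 h2.2.1) h2.2.2) h1
  have hpol : ∀ A : ℂ[X], ∀ᶠ y in 𝓝 x, HasDerivAt (fun y => A.eval (ζ y))
      ((derivative A).eval (ζ y) * η y) y := by
    intro A
    filter_upwards [hζ] with y h1
    exact HasDerivAt.comp y (A.hasDerivAt (ζ y)) h1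
  -- first derivative
  have d1 : deriv f =ᶠ[𝓝 x] fun y => F1.eval (ζ y) / (D.eval (ζ y) * g.eval (ζ y) ^ 1) * η y := by
    have hf' : f =ᶠ[𝓝 x] fun y => F.eval (ζ y) / (D.eval (ζ y) * g.eval (ζ y) ^ 0) := by
      filter_upwards [hf] with y hy
      rw [hy, pow_zero, mul_one]
    filter_upwards [hf'.deriv, hder 0 F] with y h1 h2
    rw [h1, h2.deriv]
  -- second derivative
  have d2 : deriv (deriv f) =ᶠ[𝓝 x] fun y =>
      κ * (p.eval (ζ y) * (F2.eval (ζ y) / (D.eval (ζ y) * g.eval (ζ y) ^ 2))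
        + (derivative p).eval (ζ y) / 2
          * (F1.eval (ζ y) / (D.eval (ζ y) * g.eval (ζ y) ^ 1))) := by
    filter_upwards [d1.deriv, hder 1 F1, hη, hsq] with y h1 h2 h3 h4
    rw [h1, (h2.fun_mul h3).deriv]
    linear_combination (F2.eval (ζ y) / (D.eval (ζ y) * g.eval (ζ y) ^ 2)) * h4
  -- third derivative
  have d3 : deriv (deriv (deriv f)) x = κ * (p.eval (ζ x) * (F3.eval (ζ x) / (D.eval (ζ x)
        * g.eval (ζ x) ^ 3)) + 3 / 2 * (derivative p).eval (ζ x)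
          * (F2.eval (ζ x) / (D.eval (ζ x) * g.eval (ζ x) ^ 2))
        + (derivative (derivative p)).eval (ζ x) / 2
          * (F1.eval (ζ x) / (D.eval (ζ x) * g.eval (ζ x) ^ 1))) * η x := by
    rw [d2.deriv_eq, ((((hpol p).self_of_nhds.fun_mul (hder 2 F2).self_of_nhds).fun_add
      (((hpol (derivative p)).self_of_nhds.div_const 2).fun_mul (hder 1 F1).self_of_nhds)).const_mul
        κ).deriv]
    ring
  obtain ⟨z1, z2, z3⟩ := h0.self_of_nhds
  have du : deriv u x = κ * ((derivative w).eval (ζ x) * (p.eval (ζ x) * τ.eval (ζ x))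
      - w.eval (ζ x) * ((derivative p).eval (ζ x) * τ.eval (ζ x) + 2 * p.eval (ζ x)))
      / (p.eval (ζ x) ^ 2 * τ.eval (ζ x) ^ 3) * η x := by
    have hu' : u =ᶠ[𝓝 x] fun y => κ * w.eval (ζ y) / (p.eval (ζ y) * τ.eval (ζ y) ^ 2) := hu
    rw [hu'.deriv_eq, (((hpol w).self_of_nhds.const_mul κ).fun_div ((hpol p).self_of_nhds.fun_mul
      ((hpol τ).self_of_nhds.fun_pow 2)) (mul_ne_zero z1 (pow_ne_zero 2 z2))).deriv, hτ]
    simp only [eval_one, Nat.cast_ofNat, Nat.add_one_sub_one, pow_one]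
    field_simp
  have hFx := congrArg (eval (ζ x)) hF
  simp only [cubicOp, ← hg, ← hF1, ← hF2, ← hF3, eval_add, eval_sub, eval_mul, eval_pow, eval_zero,
    eval_ofNat] at hFx
  rw [show iteratedDeriv 3 f x = deriv (deriv (deriv f)) x by
    simp only [iteratedDeriv_succ, iteratedDeriv_zero], d3, d1.self_of_nhds, du,
    hu.self_of_nhds, hf.self_of_nhds]
  simp only [hgy] at hFx ⊢
  field_simp
  linear_combination κ * η x * hFx

/-- A rational function of `1 / y` regular at infinity, as a rational function of `y`. -/
lemma eval_reflect_div {ι : Type*} [Fintype ι] (ρ : ι → ℂ) (m : ι → ℕ) {F : ℂ[X]}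
    (hF : F.natDegree ≤ ∑ v, m v) {y : ℂ} (hy : y ≠ 0) :
    F.eval (1 / y) / (∏ v, (X - C (ρ v)) ^ m v).eval (1 / y)
      = (F.reflect (∑ v, m v)).eval y / ∏ v, (1 - ρ v * y) ^ m v := by
  have h1 : F.eval (1 / y) * y ^ (∑ v, m v) = (F.reflect (∑ v, m v)).eval y := by
    let _ : Invertible (1 / y) := invertibleOfNonzero (one_div_ne_zero hy)
    have h := eval₂_reflect_mul_pow (RingHom.id ℂ) (1 / y) (∑ v, m v) F hF
    simp only [eval₂_id, invOf_eq_inv, one_div, inv_inv] at h ⊢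
    rw [← h, mul_assoc, ← mul_pow, inv_mul_cancel₀ hy, one_pow, mul_one]
  have h2 : (∏ v, (X - C (ρ v)) ^ m v).eval (1 / y) * y ^ (∑ v, m v)
      = ∏ v, (1 - ρ v * y) ^ m v := by
    rw [eval_prod, ← Finset.prod_pow_eq_pow_sum, ← Finset.prod_mul_distrib]
    refine Finset.prod_congr rfl fun v _ => ?_
    rw [eval_pow, eval_sub, eval_X, eval_C, ← mul_pow, sub_mul, one_div_mul_cancel hy]
  rw [← h1, ← h2, mul_div_mul_right _ _ (pow_ne_zero _ hy)]

end Pullback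

section RationalSolution

open Polynomial

variable (L : PeriodPair)

/-- The potential `v - E` as a function of `z = ℘(x)`, with a single pole `b` apart from the `e_i`, a
free residue `β` there, and an additive constant `K`. -/
noncomputable def potentialOfP (l : Fin 4 → ℕ) (r : ℕ) (b β K z : ℂ) : ℂ :=
  halfPeriodPotential (eVal L 1) (eVal L 2) (eVal L 3) l z
    + r * (r + 2) / 4 * (4 * (b - eVal L 1) * (b - eVal L 2) * (b - eVal L 3)) / (z - b) ^ 2
    + β / (z - b) + K

lemma hasDerivAt_moebius_weierstrassP {θ x : ℂ} (hx : x ∉ L.lattice)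
    (hθ : L.weierstrassP x ≠ θ) :
    HasDerivAt (fun y => 1 / (L.weierstrassP y - θ))
      (-(L.derivWeierstrassP x * (1 / (L.weierstrassP x - θ)) ^ 2)) x := by
  have h0 := sub_ne_zero.2 hθ
  refine ((hasDerivAt_const x (1 : ℂ)).fun_div
    ((hasDerivAt_weierstrassP L hx).sub_const θ) h0).congr_deriv ?_
  field_simp
  ring

lemma hasDerivAt_moebius_derivWeierstrassP {θ x : ℂ} (hx : 2 * x ∉ L.lattice)
    (hθ : L.weierstrassP x ≠ θ) :
    HasDerivAt (fun y => -(L.derivWeierstrassP y * (1 / (L.weierstrassP y - θ)) ^ 2))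
      (-(6 * L.weierstrassP x ^ 2 - g2 L / 2) * (1 / (L.weierstrassP x - θ)) ^ 2
        + 2 * L.derivWeierstrassP x ^ 2 * (1 / (L.weierstrassP x - θ)) ^ 3) x := by
  refine ((hasDerivAt_derivWeierstrassP L hx).fun_mul ((hasDerivAt_moebius_weierstrassP L
    (notMem_of_two_mul_notMem L hx) hθ).fun_pow 2)).fun_neg.congr_deriv ?_
  simp only [Nat.cast_ofNat, Nat.add_one_sub_one, pow_one]
  ring

lemma eventually_two_mul_notMem {x : ℂ} (hx : 2 * x ∉ L.lattice) :
    ∀ᶠ y in 𝓝 x, 2 * y ∉ L.lattice :=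
  (Continuous.continuousAt (by fun_prop : Continuous fun y : ℂ => 2 * y)).eventually
    (eventually_notMem_lattice_of_notMem L hx)

/-- A solution which is a rational function of `℘`. The equation is obtained where `℘` differs from
the auxiliary value `θ`, which is mapped to infinity by `ζ = 1 / (℘ - θ)`. -/
theorem exists_rational_solution (l : Fin 4 → ℕ) (r : ℕ) (b β K θ : ℂ)
    (hθ : ∀ i : Fin 4, i ≠ 0 → eVal L i ≠ θ) (hbθ : b ≠ θ) (hb : ∀ i : Fin 4, i ≠ 0 → b ≠ eVal L i)
    (h : (r = 0 ∧ β = 0) ∨ (r = 1 ∧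
      halfPeriodPotential (eVal L 1) (eVal L 2) (eVal L 3) l b + K
        = β ^ 2 / (4 * (b - eVal L 1) * (b - eVal L 2) * (b - eVal L 3))
          - β * (4 * ((b - eVal L 1) * (b - eVal L 2) + (b - eVal L 1) * (b - eVal L 3)
            + (b - eVal L 2) * (b - eVal L 3)))
            / (2 * (4 * (b - eVal L 1) * (b - eVal L 2) * (b - eVal L 3)))
          + (3 * b - eVal L 1 - eVal L 2 - eVal L 3))) :
    ∃ N D : ℂ[X], N ≠ 0 ∧
      (∀ z, (∀ i : Fin 4, i ≠ 0 → z ≠ eVal L i) → (r = 0 ∨ z ≠ b) → D.eval z ≠ 0) ∧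
      ∀ (x : ℂ) (u : ℂ → ℂ), 2 * x ∉ L.lattice → L.weierstrassP x ≠ θ → L.weierstrassP x ≠ b →
        (∀ᶠ y in 𝓝 x, u y = potentialOfP L l r b β K (L.weierstrassP y)) →
        iteratedDeriv 3 (fun y => N.eval (L.weierstrassP y) / D.eval (L.weierstrassP y)) x
          - 4 * u x * deriv (fun y => N.eval (L.weierstrassP y) / D.eval (L.weierstrassP y)) x
          - 2 * deriv u x * (N.eval (L.weierstrassP x) / D.eval (L.weierstrassP x)) = 0 := by
  have d1 : (1 : Fin 4) ≠ 0 := by decide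
  have d2 : (2 : Fin 4) ≠ 0 := by decide
  have d3 : (3 : Fin 4) ≠ 0 := by decide
  have esum := (eVal_relations L).1
  have eg2 : g2 L = -4 * (eVal L 1 * eVal L 2 + eVal L 2 * eVal L 3 + eVal L 3 * eVal L 1) := rfl
  obtain ⟨w, F, hF0, hFd, hF, hw⟩ := exists_cubicOp_moebius_eq_zero
    (eVal_injective L d1 d2 (by decide)) (eVal_injective L d1 d3 (by decide))
    (eVal_injective L d2 d3 (by decide)) (hθ 1 d1) (hθ 2 d2) (hθ 3 d3) hbθ (hb 1 d1) (hb 2 d2)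
    (hb 3 d3) l r β K h
  set a := moebiusRoots (eVal L 1) (eVal L 2) (eVal L 3) θ with ha
  set c := 1 / (b - θ) with hc
  set p : ℂ[X] := ∏ i, (X - C (a i)) with hp
  set κ := 4 * (θ - eVal L 1) * (θ - eVal L 2) * (θ - eVal L 3) with hκ
  have hκ0 : κ ≠ 0 := by
    rw [hκ]
    exact mul_ne_zero (mul_ne_zero (mul_ne_zero (by norm_num) (sub_ne_zero.2 (hθ 1 d1).symm))
      (sub_ne_zero.2 (hθ 2 d2).symm)) (sub_ne_zero.2 (hθ 3 d3).symm)
  have hsum : ∑ v, mult l r v = ∑ i, l i + r := by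
    rw [Fintype.sum_option, add_comm]; rfl
  set D₁ : ℂ[X] := ∏ v, (X - C (roots a c v)) ^ mult l r v with hD₁
  have hD : p * (X - C c) * derivative D₁ = -gauge a c l r * D₁ := by
    rw [← prod_roots, gauge, neg_neg]
    exact prod_mul_derivative_prod_pow _ _
  -- the denominator in terms of `℘`; its factor for `a 0 = 0`, the image of `z = ∞`, is constant
  set D : ℂ[X] := ∏ v, (1 - C (roots a c v) * (X - C θ)) ^ mult l r v with hDdef
  have hDeval : ∀ z, D.eval z = ∏ v, (1 - roots a c v * (z - θ)) ^ mult l r v := by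
    intro z
    simp only [hDdef, eval_prod, eval_pow, eval_sub, eval_one, eval_mul, eval_C, eval_X]
  refine ⟨(F.reflect (∑ v, mult l r v)).comp (X - C θ), D, ?_, ?_, ?_⟩
  · intro h0
    have h1 : taylor (-θ) (F.reflect (∑ v, mult l r v)) = 0 := by
      rw [taylor_apply, map_neg, ← sub_eq_add_neg]; exact h0
    rw [map_eq_zero_iff _ (taylor_injective _), reflect_eq_zero_iff] at h1
    exact hF0 h1
  · intro z hz hzb
    have key : ∀ {e : ℂ}, e ≠ θ → z ≠ e → 1 - 1 / (e - θ) * (z - θ) ≠ 0 := by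
      intro e he hze h0
      have := sub_ne_zero.2 he
      field_simp at h0
      exact hze (by linear_combination -h0)
    rw [hDeval]
    refine Finset.prod_ne_zero_iff.2 fun v _ => ?_
    rcases v with _ | i
    · rcases hzb with rfl | hzb
      · simp [mult]
      · exact pow_ne_zero _ (key hbθ hzb)
    · refine pow_ne_zero _ ?_
      fin_cases i
      · simp [roots, ha, moebiusRoots]
      · exact key (hθ 1 d1) (hz 1 d1)
      · exact key (hθ 2 d2) (hz 2 d2)
      · exact key (hθ 3 d3) (hz 3 d3)
  · intro x u hx hxθ hxb hu
    have hxl := notMem_of_two_mul_notMem L hx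
    have hcont : ContinuousAt L.weierstrassP x := (hasDerivAt_weierstrassP L hxl).continuousAt
    set ζ : ℂ → ℂ := fun y => 1 / (L.weierstrassP y - θ) with hζ
    set η : ℂ → ℂ := fun y => -(L.derivWeierstrassP y * (1 / (L.weierstrassP y - θ)) ^ 2) with hη
    have hgood : ∀ᶠ y in 𝓝 x, 2 * y ∉ L.lattice ∧ L.weierstrassP y ≠ θ ∧ L.weierstrassP y ≠ b :=
      (eventually_two_mul_notMem L hx).and
        ((hcont.eventually_ne hxθ).and (hcont.eventually_ne hxb))
    have hroots : ∀ᶠ y in 𝓝 x, ∀ v, ζ y ≠ roots a c v := by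
      filter_upwards [hgood] with y hy v
      have hne := fun i (hi : i ≠ 0) => weierstrassP_ne_eVal_of_two_mul_notMem L hy.1 (i := i) hi
      rcases v with _ | i
      · intro h0
        simp only [hζ, roots, Option.elim_none, hc, one_div, inv_inj] at h0
        exact hy.2.2 (sub_left_injective h0)
      · exact (moebiusRoots_ne hy.2.1 (hne 1 d1) (hne 2 d2) (hne 3 d3) i).symm
    have hmain := solves_of_cubicOp_eq_zero (κ := κ) (ζ := ζ) (η := η) (u := u) (x := x)
      (f := fun y => F.eval (ζ y) / D₁.eval (ζ y)) (τ := X - C c)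
      (by rw [derivative_sub, derivative_X, derivative_C, sub_zero]) hD hF
      (by filter_upwards [hgood] with y hy using
            hasDerivAt_moebius_weierstrassP L (notMem_of_two_mul_notMem L hy.1) hy.2.1)
      (by
        filter_upwards [hgood] with y hy
        refine (hasDerivAt_moebius_derivWeierstrassP L hy.1 hy.2.1).congr_deriv ?_
        have e1 := eval_derivative_prod_moebiusRoots (hθ 1 d1) (hθ 2 d2) (hθ 3 d3) hy.2.1
        rw [derivWeierstrassP_sq_eq_prod L (notMem_of_two_mul_notMem L hy.1), eg2]
        change κ * (derivative p).eval (ζ y) = _ at e1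
        simp only [hζ] at e1 ⊢
        linear_combination -e1 / 2 - 4 * L.weierstrassP y * (1 / (L.weierstrassP y - θ)) ^ 2 * esum)
      (by
        filter_upwards [hgood] with y hy
        have e1 := eval_prod_moebiusRoots (hθ 1 d1) (hθ 2 d2) (hθ 3 d3) hy.2.1
        change κ * p.eval (ζ y) = _ at e1
        rw [e1]
        simp only [hη]
        rw [neg_sq, mul_pow, derivWeierstrassP_sq_eq_prod L (notMem_of_two_mul_notMem L hy.1)]
        ring)
      (by
        filter_upwards [hroots] with y hy
        refine ⟨?_, ?_, ?_⟩
        · rw [hp, eval_prod]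
          refine Finset.prod_ne_zero_iff.2 fun i _ => ?_
          rw [eval_sub, eval_X, eval_C]
          exact sub_ne_zero.2 (hy (some i))
        · rw [eval_sub, eval_X, eval_C]
          exact sub_ne_zero.2 (hy none)
        · rw [hD₁, eval_prod]
          refine Finset.prod_ne_zero_iff.2 fun v _ => ?_
          rw [eval_pow, eval_sub, eval_X, eval_C]
          exact pow_ne_zero _ (sub_ne_zero.2 (hy v)))
      (by
        filter_upwards [hu, hgood, hroots] with y hy1 hy hy3
        have hne := fun i (hi : i ≠ 0) => weierstrassP_ne_eVal_of_two_mul_notMem L hy.1 (i := i) hi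
        have e1 := hw _ hy.2.1 (hne 1 d1) (hne 2 d2) (hne 3 d3) hy.2.2
        rw [hy1, eq_div_iff, ← e1, potentialOfP, eval_sub, eval_X, eval_C]
        refine mul_ne_zero ?_ (pow_ne_zero 2 ?_)
        · rw [hp, eval_prod]
          refine Finset.prod_ne_zero_iff.2 fun i _ => ?_
          rw [eval_sub, eval_X, eval_C]
          exact sub_ne_zero.2 (hy3 (some i))
        · rw [eval_sub, eval_X, eval_C]
          exact sub_ne_zero.2 (hy3 none))
      (Eventually.of_forall fun y => rfl)
    have hf : (fun y => ((F.reflect (∑ v, mult l r v)).comp (X - C θ)).eval (L.weierstrassP y)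
        / D.eval (L.weierstrassP y)) =ᶠ[𝓝 x] fun y => F.eval (ζ y) / D₁.eval (ζ y) := by
      filter_upwards [hgood] with y hy
      rw [eval_comp, eval_sub, eval_X, eval_C, hDeval]
      exact (eval_reflect_div (roots a c) (mult l r) (by rwa [hsum]) (sub_ne_zero.2 hy.2.1)).symm
    rw [hf.iteratedDeriv_eq 3, hf.deriv_eq]
    have hfx := hf.self_of_nhds
    simp only at hfx
    rw [hfx]
    exact hmain

end RationalSolution

/-! ### The singular set -/

section SingularSet

variable (L : PeriodPair) {M : ℕ} (δ : Fin M → ℂ)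

lemma mem_lattice_of_halfPeriod {x : ℂ} (hx : 2 * x ∈ L.lattice) :
    ∃ i, x - halfPeriod L i ∈ L.lattice := by
  obtain ⟨m, n, h⟩ := L.mem_lattice.1 hx
  obtain ⟨m', hm⟩ := Int.even_or_odd' m
  obtain ⟨n', hn⟩ := Int.even_or_odd' n
  simp only [L.mem_lattice]
  rcases hm with rfl | rfl <;> rcases hn with rfl | rfl <;> push_cast at h
  · exact ⟨0, m', n', by simp only [halfPeriod_zero]; linear_combination h / 2⟩
  · exact ⟨3, m', n', by simp [halfPeriod]; linear_combination h / 2⟩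
  · exact ⟨1, m', n', by simp [halfPeriod]; linear_combination h / 2⟩
  · exact ⟨2, m' + 1, n' + 1, by simp [halfPeriod]; linear_combination h / 2⟩

lemma tendsto_sub_const_nhdsNE (x c : ℂ) : Tendsto (fun y => y - c) (𝓝[≠] x) (𝓝[≠] (x - c)) := by
  refine tendsto_nhdsWithin_iff.2 ⟨?_, ?_⟩
  · exact ((continuous_id.sub continuous_const).tendsto x).mono_left nhdsWithin_le_nhds
  · filter_upwards [self_mem_nhdsWithin] with y hy
    simpa using hy

lemma tendsto_add_const_nhdsNE (x c : ℂ) : Tendsto (fun y => y + c) (𝓝[≠] x) (𝓝[≠] (x + c)) := by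
  simpa using tendsto_sub_const_nhdsNE x (-c)

lemma eventually_notMem_singularSet_nhdsNE (x : ℂ) : ∀ᶠ y in 𝓝[≠] x, y ∉ singularSet L δ := by
  have h1 : ∀ᶠ y in 𝓝[≠] x, ∀ i, y - halfPeriod L i ∉ L.lattice := eventually_all.2 fun i =>
    (tendsto_sub_const_nhdsNE x _).eventually (eventually_notMem_lattice L _)
  have h2 : ∀ᶠ y in 𝓝[≠] x, ∀ k, y - δ k ∉ L.lattice := eventually_all.2 fun k =>
    (tendsto_sub_const_nhdsNE x _).eventually (eventually_notMem_lattice L _)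
  have h3 : ∀ᶠ y in 𝓝[≠] x, ∀ k, y + δ k ∉ L.lattice := eventually_all.2 fun k =>
    (tendsto_add_const_nhdsNE x _).eventually (eventually_notMem_lattice L _)
  filter_upwards [h1, h2, h3] with y g1 g2 g3
  rintro (⟨i, hi⟩ | ⟨k, hk | hk⟩)
  exacts [g1 i hi, g2 k hk, g3 k hk]

variable {L δ}

lemma eventually_notMem_singularSet {x : ℂ} (hx : x ∉ singularSet L δ) :
    ∀ᶠ y in 𝓝 x, y ∉ singularSet L δ := by
  filter_upwards [eventually_nhdsWithin_iff.1 (eventually_notMem_singularSet_nhdsNE L δ x)] with y hy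
  by_cases h : y = x
  · rwa [h]
  · exact hy h

lemma sub_halfPeriod_notMem {x : ℂ} (hx : x ∉ singularSet L δ) (i : Fin 4) :
    x - halfPeriod L i ∉ L.lattice := fun h => hx (Or.inl ⟨i, h⟩)

lemma notMem_lattice_of_notMem_singularSet {x : ℂ} (hx : x ∉ singularSet L δ) : x ∉ L.lattice := by
  simpa [halfPeriod_zero] using sub_halfPeriod_notMem hx 0

lemma two_mul_notMem_of_notMem_singularSet {x : ℂ} (hx : x ∉ singularSet L δ) :
    2 * x ∉ L.lattice := fun h => by
  obtain ⟨i, hi⟩ := mem_lattice_of_halfPeriod L h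
  exact sub_halfPeriod_notMem hx i hi

lemma neg_mem_singularSet_iff (x : ℂ) : -x ∈ singularSet L δ ↔ x ∈ singularSet L δ := by
  have key : ∀ x, x ∈ singularSet L δ → -x ∈ singularSet L δ := by
    rintro x (⟨i, hi⟩ | ⟨k, hk | hk⟩)
    · refine Or.inl ⟨i, ?_⟩
      rw [sub_halfPeriod_mem_iff, ← neg_mem_iff]
      rwa [show -(-x + halfPeriod L i) = x - halfPeriod L i by ring]
    · refine Or.inr ⟨k, Or.inr ?_⟩
      rw [← neg_mem_iff]
      rwa [show -(-x + δ k) = x - δ k by ring]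
    · refine Or.inr ⟨k, Or.inl ?_⟩
      rw [← neg_mem_iff]
      rwa [show -(-x - δ k) = x + δ k by ring]
  exact ⟨fun h => by simpa using key _ h, key x⟩

lemma add_mem_singularSet_iff (x : ℂ) {ω : ℂ} (hω : ω ∈ L.lattice) :
    x + ω ∈ singularSet L δ ↔ x ∈ singularSet L δ := by
  have e : ∀ c, x + ω - c ∈ L.lattice ↔ x - c ∈ L.lattice := by
    intro c
    rw [show x + ω - c = (x - c) + ω by ring]
    exact Submodule.add_mem_iff_left _ hω
  have e' : ∀ c, x + ω + c ∈ L.lattice ↔ x + c ∈ L.lattice := by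
    intro c
    rw [show x + ω + c = (x + c) + ω by ring]
    exact Submodule.add_mem_iff_left _ hω
  simp only [singularSet, Set.mem_ofPred_eq, e, e']

lemma analyticAt_weierstrassP_add {x c : ℂ} (h : x + c ∉ L.lattice) :
    AnalyticAt ℂ (fun y => L.weierstrassP (y + c)) x :=
  AnalyticAt.fun_comp (g := L.weierstrassP) (f := fun y => y + c)
    (L.analyticOnNhd_weierstrassP (x + c) h) (by fun_prop)

lemma weierstrassP_ne_of_notMem_singularSet (hδ : ∀ k, 2 * δ k ∉ L.lattice) {x : ℂ}
    (hx : x ∉ singularSet L δ) (k : Fin M) : L.weierstrassP x ≠ L.weierstrassP (δ k) :=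
  weierstrassP_ne_weierstrassP L (hδ k) (notMem_lattice_of_notMem_singularSet hx)
    (fun h => hx (Or.inr ⟨k, Or.inl h⟩)) (fun h => hx (Or.inr ⟨k, Or.inr h⟩))

lemma analyticAt_potential (hδ : ∀ k, 2 * δ k ∉ L.lattice) (l : Fin 4 → ℕ) (r : Fin M → ℕ)
    (s : Fin M → ℂ) {x : ℂ} (hx : x ∉ singularSet L δ) : AnalyticAt ℂ (potential L l r δ s) x := by
  have hxl := notMem_lattice_of_notMem_singularSet hx
  have h1 : ∀ i, AnalyticAt ℂ (fun y => L.weierstrassP (y + halfPeriod L i)) x := fun i =>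
    analyticAt_weierstrassP_add
      (fun h => sub_halfPeriod_notMem hx i ((sub_halfPeriod_mem_iff L x i).2 h))
  have h2 : ∀ k, AnalyticAt ℂ (fun y => L.weierstrassP (y - δ k)) x := by
    intro k
    have := analyticAt_weierstrassP_add (L := L) (x := x) (c := -δ k)
      (fun h => hx (Or.inr ⟨k, Or.inl (by simpa [sub_eq_add_neg] using h)⟩))
    simpa [sub_eq_add_neg] using this
  have h3 : ∀ k, AnalyticAt ℂ (fun y => L.weierstrassP (y + δ k)) x := fun k =>
    analyticAt_weierstrassP_add (fun h => hx (Or.inr ⟨k, Or.inr h⟩))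
  have h4 : ∀ k, AnalyticAt ℂ (fun y => s k / (L.weierstrassP y - L.weierstrassP (δ k))) x :=
    fun k => analyticAt_const.fun_div
      ((L.analyticOnNhd_weierstrassP x hxl).fun_sub analyticAt_const)
      (sub_ne_zero.2 (weierstrassP_ne_of_notMem_singularSet hδ hx k))
  unfold potential
  refine AnalyticAt.fun_add ?_ ?_
  · exact Finset.analyticAt_fun_sum _ fun i _ => analyticAt_const.fun_mul (h1 i)
  · exact Finset.analyticAt_fun_sum _ fun k _ =>
      (analyticAt_const.fun_mul ((h2 k).fun_add (h3 k))).fun_add (h4 k)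

/-- A rational function of `℘` with poles in the singular set which satisfies the equation off a
discrete set defines an element of the space of even doubly periodic solutions. -/
theorem indicator_mem_evenPeriodicSolutions (hδ : ∀ k, 2 * δ k ∉ L.lattice) (l : Fin 4 → ℕ)
    (r : Fin M → ℕ) (s : Fin M → ℂ) (E : ℂ) (N D : Polynomial ℂ)
    (hD : ∀ x ∉ singularSet L δ, D.eval (L.weierstrassP x) ≠ 0)
    (hode : ∀ x, ∀ᶠ y in 𝓝[≠] x,
      iteratedDeriv 3 (fun y => N.eval (L.weierstrassP y) / D.eval (L.weierstrassP y)) y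
        - 4 * (potential L l r δ s y - E)
          * deriv (fun y => N.eval (L.weierstrassP y) / D.eval (L.weierstrassP y)) y
        - 2 * deriv (potential L l r δ s) y
          * (N.eval (L.weierstrassP y) / D.eval (L.weierstrassP y)) = 0) :
    (singularSet L δ)ᶜ.indicator
      (fun y => N.eval (L.weierstrassP y) / D.eval (L.weierstrassP y))
        ∈ evenPeriodicSolutions L l r δ s E := by
  set f : ℂ → ℂ := fun y => N.eval (L.weierstrassP y) / D.eval (L.weierstrassP y) with hf
  have hfan : ∀ x ∉ singularSet L δ, AnalyticAt ℂ f x := by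
    intro x hx
    have hP := L.analyticOnNhd_weierstrassP x (notMem_lattice_of_notMem_singularSet hx)
    have hpol : ∀ A : Polynomial ℂ, AnalyticAt ℂ (fun y => A.eval (L.weierstrassP y)) x :=
      fun A => by simpa using hP.aeval_polynomial A
    exact (hpol N).fun_div (hpol D) (hD x hx)
  have hfm : Meromorphic f := by
    intro x
    have hP := L.meromorphic_weierstrassP x
    have hpol : ∀ A : Polynomial ℂ, MeromorphicAt (fun y => A.eval (L.weierstrassP y)) x := by
      intro A
      simp only [Polynomial.eval_eq_sum_range]
      exact MeromorphicAt.fun_sum fun i _ => (MeromorphicAt.const _ _).fun_mul (hP.fun_pow _)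
    exact (hpol N).fun_div (hpol D)
  have hind : ∀ x ∉ singularSet L δ, (singularSet L δ)ᶜ.indicator f x = f x := fun x hx =>
    Set.indicator_of_mem hx f
  have hind0 : ∀ x ∈ singularSet L δ, (singularSet L δ)ᶜ.indicator f x = 0 := fun x hx =>
    Set.indicator_of_notMem (by simpa using hx) f
  have hloc : ∀ x ∉ singularSet L δ, (singularSet L δ)ᶜ.indicator f =ᶠ[𝓝 x] f := by
    intro x hx
    filter_upwards [eventually_notMem_singularSet hx] with y hy using hind y hy
  have hper : ∀ x, ∀ ω ∈ L.lattice,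
      (singularSet L δ)ᶜ.indicator f (x + ω) = (singularSet L δ)ᶜ.indicator f x := by
    intro x ω hω
    by_cases hx : x ∈ singularSet L δ
    · rw [hind0 x hx, hind0 _ ((add_mem_singularSet_iff x hω).2 hx)]
    · rw [hind x hx, hind _ fun h => hx ((add_mem_singularSet_iff x hω).1 h)]
      simp only [hf, weierstrassP_add_lattice L x hω]
  refine ⟨?_, ?_, hind0, ?_, fun x => hper x _ L.ω₁_mem_lattice, fun x => hper x _ L.ω₂_mem_lattice,
    ?_⟩
  · intro x
    refine (hfm x).congr ?_
    filter_upwards [eventually_notMem_singularSet_nhdsNE L δ x] with y hy using (hind y hy).symm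
  · intro x hx
    exact (hfan x hx).congr (hloc x hx).symm
  · intro x
    by_cases hx : x ∈ singularSet L δ
    · rw [hind0 x hx, hind0 _ ((neg_mem_singularSet_iff x).2 hx)]
    · rw [hind x hx, hind _ fun h => hx ((neg_mem_singularSet_iff x).1 h)]
      simp only [hf, L.weierstrassP_neg]
  · intro x hx
    rw [(hloc x hx).iteratedDeriv_eq 3, (hloc x hx).deriv_eq, hind x hx]
    have hfx := hfan x hx
    have hvx := analyticAt_potential hδ l r s hx
    have h3 : AnalyticAt ℂ (iteratedDeriv 3 f) x := by
      rw [iteratedDeriv_eq_iterate]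
      exact hfx.deriv.deriv.deriv
    have hG : AnalyticAt ℂ (fun y => iteratedDeriv 3 f y
        - 4 * (potential L l r δ s y - E) * deriv f y - 2 * deriv (potential L l r δ s) y * f y) x :=
      (h3.fun_sub ((analyticAt_const.fun_mul (hvx.fun_sub analyticAt_const)).fun_mul
        hfx.deriv)).fun_sub ((analyticAt_const.fun_mul hvx.deriv).fun_mul hfx)
    exact (hG.frequently_zero_iff_eventually_zero.1 (hode x).frequently).self_of_nhds

lemma indicator_eval_div_ne_zero {N D : Polynomial ℂ} (hN : N ≠ 0)
    (hD : ∀ x ∉ singularSet L δ, D.eval (L.weierstrassP x) ≠ 0) :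
    (singularSet L δ)ᶜ.indicator
      (fun y => N.eval (L.weierstrassP y) / D.eval (L.weierstrassP y)) ≠ 0 := by
  intro h0
  have h1 : ∀ᶠ y in 𝓝[≠] (0 : ℂ), ∀ c ∈ N.roots.toFinset, L.weierstrassP y ≠ c :=
    (Filter.eventually_all_finset _).2 fun c _ => eventually_weierstrassP_ne L c 0
  obtain ⟨y, hy1, hy2⟩ := (h1.and (eventually_notMem_singularSet_nhdsNE L δ 0)).exists
  have h2 := congrFun h0 y
  rw [Set.indicator_of_mem hy2, Pi.zero_apply, div_eq_zero_iff] at h2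
  rcases h2 with h2 | h2
  · exact hy1 (L.weierstrassP y) (by simpa [hN] using h2) rfl
  · exact hD y hy2 h2

end SingularSet

/-! ### The potential at an apparent singularity of weight one -/

section ApparentSingularity

variable (L : PeriodPair)

lemma sum_weierstrassP_add_halfPeriod (l : Fin 4 → ℕ) {x : ℂ} (hx : 2 * x ∉ L.lattice) :
    ∑ i, (l i : ℂ) * (l i + 1) * L.weierstrassP (x + halfPeriod L i)
      = halfPeriodPotential (eVal L 1) (eVal L 2) (eVal L 3) l (L.weierstrassP x) := by
  have hxl := notMem_of_two_mul_notMem L hx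
  have hx' : ∀ i, x + halfPeriod L i ∉ L.lattice := fun i h =>
    hx (two_mul_mem_of_sub_halfPeriod_mem L ((sub_halfPeriod_mem_iff L x i).2 h))
  have key : ∀ {i j k : Fin 4}, i ≠ 0 → j ≠ 0 → k ≠ 0 → i ≠ j → i ≠ k → j ≠ k →
      L.weierstrassP (x + halfPeriod L i)
        = eVal L i + (eVal L i - eVal L j) * (eVal L i - eVal L k)
          / (L.weierstrassP x - eVal L i) := by
    intro i j k hi hj hk hij hik hjk
    have h := weierstrassP_add_halfPeriod_mul L hi hj hk hij hik hjk hxl (hx' i)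
    have h0 := sub_ne_zero.2 (weierstrassP_ne_eVal_of_two_mul_notMem L hx hi)
    field_simp
    linear_combination h
  rw [Fin.sum_univ_four, halfPeriod_zero, add_zero,
    key (i := 1) (j := 2) (k := 3) (by decide) (by decide) (by decide) (by decide) (by decide)
      (by decide),
    key (i := 2) (j := 1) (k := 3) (by decide) (by decide) (by decide) (by decide) (by decide)
      (by decide),
    key (i := 3) (j := 1) (k := 2) (by decide) (by decide) (by decide) (by decide) (by decide)
      (by decide), halfPeriodPotential]
  ring

/-- Without further singular points, the auxiliary parameter `b` is arbitrary. -/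
lemma potential_sub_eq_of_isEmpty (l : Fin 4 → ℕ) (r : Fin 0 → ℕ) (δ s : Fin 0 → ℂ) (E b : ℂ)
    {x : ℂ} (hx : 2 * x ∉ L.lattice) :
    potential L l r δ s x - E = potentialOfP L l 0 b 0 (-E) (L.weierstrassP x) := by
  rw [potential, sum_weierstrassP_add_halfPeriod L l hx, potentialOfP]
  simp
  ring

/-- For a single singular point of weight one, the terms with `℘(x ± δ)` contribute
`3/8 Q'(b) / (z - b)` to the simple pole, where `Q = 4 ∏ (z - e_i)`. -/
lemma potential_sub_eq_of_unique (l : Fin 4 → ℕ) (r : Fin 1 → ℕ) (δ s : Fin 1 → ℂ) (E : ℂ)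
    (hr : ∀ k, r k = 1) (hδ : ∀ k, 2 * δ k ∉ L.lattice) {x : ℂ} (hx : x ∉ singularSet L δ) :
    potential L l r δ s x - E = potentialOfP L l 1 (bVal L δ 0)
      (3 / 8 * (4 * ((bVal L δ 0 - eVal L 1) * (bVal L δ 0 - eVal L 2)
          + (bVal L δ 0 - eVal L 1) * (bVal L δ 0 - eVal L 3)
          + (bVal L δ 0 - eVal L 2) * (bVal L δ 0 - eVal L 3))) + s 0)
      (3 / 2 * bVal L δ 0 - E) (L.weierstrassP x) := by
  have hxl := notMem_lattice_of_notMem_singularSet hx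
  have h := weierstrassP_add_add_sub_mul L (hδ 0) hxl (fun h => hx (Or.inr ⟨0, Or.inl h⟩))
    (fun h => hx (Or.inr ⟨0, Or.inr h⟩))
  have h0 : L.weierstrassP x - bVal L δ 0 ≠ 0 :=
    sub_ne_zero.2 (weierstrassP_ne_of_notMem_singularSet hδ hx 0)
  rw [derivWeierstrassP_sq_eq_prod L (notMem_of_two_mul_notMem L (hδ 0))] at h
  have esum := (eVal_relations L).1
  have eg2 : g2 L = -4 * (eVal L 1 * eVal L 2 + eVal L 2 * eVal L 3 + eVal L 3 * eVal L 1) := rfl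
  rw [potential, sum_weierstrassP_add_halfPeriod L l (two_mul_notMem_of_notMem_singularSet hx),
    potentialOfP, Fin.sum_univ_one, hr]
  rw [show L.weierstrassP (δ 0) = bVal L δ 0 from rfl] at h ⊢
  generalize bVal L δ 0 = b at h h0 ⊢
  have hT : L.weierstrassP (x - δ 0) + L.weierstrassP (x + δ 0) = 2 * b
      + (4 * ((b - eVal L 1) * (b - eVal L 2) * (b - eVal L 3))
        + (6 * b ^ 2 - g2 L / 2) * (L.weierstrassP x - b)) / (L.weierstrassP x - b) ^ 2 := by
    rw [← sub_eq_iff_eq_add', eq_div_iff (pow_ne_zero 2 h0)]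
    linear_combination h
  rw [hT, eg2, show eVal L 3 = -eVal L 1 - eVal L 2 by linear_combination esum]
  field_simp
  push_cast
  ring

/-- The condition for the absence of logarithms in the Fuchsian equation, rewritten in terms of the
potential. Here `Q₀` and `Q₁` are the values at `b` of `4 ∏ (z - e_i)` and of its derivative. -/
lemma halfPeriodPotential_eq_of_coeff_condition {e₁ e₂ e₃ b : ℂ} (hsum : e₁ + e₂ + e₃ = 0)
    (hb1 : b ≠ e₁) (hb2 : b ≠ e₂) (hb3 : b ≠ e₃) (l : Fin 4 → ℕ) (s E q A₀ B₀ o p Q₀ Q₁ N : ℂ)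
    (hQ₀ : Q₀ = 4 * (b - e₁) * (b - e₂) * (b - e₃))
    (hQ₁ : Q₁ = 4 * ((b - e₁) * (b - e₂) + (b - e₁) * (b - e₃) + (b - e₂) * (b - e₃)))
    (hN : N = l 0 + l 1 + l 2 + l 3 + 1)
    (ho : o = -s + (Q₁ / 8 + 2 * (l 1 * (b - e₂) * (b - e₃) + l 2 * (b - e₁) * (b - e₃)
      + l 3 * (b - e₁) * (b - e₂))))
    (hp : p = E + (e₁ * l 1 ^ 2 + e₂ * l 2 ^ 2 + e₃ * l 3 ^ 2)
      - 2 * (l 1 * l 2 * e₃ + l 2 * l 3 * e₁ + l 3 * l 1 * e₂) - 1 / 2 * b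
      + 2 * (l 1 * (e₁ + b) + l 2 * (e₂ + b) + l 3 * (e₃ + b)) + 2 * b)
    (hq : q = o / Q₀)
    (hA : A₀ = (1 / 2 - l 1) / (b - e₁) + (1 / 2 - l 2) / (b - e₂) + (1 / 2 - l 3) / (b - e₃))
    (hB : B₀ = (N * (N - 2 * l 0 - 1) * b + p) / Q₀ - o * Q₁ / Q₀ ^ 2)
    (h : q * (A₀ + q) + B₀ = 0) :
    halfPeriodPotential e₁ e₂ e₃ l b + (3 / 2 * b - E) = (3 / 8 * Q₁ + s) ^ 2 / Q₀
      - (3 / 8 * Q₁ + s) * Q₁ / (2 * Q₀) + (3 * b - e₁ - e₂ - e₃) := by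
  have x1 := sub_ne_zero.2 hb1
  have x2 := sub_ne_zero.2 hb2
  have x3 := sub_ne_zero.2 hb3
  have key : halfPeriodPotential e₁ e₂ e₃ l b + (3 / 2 * b - E) - ((3 / 8 * Q₁ + s) ^ 2 / Q₀
      - (3 / 8 * Q₁ + s) * Q₁ / (2 * Q₀) + (3 * b - e₁ - e₂ - e₃))
        = -Q₀ * (q * (A₀ + q) + B₀) := by
    rw [halfPeriodPotential, hq, hA, hB, hp, ho, hN, hQ₁, hQ₀]
    generalize (l 0 : ℂ) = l₀
    generalize (l 1 : ℂ) = l₁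
    generalize (l 2 : ℂ) = l₂
    generalize (l 3 : ℂ) = l₃
    obtain rfl : e₃ = -e₁ - e₂ := by linear_combination hsum
    field_simp
    ring
  rw [h, mul_zero] at key
  exact sub_eq_zero.1 key

/-- An apparent singularity of weight one satisfies the condition on the accessory parameter which
makes the third order equation free of logarithms. -/
theorem halfPeriodPotential_eq_of_isApparent (l : Fin 4 → ℕ) (r : Fin 1 → ℕ) (δ s : Fin 1 → ℂ)
    (E : ℂ) (hr : ∀ k, r k = 1) (hδ : ∀ k, 2 * δ k ∉ L.lattice)
    (happ : IsApparent (fuchsP L l r δ) (fuchsQ L l r δ s E) (bVal L δ 0)) :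
    halfPeriodPotential (eVal L 1) (eVal L 2) (eVal L 3) l (bVal L δ 0) + (3 / 2 * bVal L δ 0 - E)
      = (3 / 8 * (4 * ((bVal L δ 0 - eVal L 1) * (bVal L δ 0 - eVal L 2)
          + (bVal L δ 0 - eVal L 1) * (bVal L δ 0 - eVal L 3)
          + (bVal L δ 0 - eVal L 2) * (bVal L δ 0 - eVal L 3))) + s 0) ^ 2
          / (4 * (bVal L δ 0 - eVal L 1) * (bVal L δ 0 - eVal L 2) * (bVal L δ 0 - eVal L 3))
        - (3 / 8 * (4 * ((bVal L δ 0 - eVal L 1) * (bVal L δ 0 - eVal L 2)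
          + (bVal L δ 0 - eVal L 1) * (bVal L δ 0 - eVal L 3)
          + (bVal L δ 0 - eVal L 2) * (bVal L δ 0 - eVal L 3))) + s 0)
          * (4 * ((bVal L δ 0 - eVal L 1) * (bVal L δ 0 - eVal L 2)
          + (bVal L δ 0 - eVal L 1) * (bVal L δ 0 - eVal L 3)
          + (bVal L δ 0 - eVal L 2) * (bVal L δ 0 - eVal L 3)))
          / (2 * (4 * (bVal L δ 0 - eVal L 1) * (bVal L δ 0 - eVal L 2) * (bVal L δ 0 - eVal L 3)))
        + (3 * bVal L δ 0 - eVal L 1 - eVal L 2 - eVal L 3) := by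
  have esum := (eVal_relations L).1
  have eg2 : g2 L = -4 * (eVal L 1 * eVal L 2 + eVal L 2 * eVal L 3 + eVal L 3 * eVal L 1) := rfl
  have hb : ∀ i : Fin 4, i ≠ 0 → bVal L δ 0 ≠ eVal L i := fun i hi =>
    weierstrassP_ne_eVal_of_two_mul_notMem L (hδ 0) hi
  have hb1 := hb 1 (by decide)
  have hb2 := hb 2 (by decide)
  have hb3 := hb 3 (by decide)
  have hlog := happ.2.2
  -- `R` is the reciprocal of the cubic; its difference quotient is the regular part at `b`
  set R : ℂ → ℂ := fun z => 1 / (4 * (z - eVal L 1) * (z - eVal L 2) * (z - eVal L 3)) with hR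
  set A : ℂ → ℂ := fun z => (1 / 2 - (l 1 : ℂ)) / (z - eVal L 1)
    + (1 / 2 - (l 2 : ℂ)) / (z - eVal L 2) + (1 / 2 - (l 3 : ℂ)) / (z - eVal L 3) with hA
  set N : ℂ := bigN l r with hN
  set p : ℂ := pPar L l r δ E with hp
  set o : ℂ := oPar L l r δ s 0 with ho
  have hPeq : ∀ z, fuchsP L l r δ z = -1 / (z - bVal L δ 0) + A z := by
    intro z
    simp only [fuchsP, Fin.sum_univ_three, Fin.sum_univ_one, hr, hA]
    simp only [show (0 : Fin 3).succ = (1 : Fin 4) from rfl,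
      show (1 : Fin 3).succ = (2 : Fin 4) from rfl, show (2 : Fin 3).succ = (3 : Fin 4) from rfl,
      Nat.cast_one]
    ring
  have hQeq : ∀ z, fuchsQ L l r δ s E z
      = (N * (N - 2 * l 0 - 1) * z + p + o / (z - bVal L δ 0)) * R z := by
    intro z
    simp only [fuchsQ, Fin.sum_univ_one, hR]
    rw [mul_one_div]
  have hoval : o = -s 0 + (4 * ((bVal L δ 0 - eVal L 1) * (bVal L δ 0 - eVal L 2)
          + (bVal L δ 0 - eVal L 1) * (bVal L δ 0 - eVal L 3)
          + (bVal L δ 0 - eVal L 2) * (bVal L δ 0 - eVal L 3)) / 8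
      + 2 * (l 1 * (bVal L δ 0 - eVal L 2) * (bVal L δ 0 - eVal L 3)
        + l 2 * (bVal L δ 0 - eVal L 1) * (bVal L δ 0 - eVal L 3)
        + l 3 * (bVal L δ 0 - eVal L 1) * (bVal L δ 0 - eVal L 2))) := by
    rw [ho, oPar, hr, eg2, show (Finset.univ.erase (0 : Fin 1)) = ∅ from rfl, Finset.sum_empty]
    push_cast
    linear_combination bVal L δ 0 * esum
  have hpval : p = E + (eVal L 1 * l 1 ^ 2 + eVal L 2 * l 2 ^ 2 + eVal L 3 * l 3 ^ 2)
      - 2 * (l 1 * l 2 * eVal L 3 + l 2 * l 3 * eVal L 1 + l 3 * l 1 * eVal L 2)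
      - 1 / 2 * bVal L δ 0
      + 2 * (l 1 * (eVal L 1 + bVal L δ 0) + l 2 * (eVal L 2 + bVal L δ 0)
        + l 3 * (eVal L 3 + bVal L δ 0)) + 2 * bVal L δ 0 := by
    simp only [hp, pPar, Fin.sum_univ_three, Fin.sum_univ_one, hr]
    simp only [show (0 : Fin 3).succ = (1 : Fin 4) from rfl,
      show (1 : Fin 3).succ = (2 : Fin 4) from rfl, show (2 : Fin 3).succ = (3 : Fin 4) from rfl,
      Nat.cast_one]
    ring
  have hNval : N = l 0 + l 1 + l 2 + l 3 + 1 := by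
    rw [hN, bigN, Fin.sum_univ_four, Fin.sum_univ_one, hr]
    push_cast
    ring
  have x1 := sub_ne_zero.2 hb1
  have x2 := sub_ne_zero.2 hb2
  have x3 := sub_ne_zero.2 hb3
  have hQ0 : 4 * (bVal L δ 0 - eVal L 1) * (bVal L δ 0 - eVal L 2) * (bVal L δ 0 - eVal L 3) ≠ 0 :=
    mul_ne_zero (mul_ne_zero (mul_ne_zero (by norm_num) x1) x2) x3
  have hRan : AnalyticAt ℂ R (bVal L δ 0) := by
    refine AnalyticAt.fun_div analyticAt_const (by fun_prop) hQ0
  have hfrac : ∀ k e : ℂ, bVal L δ 0 ≠ e → AnalyticAt ℂ (fun z => k / (z - e)) (bVal L δ 0) :=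
    fun k e h => analyticAt_const.fun_div
      (by fun_prop : AnalyticAt ℂ (fun z : ℂ => z - e) (bVal L δ 0)) (sub_ne_zero.2 h)
  have hAan : AnalyticAt ℂ A (bVal L δ 0) :=
    ((hfrac _ _ hb1).fun_add (hfrac _ _ hb2)).fun_add (hfrac _ _ hb3)
  have hRd : dslope R (bVal L δ 0) (bVal L δ 0)
      = -(4 * ((bVal L δ 0 - eVal L 1) * (bVal L δ 0 - eVal L 2)
          + (bVal L δ 0 - eVal L 1) * (bVal L δ 0 - eVal L 3)
          + (bVal L δ 0 - eVal L 2) * (bVal L δ 0 - eVal L 3)))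
      / (4 * (bVal L δ 0 - eVal L 1) * (bVal L δ 0 - eVal L 2) * (bVal L δ 0 - eVal L 3)) ^ 2 := by
    rw [dslope_same]
    have hx : ∀ e : ℂ, HasDerivAt (fun z : ℂ => z - e) 1 (bVal L δ 0) := fun e =>
      (hasDerivAt_id (bVal L δ 0)).sub_const e
    have := ((hasDerivAt_const (bVal L δ 0) (1 : ℂ)).fun_div
      ((((hx (eVal L 1)).const_mul 4).fun_mul (hx (eVal L 2))).fun_mul (hx (eVal L 3))) hQ0).deriv
    rw [hR, this]
    ring
  have hcond := coeff_condition_of_not_hasLogarithmicSolution (P := fuchsP L l r δ)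
    (Q := fuchsQ L l r δ s E) (A := A)
    (B := fun z => (N * (N - 2 * l 0 - 1) * z + p) * R z + o * dslope R (bVal L δ 0) z)
    (b := bVal L δ 0) (q := o * R (bVal L δ 0))
    hAan (by
      have := AnalyticAt.dslope_self hRan
      fun_prop) (Eventually.of_forall hPeq) (by
      filter_upwards [self_mem_nhdsWithin] with z hz
      have hzb : z - bVal L δ 0 ≠ 0 := sub_ne_zero.2 hz
      rw [hQeq, eq_add_mul_dslope R (bVal L δ 0) z]
      field_simp
      ring) hlog
  refine halfPeriodPotential_eq_of_coeff_condition esum hb1 hb2 hb3 l (s 0) E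
    (o * R (bVal L δ 0)) (A (bVal L δ 0)) _ o p _ _ N rfl rfl hNval hoval hpval ?_ rfl ?_ hcond
  · rw [hR, mul_one_div]
  · rw [hRd, show R (bVal L δ 0) = 1 / (4 * (bVal L δ 0 - eVal L 1) * (bVal L δ 0 - eVal L 2)
      * (bVal L δ 0 - eVal L 3)) from rfl]
    ring

end ApparentSingularity

/-! ### Existence of an even doubly periodic solution -/

section ExistenceOfSolution

variable (L : PeriodPair)

/-- All but finitely many complex numbers avoid the values `e₁, e₂, e₃` and one more value. -/
lemma exists_generic (b : ℂ) : ∃ θ : ℂ, (∀ i : Fin 4, i ≠ 0 → eVal L i ≠ θ) ∧ b ≠ θ := by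
  obtain ⟨θ, hθ⟩ := Infinite.exists_notMem_finset (insert b (Finset.univ.image (eVal L)))
  simp only [Finset.mem_insert, Finset.mem_image, Finset.mem_univ, true_and, not_or,
    not_exists] at hθ
  exact ⟨θ, fun i _ => hθ.2 i, fun h => hθ.1 h.symm⟩

/-- There is a nonzero even doubly periodic solution, namely a rational function of `℘`. -/
theorem exists_ne_zero_mem_evenPeriodicSolutions (l : Fin 4 → ℕ) (M : ℕ) (r : Fin M → ℕ)
    (δ s : Fin M → ℂ) (E : ℂ) (hδ : ∀ k, 2 * δ k ∉ L.lattice)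
    (happ : ∀ k, IsApparent (fuchsP L l r δ) (fuchsQ L l r δ s E) (bVal L δ k))
    (hM : M = 0 ∨ (M = 1 ∧ ∀ k, r k = 1)) :
    ∃ f ∈ evenPeriodicSolutions L l r δ s E, f ≠ 0 := by
  have main : ∀ (b : ℂ) (ρ : ℕ) (β K : ℂ), (∀ i : Fin 4, i ≠ 0 → b ≠ eVal L i) →
      ((ρ = 0 ∧ β = 0) ∨ (ρ = 1 ∧
        halfPeriodPotential (eVal L 1) (eVal L 2) (eVal L 3) l b + K
        = β ^ 2 / (4 * (b - eVal L 1) * (b - eVal L 2) * (b - eVal L 3))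
          - β * (4 * ((b - eVal L 1) * (b - eVal L 2) + (b - eVal L 1) * (b - eVal L 3)
            + (b - eVal L 2) * (b - eVal L 3)))
            / (2 * (4 * (b - eVal L 1) * (b - eVal L 2) * (b - eVal L 3)))
          + (3 * b - eVal L 1 - eVal L 2 - eVal L 3))) →
      (∀ x ∉ singularSet L δ, ρ = 0 ∨ L.weierstrassP x ≠ b) →
      (∀ x ∉ singularSet L δ,
        potential L l r δ s x - E = potentialOfP L l ρ b β K (L.weierstrassP x)) →
      ∃ f ∈ evenPeriodicSolutions L l r δ s E, f ≠ 0 := by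
    intro b ρ β K hb hcond hS hpot
    obtain ⟨θ, hθ, hbθ⟩ := exists_generic L b
    obtain ⟨N, D, hN, hD, hode⟩ := exists_rational_solution L l ρ b β K θ hθ hbθ hb hcond
    have hD' : ∀ x ∉ singularSet L δ, D.eval (L.weierstrassP x) ≠ 0 := fun x hx =>
      hD _ (fun i hi => weierstrassP_ne_eVal_of_two_mul_notMem L
        (two_mul_notMem_of_notMem_singularSet hx) hi) (hS x hx)
    refine ⟨_, indicator_mem_evenPeriodicSolutions hδ l r s E N D hD' fun x => ?_,
      indicator_eval_div_ne_zero hN hD'⟩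
    -- the points with `℘ = θ` are isolated, hence harmless
    filter_upwards [eventually_notMem_singularSet_nhdsNE L δ x, eventually_weierstrassP_ne L θ x,
      eventually_weierstrassP_ne L b x] with y hy1 hy2 hy3
    have h := hode y (fun y => potential L l r δ s y - E) (two_mul_notMem_of_notMem_singularSet hy1)
      hy2 hy3 (by filter_upwards [eventually_notMem_singularSet hy1] with z hz using hpot z hz)
    rwa [deriv_sub_const] at h
  rcases hM with rfl | ⟨rfl, hr⟩
  -- without a singular point `±δ`, an ordinary point `b` takes its place
  · obtain ⟨b, hb, -⟩ := exists_generic L 0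
    exact main b 0 0 (-E) (fun i hi => (hb i hi).symm) (Or.inl ⟨rfl, rfl⟩) (fun _ _ => Or.inl rfl)
      fun x hx => potential_sub_eq_of_isEmpty L l r δ s E b (two_mul_notMem_of_notMem_singularSet hx)
  · exact main (bVal L δ 0) 1 _ _
      (fun i hi => weierstrassP_ne_eVal_of_two_mul_notMem L (hδ 0) hi)
      (Or.inr ⟨rfl, halfPeriodPotential_eq_of_isApparent L l r δ s E hr hδ (happ 0)⟩)
      (fun x hx => Or.inr (weierstrassP_ne_of_notMem_singularSet hδ hx 0))
      fun x hx => potential_sub_eq_of_unique L l r δ s E hr hδ hx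

end ExistenceOfSolution

/-! ### Exponents of the third order equation -/

section Indicial

/-- The leading coefficient of the derivative. -/
lemma exists_deriv_eq_zpow_mul {F φ : ℂ → ℂ} {x₀ : ℂ} {n : ℤ} (hφ : AnalyticAt ℂ φ x₀)
    (hF : ∀ᶠ z in 𝓝[≠] x₀, F z = (z - x₀) ^ n * φ z) :
    ∃ ψ : ℂ → ℂ, AnalyticAt ℂ ψ x₀ ∧ ψ x₀ = n * φ x₀ ∧
      ∀ᶠ z in 𝓝[≠] x₀, deriv F z = (z - x₀) ^ (n - 1) * ψ z := by
  have hφ' := hφ.deriv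
  refine ⟨fun z => n * φ z + (z - x₀) * deriv φ z, by fun_prop, by simp, ?_⟩
  filter_upwards [eventually_nhdsNE_eventually_nhds_iff.2 hF, self_mem_nhdsWithin,
    hφ.eventually_analyticAt.filter_mono nhdsWithin_le_nhds] with z hz hz0 hz2
  have h0 : z - x₀ ≠ 0 := sub_ne_zero.2 hz0
  have hF' : F =ᶠ[𝓝 z] fun z => (z - x₀) ^ n * φ z := hz
  have h1 : HasDerivAt (fun z : ℂ => (z - x₀) ^ n) (n * (z - x₀) ^ (n - 1)) z := by
    simpa using (hasDerivAt_zpow n (z - x₀) (Or.inl h0)).comp_sub_const z x₀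
  rw [hF'.deriv_eq, (h1.fun_mul hz2.differentiableAt.hasDerivAt).deriv]
  rw [show (z - x₀) ^ n = (z - x₀) ^ (n - 1) * (z - x₀) by rw [← zpow_add_one₀ h0, sub_add_cancel]]
  ring

lemma exists_eq_sq_inv_mul {u : ℂ → ℂ} {x₀ A : ℂ} (hu : MeromorphicAt u x₀)
    (hA : Tendsto (fun z => (z - x₀) ^ 2 * u z) (𝓝[≠] x₀) (𝓝 A)) :
    ∃ h : ℂ → ℂ, AnalyticAt ℂ h x₀ ∧ h x₀ = A ∧
      ∀ᶠ z in 𝓝[≠] x₀, u z = (z - x₀) ^ (-2 : ℤ) * h z := by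
  have hm : MeromorphicAt (fun z => (z - x₀) ^ 2 * u z) x₀ := by fun_prop
  have hord := order_nonneg_of_tendsto hm hA
  have han := hm.meromorphicOrderAt_nonneg_iff_analyticAt_toMeromorphicNFAt.1 hord
  have heq := hm.eq_nhdsNE_toMeromorphicNFAt
  refine ⟨toMeromorphicNFAt (fun z => (z - x₀) ^ 2 * u z) x₀, han, ?_, ?_⟩
  · exact tendsto_nhds_unique (han.continuousAt.tendsto.mono_left nhdsWithin_le_nhds)
      (hA.congr' heq)
  · filter_upwards [heq, self_mem_nhdsWithin] with z hz hz0
    have h0 : z - x₀ ≠ 0 := sub_ne_zero.2 hz0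
    rw [← hz, ← mul_assoc]
    have : (z - x₀) ^ (-2 : ℤ) * (z - x₀) ^ 2 = 1 := by
      rw [zpow_neg]
      exact inv_mul_cancel₀ (pow_ne_zero 2 h0)
    rw [this, one_mul]

/-- The indicial equation of `W''' = 4 u W' + 2 u' W` at a double pole of `u`. -/
theorem indicial_equation {u W : ℂ → ℂ} {x₀ A : ℂ} {n : ℤ} (hu : MeromorphicAt u x₀)
    (hA : Tendsto (fun z => (z - x₀) ^ 2 * u z) (𝓝[≠] x₀) (𝓝 A)) (hW : MeromorphicAt W x₀)
    (hn : meromorphicOrderAt W x₀ = n)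
    (hode : ∀ᶠ z in 𝓝[≠] x₀,
      deriv (deriv (deriv W)) z = 4 * u z * deriv W z + 2 * deriv u z * W z) :
    (n : ℂ) * (n - 1) * (n - 2) - 4 * A * n + 4 * A = 0 := by
  obtain ⟨φ, hφ, hφ0, hWφ⟩ := (meromorphicOrderAt_eq_int_iff hW).1 hn
  simp only [smul_eq_mul] at hWφ
  obtain ⟨φ₁, h1, h1', h1''⟩ := exists_deriv_eq_zpow_mul hφ hWφ
  obtain ⟨φ₂, h2, h2', h2''⟩ := exists_deriv_eq_zpow_mul h1 h1''
  obtain ⟨φ₃, h3, h3', h3''⟩ := exists_deriv_eq_zpow_mul h2 h2''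
  obtain ⟨h, hh, hhA, hu'⟩ := exists_eq_sq_inv_mul hu hA
  obtain ⟨k, hk, hk', hk''⟩ := exists_deriv_eq_zpow_mul hh hu'
  have key : ∀ᶠ z in 𝓝[≠] x₀, φ₃ z - 4 * h z * φ₁ z - 2 * k z * φ z = 0 := by
    filter_upwards [hode, hWφ, h1'', h3'', hu', hk'', self_mem_nhdsWithin] with z g0 g1 g2 g3 g4 g5 g6
    have h0 : z - x₀ ≠ 0 := sub_ne_zero.2 g6
    rw [g3, g4, g2, g5, g1] at g0
    have e1 : (z - x₀) ^ (-2 : ℤ) * (z - x₀) ^ (n - 1) = (z - x₀) ^ (n - 1 - 1 - 1) := by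
      rw [← zpow_add₀ h0]; congr 1; ring
    have e2 : (z - x₀) ^ (-2 - 1 : ℤ) * (z - x₀) ^ n = (z - x₀) ^ (n - 1 - 1 - 1) := by
      rw [← zpow_add₀ h0]; congr 1; ring
    apply mul_left_cancel₀ (zpow_ne_zero (n - 1 - 1 - 1) h0)
    linear_combination g0 + 4 * h z * φ₁ z * e1 + 2 * k z * φ z * e2
  have hlim : φ₃ x₀ - 4 * h x₀ * φ₁ x₀ - 2 * k x₀ * φ x₀ = 0 := by
    have han : AnalyticAt ℂ (fun z => φ₃ z - 4 * h z * φ₁ z - 2 * k z * φ z) x₀ := by fun_prop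
    exact (han.frequently_zero_iff_eventually_zero.1 key.frequently).self_of_nhds
  rw [h3', h2', h1', hk', hhA] at hlim
  push_cast at hlim
  apply mul_right_cancel₀ hφ0
  linear_combination hlim

/-- For the leading coefficient `l (l + 1)` the exponents are `-2 l`, `1` and `2 l + 2`, of which only
the second is odd. -/
lemma order_eq_one_of_indicial {n : ℤ} {l : ℕ} (hodd : (-1 : ℂ) ^ n = -1)
    (h : (n : ℂ) * (n - 1) * (n - 2) - 4 * (l * (l + 1)) * n + 4 * (l * (l + 1)) = 0) : n = 1 := by
  have hn : Odd n := by
    by_contra hne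
    rw [Int.not_odd_iff_even] at hne
    rw [hne.neg_one_zpow] at hodd
    norm_num at hodd
  have hz : (n - 1) * ((n + 2 * l) * (n - 2 * l - 2)) = 0 := by
    have : (((n - 1) * ((n + 2 * l) * (n - 2 * l - 2)) : ℤ) : ℂ) = 0 := by
      push_cast
      linear_combination h
    exact_mod_cast this
  obtain ⟨m, rfl⟩ := hn
  rcases mul_eq_zero.1 hz with h1 | h1
  · omega
  · rcases mul_eq_zero.1 h1 with h2 | h2 <;> omega

/-- For the leading coefficient `3/4` the exponents are `-1`, `1` and `3`. -/
lemma order_ge_of_indicial {n : ℤ}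
    (h : (n : ℂ) * (n - 1) * (n - 2) - 4 * (3 / 4) * n + 4 * (3 / 4) = 0) : -1 ≤ n := by
  have hz : (n - 1) * ((n - 3) * (n + 1)) = 0 := by
    have : (((n - 1) * ((n - 3) * (n + 1)) : ℤ) : ℂ) = 0 := by
      push_cast
      linear_combination h
    exact_mod_cast this
  rcases mul_eq_zero.1 hz with h1 | h1
  · omega
  · rcases mul_eq_zero.1 h1 with h2 | h2 <;> omega

end Indicial

/-! ### Leading coefficients of the potential -/

section Potential

variable {L : PeriodPair} {M : ℕ} {δ : Fin M → ℂ}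

lemma tendsto_sq_mul_zero_of_continuousAt {F : ℂ → ℂ} {x₀ : ℂ} (hF : ContinuousAt F x₀) :
    Tendsto (fun z => (z - x₀) ^ 2 * F z) (𝓝[≠] x₀) (𝓝 0) := by
  have h : Tendsto (fun z => (z - x₀) ^ 2 * F z) (𝓝 x₀) (𝓝 ((x₀ - x₀) ^ 2 * F x₀)) :=
    (Continuous.tendsto (by fun_prop : Continuous fun z : ℂ => (z - x₀) ^ 2) x₀).mul hF
  rw [sub_self, zero_pow two_ne_zero, zero_mul] at h
  exact h.mono_left nhdsWithin_le_nhds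

lemma tendsto_sq_mul_weierstrassP_add {x₀ c : ℂ} (h : x₀ + c ∈ L.lattice) :
    Tendsto (fun z => (z - x₀) ^ 2 * L.weierstrassP (z + c)) (𝓝[≠] x₀) (𝓝 1) := by
  refine ((tendsto_sq_mul_weierstrassP L h).comp (tendsto_add_const_nhdsNE x₀ c)).congr fun z => ?_
  simp

lemma tendsto_sq_mul_weierstrassP_add_zero {x₀ c : ℂ} (h : x₀ + c ∉ L.lattice) :
    Tendsto (fun z => (z - x₀) ^ 2 * L.weierstrassP (z + c)) (𝓝[≠] x₀) (𝓝 0) :=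
  tendsto_sq_mul_zero_of_continuousAt (analyticAt_weierstrassP_add h).continuousAt

/-- `1 / (℘ - ℘(η))` has at most simple poles. -/
lemma tendsto_sq_mul_inv_weierstrassP_sub {η : ℂ} (hη : 2 * η ∉ L.lattice) (x₀ : ℂ) :
    Tendsto (fun z => (z - x₀) ^ 2 * (1 / (L.weierstrassP z - L.weierstrassP η)))
      (𝓝[≠] x₀) (𝓝 0) := by
  by_cases hx : x₀ ∈ L.lattice
  · have hm := meromorphic_weierstrassP_sub_const L (L.weierstrassP η) x₀
    have h1 : Tendsto (fun z => L.weierstrassP z - L.weierstrassP η) (𝓝[≠] x₀)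
        (Bornology.cobounded ℂ) := by
      rw [tendsto_cobounded_iff_meromorphicOrderAt_neg hm, order_weierstrassP_sub_const L hx]
      exact WithTop.coe_lt_coe.2 (by norm_num)
    have h2 := tendsto_inv₀_cobounded.comp h1
    have h3 : Tendsto (fun z : ℂ => (z - x₀) ^ 2) (𝓝[≠] x₀) (𝓝 0) :=
      (Continuous.tendsto' (by fun_prop) _ _ (by simp)).mono_left nhdsWithin_le_nhds
    simpa [Function.comp_def] using h3.mul h2
  by_cases hP : L.weierstrassP x₀ = L.weierstrassP η
  · have hx2 : 2 * x₀ ∉ L.lattice := by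
      intro h2
      obtain ⟨i, hi⟩ := mem_lattice_of_halfPeriod L h2
      have hi0 : i ≠ 0 := by
        rintro rfl
        exact hx (by simpa [halfPeriod_zero] using hi)
      refine weierstrassP_ne_eVal_of_two_mul_notMem L hη hi0 ?_
      rw [← hP, eVal, ← weierstrassP_add_lattice L (halfPeriod L i) hi]
      congr 1; ring
    have h1 : Tendsto (fun z => (L.weierstrassP z - L.weierstrassP η) / (z - x₀)) (𝓝[≠] x₀)
        (𝓝 (L.derivWeierstrassP x₀)) := by
      refine ((hasDerivAt_weierstrassP L hx).tendsto_slope).congr fun z => ?_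
      rw [slope_def_field, hP]
    have h2 := h1.inv₀ (derivWeierstrassP_ne_zero L hx2)
    have h3 : Tendsto (fun z : ℂ => z - x₀) (𝓝[≠] x₀) (𝓝 0) :=
      (Continuous.tendsto' (by fun_prop) _ _ (by simp)).mono_left nhdsWithin_le_nhds
    have h4 := h3.mul h2
    rw [zero_mul] at h4
    refine h4.congr' ?_
    filter_upwards [self_mem_nhdsWithin] with z hz
    have h0 : z - x₀ ≠ 0 := sub_ne_zero.2 hz
    rw [inv_div, one_div, div_eq_mul_inv]
    ring
  · refine tendsto_sq_mul_zero_of_continuousAt ?_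
    exact continuousAt_const.div ((hasDerivAt_weierstrassP L hx).continuousAt.sub continuousAt_const)
      (sub_ne_zero.2 hP)

lemma meromorphic_potential (l : Fin 4 → ℕ) (r : Fin M → ℕ) (s : Fin M → ℂ) :
    Meromorphic (potential L l r δ s) := by
  intro x
  have h1 : ∀ c, MeromorphicAt (fun y => L.weierstrassP (y + c)) x := fun c =>
    meromorphic_comp_add_const L.meromorphic_weierstrassP c x
  have h2 : ∀ c, MeromorphicAt (fun y => L.weierstrassP (y - c)) x := fun c => by
    simpa [sub_eq_add_neg] using h1 (-c)
  unfold potential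
  refine MeromorphicAt.fun_add (MeromorphicAt.fun_sum fun i _ =>
    (MeromorphicAt.const _ _).fun_mul (h1 _)) (MeromorphicAt.fun_sum fun k _ => ?_)
  exact ((MeromorphicAt.const _ _).fun_mul ((h2 _).fun_add (h1 _))).fun_add
    ((MeromorphicAt.const _ _).fun_div (meromorphic_weierstrassP_sub_const L _ x))

lemma tendsto_sq_mul_const (x₀ E : ℂ) :
    Tendsto (fun z => (z - x₀) ^ 2 * E) (𝓝[≠] x₀) (𝓝 0) :=
  tendsto_sq_mul_zero_of_continuousAt continuousAt_const

/-- The leading coefficient of the potential at a point, in terms of the terms which have a double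
pole there. -/
lemma tendsto_sq_mul_potential (hδ : ∀ k, 2 * δ k ∉ L.lattice) (l : Fin 4 → ℕ) (r : Fin M → ℕ)
    (s : Fin M → ℂ) (E : ℂ) {x₀ : ℂ} {a : Fin 4 → ℂ} {c d : Fin M → ℂ}
    (ha : ∀ i, Tendsto (fun z => (z - x₀) ^ 2 * L.weierstrassP (z + halfPeriod L i)) (𝓝[≠] x₀)
      (𝓝 (a i)))
    (hc : ∀ k, Tendsto (fun z => (z - x₀) ^ 2 * L.weierstrassP (z - δ k)) (𝓝[≠] x₀) (𝓝 (c k)))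
    (hd : ∀ k, Tendsto (fun z => (z - x₀) ^ 2 * L.weierstrassP (z + δ k)) (𝓝[≠] x₀) (𝓝 (d k))) :
    Tendsto (fun z => (z - x₀) ^ 2 * (potential L l r δ s z - E)) (𝓝[≠] x₀)
      (𝓝 (∑ i, (l i : ℂ) * (l i + 1) * a i
        + ∑ k, (r k : ℂ) / 2 * ((r k : ℂ) / 2 + 1) * (c k + d k))) := by
  have h1 := tendsto_finsetSum Finset.univ fun i _ => (ha i).const_mul ((l i : ℂ) * (l i + 1))
  have h2 := tendsto_finsetSum Finset.univ fun k _ =>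
    (((hc k).add (hd k)).const_mul ((r k : ℂ) / 2 * ((r k : ℂ) / 2 + 1))).add
      ((tendsto_sq_mul_inv_weierstrassP_sub (hδ k) x₀).const_mul (s k))
  have h3 := (h1.add h2).sub (tendsto_sq_mul_const x₀ E)
  simp only [mul_zero, add_zero, sub_zero] at h3
  refine h3.congr fun z => ?_
  rw [potential, mul_sub, mul_add, Finset.mul_sum, Finset.mul_sum]
  congr 2
  · exact Finset.sum_congr rfl fun i _ => by ring
  · exact Finset.sum_congr rfl fun k _ => by ring

end Potential

/-! ### Elliptic functions vanishing at the half periods -/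

section OddElliptic

variable {L : PeriodPair}

/-- `℘ - e_i` has a double zero at `ω_i`, by the Möbius involution `x ↦ x + ω_i`. -/
lemma order_weierstrassP_sub_eVal {i : Fin 4} (hi : i ≠ 0) {x₀ : ℂ}
    (hx : x₀ - halfPeriod L i ∈ L.lattice) :
    meromorphicOrderAt (fun x => L.weierstrassP x - eVal L i) x₀ = (2 : ℤ) := by
  obtain ⟨h, h0, hh⟩ := exists_weierstrassP_halfPeriod_mul L (two_mul_halfPeriod_mem L i)
    (halfPeriod_notMem L hi)
  have hx' := (sub_halfPeriod_mem_iff L x₀ i).1 hx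
  have hm1 := meromorphic_comp_add_const (meromorphic_weierstrassP_sub_const L (eVal L i))
    (halfPeriod L i) x₀
  have hm2 := meromorphic_weierstrassP_sub_const L (eVal L i) x₀
  have h1 : meromorphicOrderAt (fun x => L.weierstrassP (x + halfPeriod L i) - eVal L i) x₀
      = (-2 : ℤ) := by
    rw [← order_weierstrassP_sub_const L hx' (eVal L i),
      ← meromorphicOrderAt_comp_add_const_eq_meromorphicOrderAt (c := halfPeriod L i)]
    rfl
  have h2 : meromorphicOrderAt (fun x => (L.weierstrassP (x + halfPeriod L i) - eVal L i)
      * (L.weierstrassP x - eVal L i)) x₀ = 0 := by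
    rw [← tendsto_ne_zero_iff_meromorphicOrderAt_eq_zero (hm1.fun_mul hm2)]
    refine ⟨h, h0, tendsto_const_nhds.congr' ?_⟩
    filter_upwards [eventually_notMem_lattice L x₀,
      (tendsto_add_const_nhdsNE x₀ (halfPeriod L i)).eventually (eventually_notMem_lattice L _)]
      with y g1 g2 using (hh y g1 g2).symm
  rw [fun_meromorphicOrderAt_mul hm1 hm2, h1] at h2
  lift meromorphicOrderAt (fun x => L.weierstrassP x - eVal L i) x₀ to ℤ
    using order_weierstrassP_sub_const_ne_top L _ _ with n hn
  have h3 : -2 + n = 0 := by exact_mod_cast h2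
  rw [show n = 2 by omega]

lemma order_weierstrassP_sub_nonneg {x₀ : ℂ} (hx : x₀ ∉ L.lattice) (c : ℂ) :
    0 ≤ meromorphicOrderAt (fun x => L.weierstrassP x - c) x₀ :=
  ((L.analyticOnNhd_weierstrassP x₀ hx).fun_sub analyticAt_const).meromorphicOrderAt_nonneg

lemma order_weierstrassP_sub_eq_zero {x₀ c : ℂ} (hx : x₀ ∉ L.lattice)
    (hc : L.weierstrassP x₀ ≠ c) : meromorphicOrderAt (fun x => L.weierstrassP x - c) x₀ = 0 := by
  rw [← tendsto_ne_zero_iff_meromorphicOrderAt_eq_zero (meromorphic_weierstrassP_sub_const L c x₀)]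
  exact ⟨_, sub_ne_zero.2 hc, (((hasDerivAt_weierstrassP L hx).continuousAt.sub
    continuousAt_const).tendsto.mono_left nhdsWithin_le_nhds)⟩

open scoped Classical in
/-- The order of `∏ (℘ - e_j) = ℘'² / 4` at every point. -/
lemma order_prod_weierstrassP_sub_eVal (L : PeriodPair) (x₀ : ℂ) :
    meromorphicOrderAt (fun x => ∏ j : Fin 3, (L.weierstrassP x - eVal L j.succ)) x₀
      = ((if x₀ ∈ L.lattice then -6 else if 2 * x₀ ∈ L.lattice then 2 else 0 : ℤ) : WithTop ℤ) := by
  rw [meromorphicOrderAt_fun_prod fun j _ => meromorphic_weierstrassP_sub_const L (eVal L j.succ) x₀]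
  split_ifs with h1 h2
  · simp_rw [order_weierstrassP_sub_const L h1]
    rfl
  · obtain ⟨i, hi⟩ := mem_lattice_of_halfPeriod L h2
    have hi0 : i ≠ 0 := by
      rintro rfl
      exact h1 (by simpa [halfPeriod_zero] using hi)
    obtain ⟨j, rfl⟩ := Fin.exists_succ_eq.2 hi0
    rw [Finset.sum_eq_single j _ (by simp), order_weierstrassP_sub_eVal hi0 hi]
    intro k _ hk
    refine order_weierstrassP_sub_eq_zero h1 (weierstrassP_ne_eVal L (Fin.succ_ne_zero k) h1 ?_)
    intro hk'
    refine halfPeriod_sub_notMem L (i := k.succ) (j := j.succ) (by simpa using hk) ?_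
    simpa using L.lattice.sub_mem hi hk'
  · refine Finset.sum_eq_zero fun k _ => ?_
    exact order_weierstrassP_sub_eq_zero h1
      (weierstrassP_ne_eVal_of_two_mul_notMem L h2 (Fin.succ_ne_zero k))

/-- An elliptic function which vanishes at all half periods and whose only poles are simple poles
at the zeros of `℘ - b` vanishes identically: `W² (℘ - b)² / ∏ (℘ - e_j)` has no pole, and it
vanishes at the origin. -/
theorem eventually_eq_zero_of_order {W : ℂ → ℂ} (hW : Meromorphic W)
    (hper : ∀ x, ∀ ω ∈ L.lattice, W (x + ω) = W x) (b : ℂ)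
    (h1 : ∀ x, 2 * x ∈ L.lattice → ((1 : ℤ) : WithTop ℤ) ≤ meromorphicOrderAt W x)
    (h2 : ∀ x, 2 * x ∉ L.lattice → ((-1 : ℤ) : WithTop ℤ) ≤ meromorphicOrderAt W x)
    (h3 : ∀ x, 2 * x ∉ L.lattice → L.weierstrassP x ≠ b → 0 ≤ meromorphicOrderAt W x) (x : ℂ) :
    ∀ᶠ y in 𝓝[≠] x, W y = 0 := by
  set P : ℂ → ℂ := fun x => L.weierstrassP x - b with hP
  set Q : ℂ → ℂ := fun x => ∏ j : Fin 3, (L.weierstrassP x - eVal L j.succ) with hQ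
  have hPm : Meromorphic P := meromorphic_weierstrassP_sub_const L b
  have hQm : Meromorphic Q := fun x =>
    MeromorphicAt.fun_prod fun j _ => meromorphic_weierstrassP_sub_const L (eVal L j.succ) x
  set G : ℂ → ℂ := fun x => (W x * P x) * (W x * P x) * (Q x)⁻¹ with hG
  have hGm : Meromorphic G := fun x =>
    (((hW x).fun_mul (hPm x)).fun_mul ((hW x).fun_mul (hPm x))).fun_mul (hQm x).fun_inv
  have hord : ∀ x (m n : ℤ), (m : WithTop ℤ) ≤ meromorphicOrderAt W x + meromorphicOrderAt P x →
      meromorphicOrderAt Q x = n → ((m + m - n : ℤ) : WithTop ℤ) ≤ meromorphicOrderAt G x := by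
    intro x m n hm hn
    rw [hG, fun_meromorphicOrderAt_mul (((hW x).fun_mul (hPm x)).fun_mul ((hW x).fun_mul (hPm x)))
      (hQm x).fun_inv, fun_meromorphicOrderAt_mul ((hW x).fun_mul (hPm x)) ((hW x).fun_mul (hPm x)),
      fun_meromorphicOrderAt_mul (hW x) (hPm x), fun_meromorphicOrderAt_inv, hn]
    have := add_le_add (add_le_add hm hm) (le_refl ((-n : ℤ) : WithTop ℤ))
    exact this
  have hlat : ∀ x ∈ L.lattice, ((4 : ℤ) : WithTop ℤ) ≤ meromorphicOrderAt G x := by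
    intro x hx
    have hx2 : 2 * x ∈ L.lattice := by
      rw [two_mul]; exact L.lattice.add_mem hx hx
    refine hord x (-1) (-6) ?_ ?_
    · rw [hP, order_weierstrassP_sub_const L hx]
      exact add_le_add (h1 x hx2) (le_refl ((-2 : ℤ) : WithTop ℤ))
    · rw [hQ, order_prod_weierstrassP_sub_eVal, if_pos hx]
  have hnonneg : ∀ x, 0 ≤ meromorphicOrderAt G x := by
    intro x
    by_cases hx : x ∈ L.lattice
    · exact le_trans (by exact_mod_cast (by norm_num : (0 : ℤ) ≤ 4)) (hlat x hx)
    have hP0 : 0 ≤ meromorphicOrderAt P x := order_weierstrassP_sub_nonneg hx b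
    by_cases hx2 : 2 * x ∈ L.lattice
    · refine hord x 1 2 ?_ ?_
      · simpa using add_le_add (h1 x hx2) hP0
      · rw [hQ, order_prod_weierstrassP_sub_eVal, if_neg hx, if_pos hx2]
    · refine hord x 0 0 ?_ ?_
      · by_cases hb : L.weierstrassP x = b
        · have hpos : 0 < meromorphicOrderAt P x := by
            rw [← tendsto_zero_iff_meromorphicOrderAt_pos (hPm x)]
            have := ((hasDerivAt_weierstrassP L hx).continuousAt.sub
              (continuousAt_const (y := b))).tendsto
            rw [Pi.sub_apply, hb, sub_self] at this
            exact this.mono_left nhdsWithin_le_nhds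
          have hone : ((1 : ℤ) : WithTop ℤ) ≤ meromorphicOrderAt P x := by
            lift meromorphicOrderAt P x to ℤ using order_weierstrassP_sub_const_ne_top L _ _ with n
            exact_mod_cast (by exact_mod_cast hpos : (0 : ℤ) < n)
          exact add_le_add (h2 x hx2) hone
        · simpa using add_le_add (h3 x hx2 hb) hP0
      · rw [hQ, order_prod_weierstrassP_sub_eVal, if_neg hx, if_neg hx2]
  have hGper : ∀ x, ∀ ω ∈ L.lattice, G (x + ω) = G x := by
    intro x ω hω
    simp only [hG, hP, hQ, hper x ω hω, weierstrassP_add_lattice L x hω]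
  obtain ⟨c, hc⟩ := exists_eventually_eq_const_of_periodic L hGm hGper hnonneg
  have hc0 : c = 0 := by
    have h0 : Tendsto G (𝓝[≠] 0) (𝓝 0) := by
      rw [tendsto_zero_iff_meromorphicOrderAt_pos (hGm 0)]
      exact lt_of_lt_of_le (by exact_mod_cast (by norm_num : (0 : ℤ) < 4))
        (hlat 0 L.lattice.zero_mem)
    exact tendsto_nhds_unique (tendsto_const_nhds.congr' ((hc 0).mono fun _ h => h.symm)) h0
  subst hc0
  have hne : ∀ᶠ y in 𝓝[≠] x, ∀ j : Fin 3, L.weierstrassP y ≠ eVal L j.succ :=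
    eventually_all.2 fun j => eventually_weierstrassP_ne L _ x
  filter_upwards [hc x, eventually_weierstrassP_ne L b x, hne] with y g1 g2 g3
  have hQ0 : Q y ≠ 0 := Finset.prod_ne_zero_iff.2 fun j _ => sub_ne_zero.2 (g3 j)
  have hP0 : P y ≠ 0 := sub_ne_zero.2 g2
  simpa [hG, hQ0, hP0] using g1

end OddElliptic

/-! ### Wronskians -/

section Wronskian

/-- The Wronskian of two functions. -/
noncomputable def wronskian (f g : ℂ → ℂ) (x : ℂ) : ℂ := f x * deriv g x - deriv f x * g x

/-- The symmetric square of a second order equation `y'' = u y` has Wronskians among its own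
solutions: if `f`, `g` solve `Ξ''' = 4 u Ξ' + 2 u' Ξ`, so does `f g' - f' g`. -/
theorem deriv_deriv_deriv_wronskian {f g u : ℂ → ℂ} {x : ℂ} (hf : AnalyticAt ℂ f x)
    (hg : AnalyticAt ℂ g x) (hu : AnalyticAt ℂ u x)
    (hf3 : ∀ᶠ y in 𝓝 x, deriv (deriv (deriv f)) y = 4 * u y * deriv f y + 2 * deriv u y * f y)
    (hg3 : ∀ᶠ y in 𝓝 x, deriv (deriv (deriv g)) y = 4 * u y * deriv g y + 2 * deriv u y * g y) :
    deriv (deriv (deriv (wronskian f g))) x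
      = 4 * u x * deriv (wronskian f g) x + 2 * deriv u x * wronskian f g x := by
  have d1 : deriv (wronskian f g) =ᶠ[𝓝 x]
      fun y => f y * deriv (deriv g) y - deriv (deriv f) y * g y := by
    filter_upwards [hf.eventually_analyticAt, hg.eventually_analyticAt] with y f0 g0
    have := (f0.differentiableAt.hasDerivAt.fun_mul g0.deriv.differentiableAt.hasDerivAt).fun_sub
      (f0.deriv.differentiableAt.hasDerivAt.fun_mul g0.differentiableAt.hasDerivAt)
    refine this.deriv.trans ?_
    ring
  have d2 : deriv (deriv (wronskian f g)) =ᶠ[𝓝 x]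
      fun y => 4 * u y * wronskian f g y
        + (deriv f y * deriv (deriv g) y - deriv (deriv f) y * deriv g y) := by
    filter_upwards [hf.eventually_analyticAt, hg.eventually_analyticAt, d1.eventually_nhds, hf3, hg3]
      with y f0 g0 h f3 g3
    rw [EventuallyEq.deriv_eq h]
    have := (f0.differentiableAt.hasDerivAt.fun_mul
      g0.deriv.deriv.differentiableAt.hasDerivAt).fun_sub
      (f0.deriv.deriv.differentiableAt.hasDerivAt.fun_mul g0.differentiableAt.hasDerivAt)
    refine this.deriv.trans ?_
    rw [f3, g3, wronskian]
    ring
  rw [EventuallyEq.deriv_eq d2]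
  have hw : HasDerivAt (wronskian f g) (deriv (wronskian f g) x) x :=
    (((hf.fun_mul hg.deriv).fun_sub (hf.deriv.fun_mul hg)).differentiableAt).hasDerivAt
  have := ((hu.differentiableAt.hasDerivAt.const_mul 4).fun_mul hw).fun_add
    ((hf.deriv.differentiableAt.hasDerivAt.fun_mul
      hg.deriv.deriv.differentiableAt.hasDerivAt).fun_sub
      (hf.deriv.deriv.differentiableAt.hasDerivAt.fun_mul hg.deriv.differentiableAt.hasDerivAt))
  refine this.deriv.trans ?_
  rw [hf3.self_of_nhds, hg3.self_of_nhds, d1.self_of_nhds, wronskian]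
  ring

lemma meromorphic_wronskian {f g : ℂ → ℂ} (hf : Meromorphic f) (hg : Meromorphic g) :
    Meromorphic (wronskian f g) := fun x =>
  ((hf x).fun_mul (hg x).deriv).fun_sub ((hf x).deriv.fun_mul (hg x))

lemma wronskian_add_period {f g : ℂ → ℂ} {ω : ℂ} (hf : ∀ x, f (x + ω) = f x)
    (hg : ∀ x, g (x + ω) = g x) (x : ℂ) : wronskian f g (x + ω) = wronskian f g x := by
  have h : ∀ k : ℂ → ℂ, (∀ x, k (x + ω) = k x) → deriv k (x + ω) = deriv k x := by
    intro k hk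
    rw [← deriv_comp_add_const, funext hk]
  rw [wronskian, wronskian, hf, hg, h f hf, h g hg]

lemma wronskian_neg_of_even {f g : ℂ → ℂ} (hf : ∀ x, f (-x) = f x) (hg : ∀ x, g (-x) = g x)
    (x : ℂ) : wronskian f g (-x) = -wronskian f g x := by
  have h : ∀ k : ℂ → ℂ, (∀ x, k (-x) = k x) → deriv k (-x) = -deriv k x := by
    intro k hk
    have h1 := deriv_comp_neg k x
    rw [show (fun x => k (-x)) = k from funext hk] at h1
    rw [h1, neg_neg]
  rw [wronskian, wronskian, hf, hg, h f hf, h g hg]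
  ring

/-- If the Wronskian of `f` and `h` vanishes near a point at which `h` vanishes and `f` does not,
then `h` vanishes near that point. -/
theorem eventually_eq_zero_of_wronskian {f h : ℂ → ℂ} {x : ℂ} (hf : AnalyticAt ℂ f x)
    (hh : AnalyticAt ℂ h x) (hf0 : f x ≠ 0) (hh0 : h x = 0)
    (hW : ∀ᶠ y in 𝓝 x, wronskian f h y = 0) : ∀ᶠ y in 𝓝 x, h y = 0 := by
  have hev := (hf.continuousAt.eventually_ne hf0).and
    (hf.eventually_analyticAt.and (hh.eventually_analyticAt.and hW))
  obtain ⟨ε, hε, hball⟩ := Metric.eventually_nhds_iff_ball.1 hev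
  have hd : ∀ y ∈ Metric.ball x ε, HasDerivAt (fun y => h y / f y) 0 y := by
    intro y hy
    obtain ⟨g0, g1, g2, g3⟩ := hball y hy
    have := g2.differentiableAt.hasDerivAt.fun_div g1.differentiableAt.hasDerivAt g0
    rw [wronskian] at g3
    rwa [show deriv h y * f y - h y * deriv f y = 0 by linear_combination g3, zero_div] at this
  filter_upwards [Metric.ball_mem_nhds x hε] with y hy
  have hc := Metric.isOpen_ball.is_const_of_deriv_eq_zero (convex_ball x ε).isPreconnected
    (fun y hy => (hd y hy).differentiableAt.differentiableWithinAt)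
    (fun y hy => (hd y hy).deriv) hy (Metric.mem_ball_self hε)
  simp only [hh0, zero_div, div_eq_zero_iff, (hball y hy).1, or_false] at hc
  exact hc

end Wronskian

/-! ### Uniqueness of the even doubly periodic solution -/

section Uniqueness

variable {L : PeriodPair} {l : Fin 4 → ℕ} {M : ℕ} {r : Fin M → ℕ} {δ s : Fin M → ℂ} {E : ℂ}
  {f g : ℂ → ℂ}

lemma periodic_of_mem (hf : f ∈ evenPeriodicSolutions L l r δ s E) (x : ℂ) {ω : ℂ}
    (hω : ω ∈ L.lattice) : f (x + ω) = f x := by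
  obtain ⟨-, -, -, -, f4, f5, -⟩ := hf
  obtain ⟨m, n, rfl⟩ := L.mem_lattice.1 hω
  have h1 : Function.Periodic f (m * L.ω₁) := Function.Periodic.int_mul f4 m
  have h2 : Function.Periodic f (n * L.ω₂) := Function.Periodic.int_mul f5 n
  exact h1.add_period h2 x

lemma deriv_deriv_deriv_of_mem (hf : f ∈ evenPeriodicSolutions L l r δ s E) {x : ℂ}
    (hx : x ∉ singularSet L δ) :
    deriv (deriv (deriv f)) x = 4 * (potential L l r δ s x - E) * deriv f x
      + 2 * deriv (fun y => potential L l r δ s y - E) x * f x := by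
  have h := hf.2.2.2.2.2.2 x hx
  simp only [iteratedDeriv_succ, iteratedDeriv_zero] at h
  rw [deriv_sub_const]
  linear_combination h

/-- The Wronskian of two solutions satisfies the equation again. -/
lemma wronskian_ode (hδ : ∀ k, 2 * δ k ∉ L.lattice) (hf : f ∈ evenPeriodicSolutions L l r δ s E)
    (hg : g ∈ evenPeriodicSolutions L l r δ s E) {x : ℂ} (hx : x ∉ singularSet L δ) :
    deriv (deriv (deriv (wronskian f g))) x
      = 4 * (potential L l r δ s x - E) * deriv (wronskian f g) x
        + 2 * deriv (fun y => potential L l r δ s y - E) x * wronskian f g x :=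
  deriv_deriv_deriv_wronskian (u := fun y => potential L l r δ s y - E) (hf.2.1 x hx) (hg.2.1 x hx)
    ((analyticAt_potential hδ l r s hx).fun_sub analyticAt_const)
    ((eventually_notMem_singularSet hx).mono fun _ hy => deriv_deriv_deriv_of_mem hf hy)
    ((eventually_notMem_singularSet hx).mono fun _ hy => deriv_deriv_deriv_of_mem hg hy)

lemma tendsto_sq_mul_potential_halfPeriod (hδ : ∀ k, 2 * δ k ∉ L.lattice) {x₀ : ℂ} {i : Fin 4}
    (hi : x₀ - halfPeriod L i ∈ L.lattice) :
    Tendsto (fun z => (z - x₀) ^ 2 * (potential L l r δ s z - E)) (𝓝[≠] x₀)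
      (𝓝 ((l i : ℂ) * (l i + 1))) := by
  have h2 := two_mul_mem_of_sub_halfPeriod_mem L hi
  have hc : ∀ k, x₀ + -δ k ∉ L.lattice := fun k h => hδ k (by
    have := L.lattice.sub_mem (L.lattice.sub_mem h2 h) h
    rwa [show 2 * x₀ - (x₀ + -δ k) - (x₀ + -δ k) = 2 * δ k by ring] at this)
  have hd : ∀ k, x₀ + δ k ∉ L.lattice := fun k h => hδ k (by
    have := L.lattice.sub_mem (L.lattice.add_mem h h) h2
    rwa [show x₀ + δ k + (x₀ + δ k) - 2 * x₀ = 2 * δ k by ring] at this)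
  have := tendsto_sq_mul_potential hδ l r s E (x₀ := x₀) (a := fun j => if j = i then 1 else 0)
    (c := 0) (d := 0) (fun j => ?_)
    (fun k => by simpa [sub_eq_add_neg] using tendsto_sq_mul_weierstrassP_add_zero (hc k))
    (fun k => tendsto_sq_mul_weierstrassP_add_zero (hd k))
  · simpa using this
  · split_ifs with hj
    · exact tendsto_sq_mul_weierstrassP_add ((sub_halfPeriod_mem_iff L _ _).1 (hj ▸ hi))
    · refine tendsto_sq_mul_weierstrassP_add_zero fun h => halfPeriod_add_notMem L hj ?_
      simpa using L.lattice.sub_mem h hi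

/-- The leading coefficient of the potential at `±δ`, for weight `r = 1`: `r/2 (r/2 + 1) = 3/4`. -/
lemma tendsto_sq_mul_potential_pole [Subsingleton (Fin M)] (hδ : ∀ k, 2 * δ k ∉ L.lattice)
    (hr : ∀ k, r k = 1) {x₀ : ℂ} {k : Fin M} (hk : x₀ - δ k ∈ L.lattice ∨ x₀ + δ k ∈ L.lattice) :
    Tendsto (fun z => (z - x₀) ^ 2 * (potential L l r δ s z - E)) (𝓝[≠] x₀) (𝓝 (3 / 4)) := by
  have h2 : 2 * x₀ ∉ L.lattice := by
    intro h2
    rcases hk with hk | hk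
    · have := L.lattice.sub_mem (L.lattice.sub_mem h2 hk) hk
      rw [show 2 * x₀ - (x₀ - δ k) - (x₀ - δ k) = 2 * δ k by ring] at this
      exact hδ k this
    · have := L.lattice.sub_mem (L.lattice.add_mem hk hk) h2
      rw [show x₀ + δ k + (x₀ + δ k) - 2 * x₀ = 2 * δ k by ring] at this
      exact hδ k this
  have ha : ∀ i, Tendsto (fun z => (z - x₀) ^ 2 * L.weierstrassP (z + halfPeriod L i)) (𝓝[≠] x₀)
      (𝓝 ((0 : Fin 4 → ℂ) i)) := fun i =>
    tendsto_sq_mul_weierstrassP_add_zero fun h =>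
      h2 (two_mul_mem_of_sub_halfPeriod_mem L ((sub_halfPeriod_mem_iff L _ _).2 h))
  have hsum : ∀ F : Fin M → ℂ, ∑ j, F j = F k := fun F => by
    rw [Finset.sum_eq_single k (fun j _ hj => absurd (Subsingleton.elim j k) hj) (by simp)]
  have hother : ∀ j, x₀ - δ j ∈ L.lattice → x₀ + δ j ∉ L.lattice := by
    intro j h h'
    refine h2 ?_
    have := L.lattice.add_mem h h'
    rwa [show x₀ - δ j + (x₀ + δ j) = 2 * x₀ by ring] at this
  rcases hk with hk | hk
  · have := tendsto_sq_mul_potential hδ l r s E (c := 1) (d := 0) ha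
      (fun j => by
        rw [Subsingleton.elim j k]
        simpa [sub_eq_add_neg] using
          tendsto_sq_mul_weierstrassP_add (c := -δ k) (by simpa [sub_eq_add_neg] using hk))
      (fun j => by
        rw [Subsingleton.elim j k]
        exact tendsto_sq_mul_weierstrassP_add_zero (hother k hk))
    rw [hsum] at this
    norm_num [hr] at this
    exact this
  · have := tendsto_sq_mul_potential hδ l r s E (c := 0) (d := 1) ha
      (fun j => by
        rw [Subsingleton.elim j k]
        simpa [sub_eq_add_neg] using tendsto_sq_mul_weierstrassP_add_zero (c := -δ k)
          (fun h => hother k (by simpa [sub_eq_add_neg] using h) hk))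
      (fun j => by
        rw [Subsingleton.elim j k]
        exact tendsto_sq_mul_weierstrassP_add hk)
    rw [hsum] at this
    norm_num [hr] at this
    exact this

/-- At a half period the Wronskian is odd, and the only odd exponent allowed by the indicial
equation is `1`. -/
lemma order_wronskian_halfPeriod (hδ : ∀ k, 2 * δ k ∉ L.lattice)
    (hf : f ∈ evenPeriodicSolutions L l r δ s E) (hg : g ∈ evenPeriodicSolutions L l r δ s E)
    {x₀ : ℂ} (hx : 2 * x₀ ∈ L.lattice) :
    ((1 : ℤ) : WithTop ℤ) ≤ meromorphicOrderAt (wronskian f g) x₀ := by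
  have hm := meromorphic_wronskian hf.1 hg.1 x₀
  rcases eq_or_ne (meromorphicOrderAt (wronskian f g) x₀) ⊤ with htop | htop
  · rw [htop]; exact le_top
  obtain ⟨n, hn⟩ := WithTop.ne_top_iff_exists.1 htop
  obtain ⟨i, hi⟩ := mem_lattice_of_halfPeriod L hx
  have hind := indicial_equation ((meromorphic_potential l r s x₀).fun_sub (MeromorphicAt.const E _))
    (tendsto_sq_mul_potential_halfPeriod hδ hi) hm hn.symm
    ((eventually_notMem_singularSet_nhdsNE L δ x₀).mono fun _ hy => wronskian_ode hδ hf hg hy)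
  have hodd : (-1 : ℂ) ^ n = -1 := by
    refine neg_one_zpow_order_of_reflection hm (Eventually.of_forall fun t => ?_) hn.symm
    have h1 := wronskian_neg_of_even hf.2.2.2.1 hg.2.2.2.1 (x₀ - t)
    have h2 := wronskian_add_period (fun x => periodic_of_mem hf x hx)
      (fun x => periodic_of_mem hg x hx) (-(x₀ - t))
    rw [show -(x₀ - t) + 2 * x₀ = x₀ + t by ring] at h2
    rw [h2, h1]; ring
  rw [← hn, order_eq_one_of_indicial hodd hind]

lemma order_wronskian_pole [Subsingleton (Fin M)] (hδ : ∀ k, 2 * δ k ∉ L.lattice)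
    (hr : ∀ k, r k = 1)
    (hf : f ∈ evenPeriodicSolutions L l r δ s E) (hg : g ∈ evenPeriodicSolutions L l r δ s E)
    {x₀ : ℂ} {k : Fin M} (hk : x₀ - δ k ∈ L.lattice ∨ x₀ + δ k ∈ L.lattice) :
    ((-1 : ℤ) : WithTop ℤ) ≤ meromorphicOrderAt (wronskian f g) x₀ := by
  have hm := meromorphic_wronskian hf.1 hg.1 x₀
  rcases eq_or_ne (meromorphicOrderAt (wronskian f g) x₀) ⊤ with htop | htop
  · rw [htop]; exact le_top
  obtain ⟨n, hn⟩ := WithTop.ne_top_iff_exists.1 htop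
  have hind := indicial_equation ((meromorphic_potential l r s x₀).fun_sub (MeromorphicAt.const E _))
    (tendsto_sq_mul_potential_pole hδ hr hk) hm hn.symm
    ((eventually_notMem_singularSet_nhdsNE L δ x₀).mono fun _ hy => wronskian_ode hδ hf hg hy)
  rw [← hn]
  exact WithTop.coe_le_coe.2 (order_ge_of_indicial hind)

lemma analyticAt_wronskian (hf : f ∈ evenPeriodicSolutions L l r δ s E)
    (hg : g ∈ evenPeriodicSolutions L l r δ s E) {x : ℂ} (hx : x ∉ singularSet L δ) :
    AnalyticAt ℂ (wronskian f g) x :=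
  ((hf.2.1 x hx).fun_mul (hg.2.1 x hx).deriv).fun_sub ((hf.2.1 x hx).deriv.fun_mul (hg.2.1 x hx))

/-- The Wronskian of two even doubly periodic solutions vanishes. -/
theorem wronskian_eq_zero [Subsingleton (Fin M)] (hδ : ∀ k, 2 * δ k ∉ L.lattice)
    (hr : ∀ k, r k = 1)
    (hf : f ∈ evenPeriodicSolutions L l r δ s E) (hg : g ∈ evenPeriodicSolutions L l r δ s E)
    {x : ℂ} (hx : x ∉ singularSet L δ) : wronskian f g x = 0 := by
  -- without poles off the half periods, any `b` will do
  obtain ⟨b, hb⟩ : ∃ b, ∀ k, L.weierstrassP (δ k) = b := by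
    rcases isEmpty_or_nonempty (Fin M) with h | ⟨⟨k⟩⟩
    · exact ⟨0, fun k => isEmptyElim k⟩
    · exact ⟨L.weierstrassP (δ k), fun j => by rw [Subsingleton.elim j k]⟩
  have hnonneg : ∀ x ∉ singularSet L δ, 0 ≤ meromorphicOrderAt (wronskian f g) x := fun x hx =>
    (analyticAt_wronskian hf hg hx).meromorphicOrderAt_nonneg
  have key := eventually_eq_zero_of_order (meromorphic_wronskian hf.1 hg.1)
    (fun x ω hω => wronskian_add_period (fun x => periodic_of_mem hf x hω)
      (fun x => periodic_of_mem hg x hω) x) b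
    (fun x hx => order_wronskian_halfPeriod hδ hf hg hx) ?_ ?_ x
  · exact ((analyticAt_wronskian hf hg hx).frequently_zero_iff_eventually_zero.1
      key.frequently).self_of_nhds
  · intro y hy
    by_cases hyS : y ∈ singularSet L δ
    · rcases hyS with ⟨i, hi⟩ | ⟨k, hk⟩
      · exact absurd (two_mul_mem_of_sub_halfPeriod_mem L hi) hy
      · exact order_wronskian_pole hδ hr hf hg hk
    · exact le_trans (by exact_mod_cast (by norm_num : (-1 : ℤ) ≤ 0)) (hnonneg y hyS)
  · intro y hy hyb
    refine hnonneg y ?_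
    rintro (⟨i, hi⟩ | ⟨k, hk | hk⟩)
    · exact hy (two_mul_mem_of_sub_halfPeriod_mem L hi)
    · refine hyb ?_
      rw [← hb k, ← weierstrassP_add_lattice L (δ k) hk]
      congr 1; ring
    · refine hyb ?_
      rw [← hb k, ← L.weierstrassP_neg (δ k), ← weierstrassP_add_lattice L (-δ k) hk]
      congr 1; ring

/-- The identity theorem for elements of the solution space. -/
lemma eq_zero_of_eventually_eq_zero (hf : f ∈ evenPeriodicSolutions L l r δ s E) {x : ℂ}
    (h : ∀ᶠ y in 𝓝 x, f y = 0) : f = 0 := by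
  have htop : ∀ y, meromorphicOrderAt f y = ⊤ := by
    intro y
    by_contra hne
    refine MeromorphicOn.meromorphicOrderAt_ne_top_of_isPreconnected (U := Set.univ) (x := y) (y := x)
      (fun z _ => hf.1 z) isPreconnected_univ (Set.mem_univ _) (Set.mem_univ _) hne ?_
    exact meromorphicOrderAt_eq_top_iff.2 (h.filter_mono nhdsWithin_le_nhds)
  funext y
  by_cases hy : y ∈ singularSet L δ
  · exact hf.2.2.1 y hy
  · exact ((hf.2.1 y hy).frequently_zero_iff_eventually_zero.1
      (meromorphicOrderAt_eq_top_iff.1 (htop y)).frequently).self_of_nhds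

/-- Two even doubly periodic solutions are proportional. -/
theorem exists_smul_eq [Subsingleton (Fin M)] (hδ : ∀ k, 2 * δ k ∉ L.lattice) (hr : ∀ k, r k = 1)
    (hf : f ∈ evenPeriodicSolutions L l r δ s E) (hf0 : f ≠ 0)
    (hg : g ∈ evenPeriodicSolutions L l r δ s E) : ∃ c : ℂ, c • f = g := by
  obtain ⟨x, hx⟩ := Function.ne_iff.1 hf0
  have hxS : x ∉ singularSet L δ := fun h => hx (hf.2.2.1 x h)
  -- `g - c f` vanishes at a point where `f` does not
  set c := g x / f x with hc
  have hh : g - c • f ∈ evenPeriodicSolutions L l r δ s E :=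
    Submodule.sub_mem _ hg (Submodule.smul_mem _ c hf)
  refine ⟨c, ?_⟩
  rw [eq_comm, ← sub_eq_zero]
  refine eq_zero_of_eventually_eq_zero hh (eventually_eq_zero_of_wronskian (hf.2.1 x hxS)
    (hh.2.1 x hxS) hx ?_ ((eventually_notMem_singularSet hxS).mono fun y hy =>
      wronskian_eq_zero hδ hr hf hh hy))
  simp only [Pi.sub_apply, Pi.smul_apply, smul_eq_mul, hc]
  rw [div_mul_cancel₀ _ hx, sub_self]

end Uniqueness

end FuchsElliptic

theorem mainTheorem7 (L : PeriodPair) (l : Fin 4 → ℕ) (M : ℕ) (r : Fin M → ℕ)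
    (δ s : Fin M → ℂ) (E : ℂ)
    (hδ : ∀ k, 2 * δ k ∉ L.lattice)
    (happ : ∀ k, FuchsElliptic.IsApparent (FuchsElliptic.fuchsP L l r δ)
      (FuchsElliptic.fuchsQ L l r δ s E) (FuchsElliptic.bVal L δ k))
    (hM : M = 0 ∨ (M = 1 ∧ ∀ k, r k = 1)) :
    Module.finrank ℂ (FuchsElliptic.evenPeriodicSolutions L l r δ s E) = 1 := by
  have hsub : Subsingleton (Fin M) := Fin.subsingleton_iff_le_one.2 (by omega)
  have hr : ∀ k, r k = 1 := by
    rcases hM with rfl | ⟨-, hr⟩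
    · exact fun k => k.elim0
    · exact hr
  obtain ⟨f, hf, hf0⟩ :=
    FuchsElliptic.exists_ne_zero_mem_evenPeriodicSolutions L l M r δ s E hδ happ hM
  refine finrank_eq_one_iff'.2 ⟨⟨f, hf⟩, fun h => hf0 (congrArg Subtype.val h), ?_⟩
  rintro ⟨g, hg⟩
  obtain ⟨c, hc⟩ := FuchsElliptic.exists_smul_eq hδ hr hf hf0 hg
  exact ⟨c, Subtype.ext hc⟩
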